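/- Let $1<\alpha<2$. For bounded $w:\mathbb R\to\mathbb R$ with bounded first and second derivatives put $$\Lambda^\alpha w(x)=-C(\alpha)\int_{\mathbb R}\frac{w(x+z)-w(x)-w'(x)z}{|z|^{1+\alpha}}\,dz,\qquad C(\alpha)^{-1}=\int_{\mathbb R}\frac{1-\cos z}{|z|^{1+\alpha}}\,dz ,$$ that is, $\Lambda^\alpha=(-\partial_x^2)^{\alpha/2}$ is the operator with Fourier symbol $|\xi|^\alpha$. For $u_0\in L^\infty(\mathbb R)$, a solution of the fractal Burgers problem $$u_t+\Lambda^\alpha u+uu_x=0\quad (x\in\mathbb R,\ t>0),\qquad u(\cdot,0)=u_0,$$ means a function $u=u(x,t)$ such that, for every $T>0$: $u$ is continuous and bounded on $\mathbb R\times(0,T)$; for every $a\in(0,T)$, $u$ is $C^\infty$ on $\mathbb R\times(a,T)$ with all derivatives bounded there; the equation holds pointwise on $\mathbb R\times(0,T)$; and $u(\cdot,t)\to u_0$ weak-$*$ in $L^\infty(\mathbb R)$ as $t\to0^+$. **Theorem 2.2.** Let $1<\alpha<2$. (i) Suppose that, for some $c\in\mathbb R$ and some finite signed Borel measure $m$ on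 $\mathbb R$, $u_0(x)=c+m((-\infty,x])$ for almost every $x\in\mathbb R$ (that is, $u_0=c+H*m$, where $H$ is the indicator function of $[0,\infty)$). Then the solution $u$ with initial datum $u_0$ satisfies $u_x\in C((0,T];L^p(\mathbb R))$ for every $1\le p\le\infty$ and every $T>0$. (ii) Let $u$ and $\widetilde u$ be two such solutions, with initial data $u_0$ and $\widetilde u_0$ both of the form in (i) (with possibly different constants and measures). Suppose that $\widetilde u_x(x,t)\ge 0$ for almost every $(x,t)\in\mathbb R\times(0,\infty)$ and that $u_0-\widetilde u_0\in L^1(\mathbb R)$. Then $$\|u(t)-\widetilde u(t)\|_1\le\|u_0-\widetilde u_0\|_1\qquad\text{for all } t>0 .$$ -/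

import Mathlib

open MeasureTheory Set Filter Topology
open scoped ENNReal ContDiff

noncomputable section

/-- The normalising constant `C(α)` of the integral representation of `Λ^α`: with this choice
`Λ^α` multiplies the plane wave of frequency `ξ` by exactly `|ξ| ^ α`. -/
def fracLaplacianConst (α : ℝ) : ℝ :=
  (∫ z : ℝ, (1 - Real.cos z) / |z| ^ (1 + α))⁻¹

/-- The operator `Λ^α = (-∂²/∂x²)^{α/2}`, `1 < α < 2`, with Fourier symbol `|ξ| ^ α`, on bounded
functions with bounded first and second derivatives (not necessarily decaying at infinity, so that
it has to be given by its integral representation; the integral converges absolutely there). -/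
def fracLaplacian (α : ℝ) (w : ℝ → ℝ) (x : ℝ) : ℝ :=
  -fracLaplacianConst α * ∫ z : ℝ, (w (x + z) - w x - deriv w x * z) / |z| ^ (1 + α)

/-- `u₀ = c + H * m` almost everywhere, for a constant `c` and a finite signed measure `m`, where
`H` is the indicator function of `[0, ∞)`; thus `(H * m)(x) = m((-∞, x])`. -/
def IsStepConvolution (u₀ : ℝ → ℝ) : Prop :=
  ∃ (c : ℝ) (m : SignedMeasure ℝ), ∀ᵐ x : ℝ, u₀ x = c + m (Iic x)

/-- `u ∈ C_b(S)`: `u` is continuous and bounded on `S`; here `u` takes time first, then space. -/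
def IsCb (u : ℝ → ℝ → ℝ) (S : Set (ℝ × ℝ)) : Prop :=
  ContinuousOn (fun z : ℝ × ℝ => u z.1 z.2) S ∧ ∃ C : ℝ, ∀ z ∈ S, |u z.1 z.2| ≤ C

/-- `u ∈ C_b^∞(S)` for an open set `S`: `u` is smooth on `S`, and its derivatives of every order
(including order zero) are bounded on `S`. -/
def IsCbSmooth (u : ℝ → ℝ → ℝ) (S : Set (ℝ × ℝ)) : Prop :=
  ContDiffOn ℝ ∞ (fun z : ℝ × ℝ => u z.1 z.2) S ∧
    ∀ n : ℕ, ∃ C : ℝ, ∀ z ∈ S, ‖iteratedFDeriv ℝ n (fun z : ℝ × ℝ => u z.1 z.2) z‖ ≤ C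

/-- `u = u(t, x)` solves `u_t + Λ^α u + u u_x = 0` for `x ∈ ℝ`, `t > 0`, with `u(0, ·) = u₀`. -/
structure IsFractalBurgersSolution (α : ℝ) (u₀ : ℝ → ℝ) (u : ℝ → ℝ → ℝ) : Prop where
  bounded : ∀ T : ℝ, 0 < T → IsCb u (Ioo 0 T ×ˢ univ)
  smooth : ∀ T : ℝ, 0 < T → ∀ a ∈ Ioo 0 T, IsCbSmooth u (Ioo a T ×ˢ univ)
  equation : ∀ t : ℝ, 0 < t → ∀ x : ℝ,
    deriv (fun s => u s x) t + fracLaplacian α (u t) x + u t x * deriv (u t) x = 0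
  /-- `u(t, ·) → u₀` weak-* in `L^∞(ℝ)` as `t → 0⁺`. -/
  initial : ∀ φ : ℝ → ℝ, Integrable φ →
    Tendsto (fun t => ∫ x, u t x * φ x) (𝓝[>] 0) (𝓝 (∫ x, u₀ x * φ x))

/-- `f ∈ C(I; L^p(ℝ))`: every `f t`, `t ∈ I`, is in `L^p(ℝ)`, and `t ↦ f t` is continuous from `I`
to the Banach space `L^p(ℝ)`. -/
def IsContinuousInLp (p : ℝ≥0∞) [Fact (1 ≤ p)] (I : Set ℝ) (f : ℝ → ℝ → ℝ) : Prop :=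
  ∃ h : ∀ t : I, MemLp (f t) p (volume : Measure ℝ), Continuous fun t : I => (h t).toLp (f t)

end

/-!
The equation contracts the distance of any two solutions in `L¹`; both parts follow from this.

*Contraction.* For two solutions `u`, `v` with difference `w`, Kato's inequality gives
`|w|_t + Λ^α |w| + (((u + v) / 2) |w|)_x ≤ 0`: the convective term is a total derivative, and the
chain-rule defect of `Λ^α` has a sign for convex functions
(`mul_fracLaplacian_sub_fracLaplacian_comp`). As `w` need not be integrable a priori, the inequality
is tested against the Cauchy weight `cauchyWeight 0 R`. For `α > 1` this weight dominates `R` times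
its derivative and, up to a constant, `R ^ α` times its image under `Λ^α` (`abs_cauchyDual_le`), and
`Λ^α` can be moved onto it (`isDualPair_cauchyWeight`). Hence the weighted `L¹` norm of `w` grows at
most exponentially, at the rate `growthRate`, which vanishes as `R → ∞`
(`weighted_integral_abs_sub_le`).

*Initial time.* The datum is attained only weakly-*, while the contraction needs strong convergence
along some sequence of times. Weak convergence together with the equation bounds the distance of
the mollifications of `u(s)` and of the datum at scale `ε` by a multiple of
`s ε ^ (-α) + s ε⁻¹`, which is small when `ε` is a large multiple of `s ^ (1 / α)`. The distance of
`u(s)` to its own mollification is controlled, up to the tail of the kernel, by the square root of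
`ε ^ α` times the weighted Gagliardo energy `F(s)`. The energy inequality
(`IsFractalBurgersSolution.energy`) bounds the integral of `F` in time, so that `s F(s)` is small
along a sequence `s → 0` (`exists_mul_le_of_dissipation`). The energies of the two
solutions are added, so that one sequence serves both (`exists_time_near_initial`). The result is
`integrable_sub_and_integral_abs_sub_le`, which is the second part of the theorem without the sign
condition on the derivative.

*The space derivative.* Applied to `u` and its translate by `a`, the contraction gives
`‖u(t, · + a) - u(t, ·)‖₁ ≤ a V` with `V` the total variation of the datum, and so `u_x(t) ∈ L¹` by
Fatou's lemma. Testing Kato's inequality against the difference of two Cauchy weights shows that no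
mass of `u_x` escapes to infinity on compact time intervals
(`IsFractalBurgersSolution.integral_abs_deriv_tail_le`). As `u_x` is Lipschitz in time for the
uniform norm, away from the initial time, it is continuous in time for the `L¹` norm, and by
interpolation for every `L^p` norm.
-/

/-! ### The singular kernel and the operator on functions with quadratic Taylor bounds -/

/-- An integrable majorant, up to constants, of both the first-order Taylor remainder and the
symmetric second difference of a bounded `C^{1,1}` function, divided by `|z| ^ (1 + α)`. -/
noncomputable def levyMajorant (α z : ℝ) : ℝ := min |z| (z ^ 2) / |z| ^ (1 + α)

lemma levyMajorant_nonneg (α z : ℝ) : 0 ≤ levyMajorant α z := by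
  unfold levyMajorant; positivity

lemma measurable_levyMajorant (α : ℝ) : Measurable (levyMajorant α) := by
  unfold levyMajorant; fun_prop

lemma integrableOn_Ioi_levyMajorant {α : ℝ} (hα₁ : 1 < α) (hα₂ : α < 2) :
    IntegrableOn (levyMajorant α) (Ioi 0) := by
  rw [← Ioc_union_Ioi_eq_Ioi zero_le_one]
  refine IntegrableOn.union ?_ ?_
  · have h : IntegrableOn (fun z : ℝ => z ^ (1 - α)) (Ioc 0 1) :=
      (intervalIntegrable_iff_integrableOn_Ioc_of_le zero_le_one).1
        (intervalIntegral.intervalIntegrable_rpow' (by linarith))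
    refine Integrable.mono' h (measurable_levyMajorant α).aestronglyMeasurable ?_
    refine (ae_restrict_iff' measurableSet_Ioc).2 (Eventually.of_forall fun z hz => ?_)
    rw [Real.norm_of_nonneg (levyMajorant_nonneg α z), levyMajorant, abs_of_pos hz.1,
      div_le_iff₀ (Real.rpow_pos_of_pos hz.1 _), ← Real.rpow_add hz.1]
    calc min z (z ^ 2) ≤ z ^ 2 := min_le_right _ _
      _ = z ^ (1 - α + (1 + α)) := by
        rw [← Real.rpow_natCast]; congr 1; push_cast; ring
  · have h : IntegrableOn (fun z : ℝ => z ^ (-α)) (Ioi 1) :=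
      integrableOn_Ioi_rpow_of_lt (by linarith) zero_lt_one
    refine Integrable.mono' h (measurable_levyMajorant α).aestronglyMeasurable ?_
    refine (ae_restrict_iff' measurableSet_Ioi).2 (Eventually.of_forall fun z hz => ?_)
    have hz0 : (0 : ℝ) < z := zero_lt_one.trans hz
    rw [Real.norm_of_nonneg (levyMajorant_nonneg α z), levyMajorant, abs_of_pos hz0,
      div_le_iff₀ (Real.rpow_pos_of_pos hz0 _), ← Real.rpow_add hz0]
    calc min z (z ^ 2) ≤ z := min_le_left _ _
      _ = z ^ (-α + (1 + α)) := by
        rw [show -α + (1 + α) = 1 by ring, Real.rpow_one]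

lemma integrable_levyMajorant {α : ℝ} (hα₁ : 1 < α) (hα₂ : α < 2) :
    Integrable (levyMajorant α) := by
  have h := (integrableOn_Ioi_levyMajorant hα₁ hα₂).integrable_indicator measurableSet_Ioi
  refine Integrable.mono' (h.add h.comp_neg) (measurable_levyMajorant α).aestronglyMeasurable ?_
  refine Eventually.of_forall fun z => ?_
  rw [Real.norm_of_nonneg (levyMajorant_nonneg α z)]
  have hi : ∀ y, 0 ≤ (Ioi (0 : ℝ)).indicator (levyMajorant α) y :=
    fun y => indicator_nonneg (fun y _ => levyMajorant_nonneg α y) y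
  rcases lt_trichotomy z 0 with hz | hz | hz
  · have : levyMajorant α z = (Ioi (0 : ℝ)).indicator (levyMajorant α) (-z) := by
      rw [indicator_of_mem (by simpa using hz)]; simp [levyMajorant]
    rw [this]; exact le_add_of_nonneg_left (hi z)
  · simp [hz, levyMajorant]
  · have : levyMajorant α z = (Ioi (0 : ℝ)).indicator (levyMajorant α) z :=
      (indicator_of_mem (by simpa using hz) _).symm
    rw [this]; exact le_add_of_nonneg_right (hi _)

lemma fracLaplacianConst_pos {α : ℝ} (hα₁ : 1 < α) (hα₂ : α < 2) : 0 < fracLaplacianConst α := by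
  unfold fracLaplacianConst
  rw [inv_pos]
  have hnn : ∀ z : ℝ, 0 ≤ (1 - Real.cos z) / |z| ^ (1 + α) := fun z =>
    div_nonneg (by linarith [Real.cos_le_one z]) (by positivity)
  have hint : Integrable fun z : ℝ => (1 - Real.cos z) / |z| ^ (1 + α) := by
    refine Integrable.mono' ((integrable_levyMajorant hα₁ hα₂).const_mul 2)
      (Measurable.aestronglyMeasurable (by fun_prop)) (Eventually.of_forall fun z => ?_)
    rw [Real.norm_of_nonneg (hnn z), levyMajorant, ← mul_div_assoc]
    gcongr
    rw [mul_min_of_nonneg _ _ zero_le_two]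
    have h1 := Real.one_sub_sq_div_two_le_cos (x := z)
    refine le_min ?_ (by nlinarith [sq_nonneg z])
    rcases le_total |z| 1 with h | h
    · nlinarith [sq_abs z, abs_nonneg z]
    · linarith [Real.neg_one_le_cos z]
  rw [integral_pos_iff_support_of_nonneg hnn hint]
  refine lt_of_lt_of_le ?_ (measure_mono (s := Ioo (0 : ℝ) 1) fun z hz => ?_)
  · simp
  · have : Real.cos z < 1 := by
      have := Real.cos_lt_cos_of_nonneg_of_le_pi le_rfl
        (hz.2.le.trans (by linarith [Real.pi_gt_three])) hz.1
      simpa using this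
    exact (div_pos (by linarith) (Real.rpow_pos_of_pos (abs_pos.2 hz.1.ne') _)).ne'

/-- Bounded differentiable functions with a uniform quadratic Taylor bound: the class (bounded
`C^{1,1}` functions) on which the integral defining `fracLaplacian` converges absolutely. -/
structure IsC11 (B : ℝ) (f : ℝ → ℝ) : Prop where
  diff : Differentiable ℝ f
  bdd : ∀ x, |f x| ≤ B
  taylor : ∀ x z, |f (x + z) - f x - deriv f x * z| ≤ B * z ^ 2

namespace IsC11

variable {B : ℝ} {f g : ℝ → ℝ}

lemma nonneg (hf : IsC11 B f) : 0 ≤ B := (abs_nonneg _).trans (hf.bdd 0)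

lemma continuous (hf : IsC11 B f) : Continuous f := hf.diff.continuous

lemma abs_deriv_le (hf : IsC11 B f) (x : ℝ) : |deriv f x| ≤ 3 * B := by
  have h := hf.taylor x 1
  have h1 := hf.bdd x
  have h2 := hf.bdd (x + 1)
  rw [abs_le] at *
  constructor <;> linarith

lemma abs_sub_sq_le (hf : IsC11 B f) (x z : ℝ) :
    (f (x + z) - f x) ^ 2 ≤ 16 * B ^ 2 * z ^ 2 := by
  have hB := hf.nonneg
  have h3 : |f (x + z) - f x| ≤ 4 * B * |z| := by
    rcases le_total |z| 1 with h | h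
    · have := hf.taylor x z
      have h1 : |deriv f x * z| ≤ 3 * B * |z| := by
        rw [abs_mul]; gcongr; exact hf.abs_deriv_le x
      have h2 : B * z ^ 2 ≤ B * |z| := by
        gcongr; rw [← sq_abs]; nlinarith [abs_nonneg z]
      calc |f (x + z) - f x| = |(f (x + z) - f x - deriv f x * z) + deriv f x * z| := by ring_nf
        _ ≤ _ := abs_add_le _ _
        _ ≤ _ := by linarith
    · have h1 := abs_sub (f (x + z)) (f x)
      have h2 := hf.bdd x
      have h3 := hf.bdd (x + z)
      nlinarith
  calc (f (x + z) - f x) ^ 2 = |f (x + z) - f x| ^ 2 := (sq_abs _).symm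
    _ ≤ (4 * B * |z|) ^ 2 := by gcongr
    _ = _ := by rw [mul_pow, sq_abs]; ring

lemma taylor_min (hf : IsC11 B f) (x z : ℝ) :
    |f (x + z) - f x - deriv f x * z| ≤ 5 * B * min |z| (z ^ 2) := by
  have hB := hf.nonneg
  rw [mul_min_of_nonneg _ _ (by positivity)]
  refine le_min ?_ ((hf.taylor x z).trans (by nlinarith [sq_nonneg z]))
  rcases le_total |z| 1 with h | h
  · refine (hf.taylor x z).trans ?_
    rw [← sq_abs]; nlinarith [abs_nonneg z, mul_nonneg hB (abs_nonneg z)]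
  · have h1 : |deriv f x * z| ≤ 3 * B * |z| := by
      rw [abs_mul]; gcongr; exact hf.abs_deriv_le x
    have h2 := abs_sub (f (x + z)) (f x)
    have h4 := abs_sub (f (x + z) - f x) (deriv f x * z)
    have h3 := hf.bdd x
    have h5 := hf.bdd (x + z)
    nlinarith

lemma integrable_taylor (hf : IsC11 B f) {α : ℝ} (hα₁ : 1 < α) (hα₂ : α < 2) (x : ℝ) :
    Integrable fun z => (f (x + z) - f x - deriv f x * z) / |z| ^ (1 + α) := by
  have := hf.continuous
  refine Integrable.mono' ((integrable_levyMajorant hα₁ hα₂).const_mul (5 * B))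
    (Measurable.aestronglyMeasurable (by fun_prop)) (Eventually.of_forall fun z => ?_)
  rw [norm_div, Real.norm_eq_abs, Real.norm_of_nonneg (by positivity), levyMajorant,
    ← mul_div_assoc]
  gcongr
  exact hf.taylor_min x z

lemma sub (hf : IsC11 B f) {B' : ℝ} (hg : IsC11 B' g) : IsC11 (B + B') fun x => f x - g x := by
  have hd : ∀ x, deriv (fun x => f x - g x) x = deriv f x - deriv g x := fun x =>
    deriv_fun_sub (hf.diff x) (hg.diff x)
  refine ⟨hf.diff.sub hg.diff, fun x => (abs_sub _ _).trans (add_le_add (hf.bdd x) (hg.bdd x)),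
    fun x z => ?_⟩
  rw [hd, show f (x + z) - g (x + z) - (f x - g x) - (deriv f x - deriv g x) * z =
    (f (x + z) - f x - deriv f x * z) - (g (x + z) - g x - deriv g x * z) by ring, add_mul]
  exact (abs_sub _ _).trans (add_le_add (hf.taylor x z) (hg.taylor x z))

/-- Composition with a function whose first-order Taylor remainder is quadratic on the range. -/
lemma comp (hf : IsC11 B f) {η η' : ℝ → ℝ} {M : ℝ} (hM : 0 ≤ M)
    (hη : ∀ y, HasDerivAt η (η' y) y) (h0 : ∀ x, |η (f x)| ≤ M) (h1 : ∀ x, |η' (f x)| ≤ M)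
    (h2 : ∀ a b, |η b - η a - η' a * (b - a)| ≤ M * (b - a) ^ 2) :
    IsC11 (M * (1 + B + 16 * B ^ 2)) fun x => η (f x) := by
  have hB := hf.nonneg
  have hd : ∀ x, HasDerivAt (fun x => η (f x)) (η' (f x) * deriv f x) x := fun x =>
    (hη (f x)).comp x (hf.diff x).hasDerivAt
  refine ⟨fun x => (hd x).differentiableAt, fun x => (h0 x).trans ?_, fun x z => ?_⟩
  · nlinarith [mul_nonneg hM hB, mul_nonneg hM (sq_nonneg B)]
  rw [(hd x).deriv, show η (f (x + z)) - η (f x) - η' (f x) * deriv f x * z =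
    (η (f (x + z)) - η (f x) - η' (f x) * (f (x + z) - f x)) +
      η' (f x) * (f (x + z) - f x - deriv f x * z) by ring]
  calc _ ≤ _ := abs_add_le _ _
    _ ≤ M * (16 * B ^ 2 * z ^ 2) + M * (B * z ^ 2) := by
      gcongr
      · exact (h2 _ _).trans (by gcongr; exact hf.abs_sub_sq_le x z)
      · rw [abs_mul]; gcongr
        · exact h1 x
        · exact hf.taylor x z
    _ ≤ _ := by nlinarith [mul_nonneg hM (sq_nonneg z)]

lemma comp_affine (hf : IsC11 B f) (x₀ R : ℝ) :
    IsC11 (B * (1 + R ^ 2)) fun y => f (x₀ + R * y) := by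
  have hB := hf.nonneg
  have hd : ∀ y, HasDerivAt (fun y => f (x₀ + R * y)) (deriv f (x₀ + R * y) * R) y := fun y => by
    have h1 : HasDerivAt (fun y : ℝ => x₀ + R * y) R y := by
      simpa using ((hasDerivAt_id y).const_mul R).const_add x₀
    exact (hf.diff _).hasDerivAt.comp y h1
  refine ⟨fun y => (hd y).differentiableAt, fun y => (hf.bdd _).trans ?_, fun y z => ?_⟩
  · nlinarith [mul_nonneg hB (sq_nonneg R)]
  · rw [(hd y).deriv, mul_add, ← add_assoc, mul_assoc]
    exact (hf.taylor _ _).trans (by nlinarith [mul_nonneg hB (sq_nonneg z)])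

end IsC11

lemma fracLaplacian_sub {α : ℝ} (hα₁ : 1 < α) (hα₂ : α < 2) {B B' : ℝ} {f g : ℝ → ℝ}
    (hf : IsC11 B f) (hg : IsC11 B' g) (x : ℝ) :
    fracLaplacian α (fun x => f x - g x) x = fracLaplacian α f x - fracLaplacian α g x := by
  unfold fracLaplacian
  rw [deriv_fun_sub (hf.diff x) (hg.diff x), ← mul_sub,
    ← integral_sub (hf.integrable_taylor hα₁ hα₂ x) (hg.integrable_taylor hα₁ hα₂ x)]
  congr 2
  ext z
  ring

/-- The chain-rule defect of `Λ^α`. For convex `η` the right-hand side is nonnegative, because of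
the tangent-line inequality under the integral sign. -/
lemma mul_fracLaplacian_sub_fracLaplacian_comp {α : ℝ} (hα₁ : 1 < α) (hα₂ : α < 2) {B B' : ℝ}
    {f η η' : ℝ → ℝ} (hf : IsC11 B f) (hη : ∀ y, HasDerivAt η (η' y) y)
    (hηf : IsC11 B' fun x => η (f x)) (x : ℝ) :
    Integrable (fun z => (η (f (x + z)) - η (f x) - η' (f x) * (f (x + z) - f x)) /
        |z| ^ (1 + α)) ∧
    η' (f x) * fracLaplacian α f x - fracLaplacian α (fun x => η (f x)) x =
      fracLaplacianConst α * ∫ z, (η (f (x + z)) - η (f x) - η' (f x) * (f (x + z) - f x)) /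
        |z| ^ (1 + α) := by
  have hd : deriv (fun x => η (f x)) x = η' (f x) * deriv f x :=
    ((hη (f x)).comp x (hf.diff x).hasDerivAt).deriv
  have h1 := (hf.integrable_taylor hα₁ hα₂ x).const_mul (η' (f x))
  have h2 := hηf.integrable_taylor hα₁ hα₂ x
  have he : (fun z => (η (f (x + z)) - η (f x) - η' (f x) * (f (x + z) - f x)) /
      |z| ^ (1 + α)) = fun z => (η (f (x + z)) - η (f x) - deriv (fun x => η (f x)) x * z) /
      |z| ^ (1 + α) - η' (f x) * ((f (x + z) - f x - deriv f x * z) / |z| ^ (1 + α)) := by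
    ext z; rw [hd]; ring
  refine ⟨he ▸ h2.sub h1, ?_⟩
  rw [he, integral_sub h2 h1, integral_const_mul]
  unfold fracLaplacian
  ring

lemma fracLaplacian_comp_affine {α : ℝ} (f : ℝ → ℝ) (hf : Differentiable ℝ f) (x₀ : ℝ) {R : ℝ}
    (hR : 0 < R) (y : ℝ) :
    fracLaplacian α (fun y => f (x₀ + R * y)) y = R ^ α * fracLaplacian α f (x₀ + R * y) := by
  have hd : deriv (fun y => f (x₀ + R * y)) y = deriv f (x₀ + R * y) * R := by
    have h1 : HasDerivAt (fun y : ℝ => x₀ + R * y) R y := by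
      simpa using ((hasDerivAt_id y).const_mul R).const_add x₀
    exact ((hf _).hasDerivAt.comp y h1).deriv
  unfold fracLaplacian
  set h : ℝ → ℝ := fun z => (f (x₀ + R * y + z) - f (x₀ + R * y) - deriv f (x₀ + R * y) * z) /
    |z| ^ (1 + α) with hh
  have : ∀ z, (f (x₀ + R * (y + z)) - f (x₀ + R * y) -
      deriv (fun y => f (x₀ + R * y)) y * z) / |z| ^ (1 + α) = R ^ (1 + α) * h (R * z) := by
    intro z
    simp only [hh]
    rw [hd, abs_mul, abs_of_pos hR, Real.mul_rpow hR.le (abs_nonneg z), mul_add, ← add_assoc,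
      mul_assoc]
    have : R ^ (1 + α) ≠ 0 := (Real.rpow_pos_of_pos hR _).ne'
    field_simp
  simp_rw [this]
  rw [integral_const_mul, Measure.integral_comp_mul_left, abs_inv, abs_of_pos hR,
    Real.rpow_add hR, Real.rpow_one, smul_eq_mul]
  field_simp

/-- The symmetrised form of the integral defining `Λ^α`; here the derivative has cancelled. -/
lemma fracLaplacian_eq_symm {α : ℝ} (hα₁ : 1 < α) (hα₂ : α < 2) {B : ℝ} {f : ℝ → ℝ}
    (hf : IsC11 B f) (x : ℝ) :
    fracLaplacian α f x =
      -(fracLaplacianConst α / 2) * ∫ z, (f (x + z) + f (x - z) - 2 * f x) / |z| ^ (1 + α) := by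
  have h1 := hf.integrable_taylor hα₁ hα₂ x
  have h2 := h1.comp_neg
  have he : (fun z => (f (x + z) + f (x - z) - 2 * f x) / |z| ^ (1 + α)) =
      fun z => (f (x + z) - f x - deriv f x * z) / |z| ^ (1 + α) +
        (f (x + -z) - f x - deriv f x * -z) / |-z| ^ (1 + α) := by
    ext z; rw [abs_neg, ← sub_eq_add_neg]; ring
  rw [he, integral_add h1 h2,
    integral_neg_eq_self (fun z => (f (x + z) - f x - deriv f x * z) / |z| ^ (1 + α))]
  unfold fracLaplacian
  ring

/-! ### Cauchy weights and the self-adjointness of the fractional Laplacian -/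

/-- The Cauchy profile `1 / (1 + ((x - x₀) / R) ^ 2)` centred at `x₀` with scale `R`. As `α > 1`, it
decays slowly enough to dominate pointwise both its own derivative and its own image
under `Λ^α`. -/
noncomputable def cauchyWeight (x₀ R x : ℝ) : ℝ := (1 + ((x - x₀) / R) ^ 2)⁻¹

lemma cauchyWeight_pos (x₀ R x : ℝ) : 0 < cauchyWeight x₀ R x := by
  unfold cauchyWeight; positivity

lemma cauchyWeight_le_one (x₀ R x : ℝ) : cauchyWeight x₀ R x ≤ 1 :=
  inv_le_one_of_one_le₀ (by nlinarith [sq_nonneg ((x - x₀) / R)])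

lemma continuous_cauchyWeight (x₀ R : ℝ) : Continuous (cauchyWeight x₀ R) := by
  unfold cauchyWeight
  exact Continuous.inv₀ (by fun_prop) fun x => by positivity

lemma integrable_cauchyWeight (x₀ : ℝ) {R : ℝ} (hR : 0 < R) :
    Integrable (cauchyWeight x₀ R) :=
  (integrable_inv_one_add_sq.comp_div hR.ne').comp_sub_right x₀

lemma integral_cauchyWeight (x₀ : ℝ) {R : ℝ} (hR : 0 < R) :
    ∫ x, cauchyWeight x₀ R x = R * Real.pi := by
  unfold cauchyWeight
  rw [integral_sub_right_eq_self (fun x => (1 + (x / R) ^ 2)⁻¹) x₀,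
    Measure.integral_comp_div (fun y => (1 + y ^ 2)⁻¹) R, integral_univ_inv_one_add_sq,
    abs_of_pos hR, smul_eq_mul]

lemma hasDerivAt_cauchyWeight (x₀ R x : ℝ) :
    HasDerivAt (cauchyWeight x₀ R)
      (-(2 * ((x - x₀) / R) / R) / (1 + ((x - x₀) / R) ^ 2) ^ 2) x := by
  have h1 : HasDerivAt (fun x => 1 + ((x - x₀) / R) ^ 2) (2 * ((x - x₀) / R) / R) x := by
    have := ((((hasDerivAt_id x).sub_const x₀).div_const R).pow 2).const_add 1
    refine this.congr_deriv ?_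
    simp; ring
  exact h1.inv (by positivity)

lemma abs_deriv_cauchyWeight_le (x₀ : ℝ) {R : ℝ} (hR : 0 < R) (x : ℝ) :
    |deriv (cauchyWeight x₀ R) x| ≤ R⁻¹ * cauchyWeight x₀ R x := by
  rw [(hasDerivAt_cauchyWeight x₀ R x).deriv, cauchyWeight]
  set y := (x - x₀) / R
  have hp : 0 < 1 + y ^ 2 := by positivity
  rw [abs_div, abs_neg, abs_div, abs_of_pos hR, abs_of_pos (by positivity : 0 < (1 + y ^ 2) ^ 2),
    div_le_iff₀ (by positivity)]
  have : |2 * y| ≤ 1 + y ^ 2 := abs_le.2 ⟨by nlinarith [sq_nonneg (y + 1)],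
    by nlinarith [sq_nonneg (y - 1)]⟩
  calc |2 * y| / R ≤ (1 + y ^ 2) / R := by gcongr
    _ = _ := by field_simp

lemma integrable_deriv_cauchyWeight (x₀ : ℝ) {R : ℝ} (hR : 0 < R) :
    Integrable (deriv (cauchyWeight x₀ R)) :=
  Integrable.mono' ((integrable_cauchyWeight x₀ hR).const_mul R⁻¹)
    (measurable_deriv _).aestronglyMeasurable
    (Eventually.of_forall fun x => abs_deriv_cauchyWeight_le x₀ hR x)

lemma cauchyWeight_mono {R L : ℝ} (hR : 0 < R) (hRL : R ≤ L) (x : ℝ) :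
    cauchyWeight 0 R x ≤ cauchyWeight 0 L x := by
  unfold cauchyWeight
  rw [div_pow, div_pow]
  gcongr

lemma tendsto_cauchyWeight_atTop (x : ℝ) :
    Tendsto (fun R => cauchyWeight 0 R x) atTop (𝓝 1) := by
  have h : Tendsto (fun R : ℝ => (1 + ((x - 0) / R) ^ 2)⁻¹) atTop (𝓝 (1 + 0 ^ 2)⁻¹) :=
    ((((tendsto_const_nhds (x := x - 0)).div_atTop tendsto_id).pow 2).const_add 1).inv₀ (by simp)
  simpa [cauchyWeight] using h

section Profile

lemma abs_second_diff_profile_le (x : ℝ) {z : ℝ} (hz : |z| ≤ 1) :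
    |(1 + (x + z) ^ 2)⁻¹ + (1 + (x - z) ^ 2)⁻¹ - 2 * (1 + x ^ 2)⁻¹| ≤
      72 * z ^ 2 * (1 + x ^ 2)⁻¹ := by
  have ha : 0 < 1 + x ^ 2 := by positivity
  have hp : 0 < 1 + (x + z) ^ 2 := by positivity
  have hm : 0 < 1 + (x - z) ^ 2 := by positivity
  have hz2 : z ^ 2 ≤ 1 := by rw [← sq_abs]; exact pow_le_one₀ (abs_nonneg z) hz
  have e : (1 + (x + z) ^ 2)⁻¹ + (1 + (x - z) ^ 2)⁻¹ - 2 * (1 + x ^ 2)⁻¹ =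
      (1 + x ^ 2)⁻¹ * z ^ 2 * (2 * (3 * x ^ 2 - 1 - z ^ 2) /
        ((1 + (x + z) ^ 2) * (1 + (x - z) ^ 2))) := by
    field_simp; ring
  have h1 : 1 + x ^ 2 ≤ 3 * (1 + (x + z) ^ 2) := by nlinarith [sq_nonneg (x + 2 * z)]
  have h2 : 1 + x ^ 2 ≤ 3 * (1 + (x - z) ^ 2) := by nlinarith [sq_nonneg (x - 2 * z)]
  have h3 : (1 + x ^ 2) ≤ 9 * ((1 + (x + z) ^ 2) * (1 + (x - z) ^ 2)) := by
    have := mul_le_mul h1 h2 ha.le (by positivity)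
    nlinarith [sq_nonneg x]
  have h4 : |2 * (3 * x ^ 2 - 1 - z ^ 2) / ((1 + (x + z) ^ 2) * (1 + (x - z) ^ 2))| ≤ 72 := by
    rw [abs_div, abs_of_pos (mul_pos hp hm), div_le_iff₀ (mul_pos hp hm), abs_le]
    constructor <;> nlinarith [sq_nonneg x, sq_nonneg z]
  rw [e, abs_mul, abs_of_nonneg (by positivity)]
  calc _ ≤ (1 + x ^ 2)⁻¹ * z ^ 2 * 72 := by gcongr
    _ = _ := by ring

/-- Quasi-submultiplicativity of the Cauchy profile. -/
lemma profile_mul_profile_le (x z : ℝ) :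
    (1 + (x + z) ^ 2)⁻¹ * (1 + z ^ 2)⁻¹ ≤
      2 * (1 + x ^ 2)⁻¹ * ((1 + (x + z) ^ 2)⁻¹ + (1 + z ^ 2)⁻¹) := by
  have ha : 0 < 1 + x ^ 2 := by positivity
  have hp : 0 < 1 + (x + z) ^ 2 := by positivity
  have hz : 0 < 1 + z ^ 2 := by positivity
  have e : 2 * (1 + x ^ 2)⁻¹ * ((1 + (x + z) ^ 2)⁻¹ + (1 + z ^ 2)⁻¹) =
      (1 + (x + z) ^ 2)⁻¹ * (1 + z ^ 2)⁻¹ *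
        (2 * ((1 + (x + z) ^ 2) + (1 + z ^ 2)) / (1 + x ^ 2)) := by
    field_simp; ring
  rw [e]
  refine le_mul_of_one_le_right (by positivity) ?_
  rw [one_le_div ha]
  nlinarith [sq_nonneg (x + 2 * z)]

/-- An integrable majorant for the second differences of the Cauchy profile, relative to the
value of the profile itself. -/
noncomputable def profileMajorant (α x z : ℝ) : ℝ :=
  72 * levyMajorant α z + 4 * (1 + (x + z) ^ 2)⁻¹ + 4 * (1 + (x - z) ^ 2)⁻¹ + 12 * (1 + z ^ 2)⁻¹

lemma abs_second_diff_profile_div_le {α : ℝ} (hα₁ : 1 < α) (x z : ℝ) :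
    |((1 + (x + z) ^ 2)⁻¹ + (1 + (x - z) ^ 2)⁻¹ - 2 * (1 + x ^ 2)⁻¹) / |z| ^ (1 + α)| ≤
      (1 + x ^ 2)⁻¹ * profileMajorant α x z := by
  have ha : 0 < (1 + x ^ 2)⁻¹ := by positivity
  have hp : 0 < (1 + (x + z) ^ 2)⁻¹ := by positivity
  have hm : 0 < (1 + (x - z) ^ 2)⁻¹ := by positivity
  have hz : 0 < (1 + z ^ 2)⁻¹ := by positivity
  have hμ := levyMajorant_nonneg α z
  rw [abs_div, abs_of_nonneg (by positivity : 0 ≤ |z| ^ (1 + α))]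
  unfold profileMajorant
  rcases le_or_gt |z| 1 with h | h
  · have h1 : |(1 + (x + z) ^ 2)⁻¹ + (1 + (x - z) ^ 2)⁻¹ - 2 * (1 + x ^ 2)⁻¹| / |z| ^ (1 + α) ≤
        (1 + x ^ 2)⁻¹ * (72 * levyMajorant α z) := by
      have : min |z| (z ^ 2) = z ^ 2 := min_eq_right (by
        rw [← sq_abs]; nlinarith [abs_nonneg z])
      rw [levyMajorant, this]
      calc _ ≤ 72 * z ^ 2 * (1 + x ^ 2)⁻¹ / |z| ^ (1 + α) := by
            gcongr; exact abs_second_diff_profile_le x h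
        _ = _ := by ring
    refine h1.trans ?_
    gcongr
    linarith
  · have hz0 : 0 < |z| := one_pos.trans h
    have h2 : (|z| ^ (1 + α))⁻¹ ≤ 2 * (1 + z ^ 2)⁻¹ := by
      have h3 : z ^ 2 ≤ |z| ^ (1 + α) := by
        rw [← sq_abs, ← Real.rpow_natCast]
        exact Real.rpow_le_rpow_of_exponent_le h.le (by push_cast; linarith)
      have h4 : 1 ≤ z ^ 2 := by rw [← sq_abs]; exact one_le_pow₀ h.le
      rw [show 2 * (1 + z ^ 2)⁻¹ = ((1 + z ^ 2) / 2)⁻¹ by rw [inv_div]; ring]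
      gcongr
      linarith
    have h3 : |(1 + (x + z) ^ 2)⁻¹ + (1 + (x - z) ^ 2)⁻¹ - 2 * (1 + x ^ 2)⁻¹| ≤
        (1 + (x + z) ^ 2)⁻¹ + (1 + (x - z) ^ 2)⁻¹ + 2 * (1 + x ^ 2)⁻¹ :=
      abs_le.2 ⟨by linarith, by linarith⟩
    have h4 := profile_mul_profile_le x z
    have h5 := profile_mul_profile_le x (-z)
    rw [← sub_eq_add_neg, neg_sq] at h5
    rw [div_eq_mul_inv]
    calc _ ≤ ((1 + (x + z) ^ 2)⁻¹ + (1 + (x - z) ^ 2)⁻¹ + 2 * (1 + x ^ 2)⁻¹) *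
          (2 * (1 + z ^ 2)⁻¹) := by gcongr
      _ ≤ (1 + x ^ 2)⁻¹ * (4 * (1 + (x + z) ^ 2)⁻¹ + 4 * (1 + (x - z) ^ 2)⁻¹ +
          12 * (1 + z ^ 2)⁻¹) := by linarith
      _ ≤ _ := by gcongr; linarith

lemma integrable_profileMajorant {α : ℝ} (hα₁ : 1 < α) (hα₂ : α < 2) (x : ℝ) :
    Integrable (profileMajorant α x) :=
  ((((integrable_levyMajorant hα₁ hα₂).const_mul 72).add
    ((integrable_inv_one_add_sq.comp_add_left x).const_mul 4)).add
    ((integrable_inv_one_add_sq.comp_sub_left x).const_mul 4)).add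
    (integrable_inv_one_add_sq.const_mul 12)

lemma integral_profileMajorant {α : ℝ} (hα₁ : 1 < α) (hα₂ : α < 2) (x : ℝ) :
    ∫ z, profileMajorant α x z = 72 * (∫ z, levyMajorant α z) + 20 * Real.pi := by
  have h1 := (integrable_levyMajorant hα₁ hα₂).const_mul 72
  have h2 := (integrable_inv_one_add_sq.comp_add_left x).const_mul 4
  have h3 := (integrable_inv_one_add_sq.comp_sub_left x).const_mul 4
  have h4 := integrable_inv_one_add_sq.const_mul 12
  unfold profileMajorant
  rw [integral_add ((h1.fun_add h2).fun_add h3) h4, integral_add (h1.fun_add h2) h3,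
    integral_add h1 h2,
    integral_const_mul, integral_const_mul, integral_const_mul, integral_const_mul,
    integral_add_left_eq_self (fun z => (1 + z ^ 2)⁻¹) x,
    integral_sub_left_eq_self (fun z => (1 + z ^ 2)⁻¹) volume x, integral_univ_inv_one_add_sq]
  ring

lemma integrable_profile_mul_profileMajorant {α : ℝ} (hα₁ : 1 < α) (hα₂ : α < 2) :
    Integrable fun p : ℝ × ℝ => (1 + p.1 ^ 2)⁻¹ * profileMajorant α p.1 p.2 := by
  have hm : Measurable fun p : ℝ × ℝ => profileMajorant α p.1 p.2 := by
    have := measurable_levyMajorant α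
    unfold profileMajorant; fun_prop
  have hnn : ∀ x z, 0 ≤ profileMajorant α x z := fun x z => by
    have := levyMajorant_nonneg α z
    unfold profileMajorant; positivity
  rw [Measure.volume_eq_prod, integrable_prod_iff (Measurable.aestronglyMeasurable (by fun_prop))]
  refine ⟨Eventually.of_forall fun x =>
    (integrable_profileMajorant hα₁ hα₂ x).const_mul (1 + x ^ 2)⁻¹, ?_⟩
  have : (fun x : ℝ => ∫ z, ‖(1 + x ^ 2)⁻¹ * profileMajorant α x z‖) =
      fun x => (1 + x ^ 2)⁻¹ * (72 * (∫ z, levyMajorant α z) + 20 * Real.pi) := by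
    ext x
    rw [← integral_profileMajorant hα₁ hα₂ x, ← integral_const_mul]
    congr 1
    ext z
    exact Real.norm_of_nonneg (mul_nonneg (by positivity) (hnn x z))
  simp only [this]
  exact integrable_inv_one_add_sq.mul_const _

/-- `Λ^α` applied to the Cauchy profile, in symmetrised form. -/
noncomputable def profileDual (α x : ℝ) : ℝ :=
  -(fracLaplacianConst α / 2) *
    ∫ z, ((1 + (x + z) ^ 2)⁻¹ + (1 + (x - z) ^ 2)⁻¹ - 2 * (1 + x ^ 2)⁻¹) / |z| ^ (1 + α)

/-- The constant in the pointwise bound of `Λ^α` of the Cauchy profile by the profile. -/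
noncomputable def profileDualConst (α : ℝ) : ℝ :=
  fracLaplacianConst α / 2 * (72 * (∫ z, levyMajorant α z) + 20 * Real.pi)

lemma profileDualConst_nonneg {α : ℝ} (hα₁ : 1 < α) (hα₂ : α < 2) : 0 ≤ profileDualConst α := by
  have := fracLaplacianConst_pos hα₁ hα₂
  have := integral_nonneg (μ := volume) (f := levyMajorant α) (levyMajorant_nonneg α)
  have := Real.pi_pos
  unfold profileDualConst
  positivity

lemma measurable_profileDual (α : ℝ) : Measurable (profileDual α) := by
  unfold profileDual
  refine Measurable.const_mul (StronglyMeasurable.measurable ?_) _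
  refine StronglyMeasurable.integral_prod_right (f := fun x z : ℝ =>
    ((1 + (x + z) ^ 2)⁻¹ + (1 + (x - z) ^ 2)⁻¹ - 2 * (1 + x ^ 2)⁻¹) / |z| ^ (1 + α)) ?_
  exact Measurable.stronglyMeasurable (by unfold Function.uncurry; fun_prop)

lemma abs_profileDual_le {α : ℝ} (hα₁ : 1 < α) (hα₂ : α < 2) (x : ℝ) :
    |profileDual α x| ≤ profileDualConst α * (1 + x ^ 2)⁻¹ := by
  have hC := (fracLaplacianConst_pos hα₁ hα₂).le
  unfold profileDual profileDualConst
  rw [abs_mul, abs_neg, abs_of_nonneg (by positivity : 0 ≤ fracLaplacianConst α / 2), mul_assoc,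
    ← integral_profileMajorant hα₁ hα₂ x, mul_comm (∫ z, _), ← integral_const_mul]
  refine mul_le_mul_of_nonneg_left ?_ (by positivity)
  rw [← Real.norm_eq_abs]
  exact norm_integral_le_of_norm_le ((integrable_profileMajorant hα₁ hα₂ x).const_mul
    (1 + x ^ 2)⁻¹) (Eventually.of_forall fun z => abs_second_diff_profile_div_le hα₁ x z)

/-- Self-adjointness of `Λ^α`, tested against the Cauchy profile. -/
lemma integral_fracLaplacian_mul_profile {α : ℝ} (hα₁ : 1 < α) (hα₂ : α < 2) {B : ℝ} {f : ℝ → ℝ}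
    (hf : IsC11 B f) :
    Integrable (fun x => fracLaplacian α f x * (1 + x ^ 2)⁻¹) ∧
      ∫ x, fracLaplacian α f x * (1 + x ^ 2)⁻¹ = ∫ x, f x * profileDual α x := by
  have hfc := hf.continuous
  have hfm := hfc.measurable
  have hB := hf.nonneg
  -- Both double integrals converge absolutely, so that Fubini's theorem applies twice.
  have hI : Integrable fun p : ℝ × ℝ =>
      (f (p.1 + p.2) + f (p.1 - p.2) - 2 * f p.1) / |p.2| ^ (1 + α) * (1 + p.1 ^ 2)⁻¹ := by
    refine Integrable.mono' ((integrable_inv_one_add_sq.mul_prod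
      ((integrable_levyMajorant hα₁ hα₂).const_mul (10 * B))))
      (Measurable.aestronglyMeasurable (by fun_prop)) (Eventually.of_forall fun ⟨x, z⟩ => ?_)
    simp only
    rw [norm_mul, Real.norm_of_nonneg (by positivity : 0 ≤ (1 + x ^ 2)⁻¹), mul_comm, norm_div,
      Real.norm_of_nonneg (by positivity : 0 ≤ |z| ^ (1 + α)), Real.norm_eq_abs, levyMajorant]
    have h3 : |f (x + z) + f (x - z) - 2 * f x| ≤ 10 * B * min |z| (z ^ 2) := ?_
    · refine mul_le_mul_of_nonneg_left ?_ (by positivity)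
      rw [← mul_div_assoc]
      exact div_le_div_of_nonneg_right h3 (by positivity)
    have h1 := hf.taylor_min x z
    have h2 := hf.taylor_min x (-z)
    rw [abs_neg, neg_sq, ← sub_eq_add_neg] at h2
    rw [abs_le] at *
    constructor <;> linarith
  have hJ : Integrable fun p : ℝ × ℝ =>
      f p.1 * (((1 + (p.1 + p.2) ^ 2)⁻¹ + (1 + (p.1 - p.2) ^ 2)⁻¹ - 2 * (1 + p.1 ^ 2)⁻¹) /
        |p.2| ^ (1 + α)) := by
    refine Integrable.mono' ((integrable_profile_mul_profileMajorant hα₁ hα₂).const_mul B)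
      (Measurable.aestronglyMeasurable (by fun_prop)) (Eventually.of_forall fun ⟨x, z⟩ => ?_)
    rw [norm_mul]
    gcongr
    · exact hf.bdd x
    · exact abs_second_diff_profile_div_le hα₁ x z
  have hx : ∀ x, fracLaplacian α f x * (1 + x ^ 2)⁻¹ = -(fracLaplacianConst α / 2) *
      ∫ z, (f (x + z) + f (x - z) - 2 * f x) / |z| ^ (1 + α) * (1 + x ^ 2)⁻¹ := fun x => by
    rw [fracLaplacian_eq_symm hα₁ hα₂ hf, integral_mul_const, mul_assoc]
  have hx' : ∀ x, f x * profileDual α x = -(fracLaplacianConst α / 2) *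
      ∫ z, f x * (((1 + (x + z) ^ 2)⁻¹ + (1 + (x - z) ^ 2)⁻¹ - 2 * (1 + x ^ 2)⁻¹) /
        |z| ^ (1 + α)) := fun x => by
    rw [profileDual, integral_const_mul]; ring
  have hz : ∀ z, ∫ x, (f (x + z) + f (x - z) - 2 * f x) / |z| ^ (1 + α) * (1 + x ^ 2)⁻¹ =
      ∫ x, f x * (((1 + (x + z) ^ 2)⁻¹ + (1 + (x - z) ^ 2)⁻¹ - 2 * (1 + x ^ 2)⁻¹) /
        |z| ^ (1 + α)) := fun z => by
    have hint : ∀ a b : ℝ, Integrable fun x => f (x + a) * (1 + (x + b) ^ 2)⁻¹ := fun a b =>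
      (integrable_inv_one_add_sq.comp_add_right b).bdd_mul (c := B)
        (by fun_prop) (Eventually.of_forall fun x => hf.bdd _)
    have hs : ∀ a : ℝ, ∫ x, f (x + a) * (1 + x ^ 2)⁻¹ = ∫ x, f x * (1 + (x - a) ^ 2)⁻¹ :=
      fun a => by
        rw [← integral_add_right_eq_self (fun x => f x * (1 + (x - a) ^ 2)⁻¹) a]
        simp
    have i1 := hint z 0
    have i2 := hint (-z) 0
    have i3 := (hint 0 0).const_mul 2
    have i4 := hint 0 (-z)
    have i5 := hint 0 z
    simp only [add_zero, ← sub_eq_add_neg] at i1 i2 i3 i4 i5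
    have e1 : ∀ x, (f (x + z) + f (x - z) - 2 * f x) / |z| ^ (1 + α) * (1 + x ^ 2)⁻¹ =
        (|z| ^ (1 + α))⁻¹ * (f (x + z) * (1 + x ^ 2)⁻¹ + f (x - z) * (1 + x ^ 2)⁻¹ -
          2 * (f x * (1 + x ^ 2)⁻¹)) := fun x => by ring
    have e2 : ∀ x, f x * (((1 + (x + z) ^ 2)⁻¹ + (1 + (x - z) ^ 2)⁻¹ - 2 * (1 + x ^ 2)⁻¹) /
        |z| ^ (1 + α)) = (|z| ^ (1 + α))⁻¹ * (f x * (1 + (x - z) ^ 2)⁻¹ +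
          f x * (1 + (x + z) ^ 2)⁻¹ - 2 * (f x * (1 + x ^ 2)⁻¹)) := fun x => by ring
    simp_rw [e1, e2, integral_const_mul]
    rw [integral_sub (i1.fun_add i2) i3, integral_add i1 i2, integral_sub (i4.fun_add i5) i3,
      integral_add i4 i5, hs z]
    have := hs (-z)
    simp_rw [sub_neg_eq_add, ← sub_eq_add_neg] at this
    rw [this]
  refine ⟨?_, ?_⟩
  · simp_rw [hx]
    exact (Integrable.integral_prod_left hI).const_mul _
  · simp_rw [hx, hx']
    rw [integral_const_mul, integral_const_mul]
    congr 1
    have hs1 := integral_integral_swap (f := fun x z =>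
      (f (x + z) + f (x - z) - 2 * f x) / |z| ^ (1 + α) * (1 + x ^ 2)⁻¹) hI
    have hs2 := integral_integral_swap (f := fun x z =>
      f x * (((1 + (x + z) ^ 2)⁻¹ + (1 + (x - z) ^ 2)⁻¹ - 2 * (1 + x ^ 2)⁻¹) /
        |z| ^ (1 + α))) hJ
    rw [hs1, hs2]
    simp_rw [hz]

end Profile

/-- `IsDualPair α χ lam`: the weight `χ` is integrable with integrable derivative, and `lam` is the
image of `χ` under `Λ^α`, in the sense that `∫ (Λ^α f) χ = ∫ f lam` for all admissible `f`. -/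
structure IsDualPair (α : ℝ) (χ lam : ℝ → ℝ) : Prop where
  diff : Differentiable ℝ χ
  int : Integrable χ
  int_deriv : Integrable (deriv χ)
  int_dual : Integrable lam
  int_mul : ∀ B f, IsC11 B f → Integrable fun x => fracLaplacian α f x * χ x
  dual : ∀ B f, IsC11 B f → ∫ x, fracLaplacian α f x * χ x = ∫ x, f x * lam x

lemma IsC11.integrable_mul {B : ℝ} {f : ℝ → ℝ} (hf : IsC11 B f) {χ : ℝ → ℝ} (hχ : Integrable χ) :
    Integrable fun x => f x * χ x :=
  hχ.bdd_mul (c := B) hf.continuous.aestronglyMeasurable (Eventually.of_forall fun x => hf.bdd x)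

lemma IsDualPair.sub {α : ℝ} {χ lam χ' lam' : ℝ → ℝ} (h : IsDualPair α χ lam)
    (h' : IsDualPair α χ' lam') :
    IsDualPair α (fun x => χ x - χ' x) (fun x => lam x - lam' x) where
  diff := h.diff.sub h'.diff
  int := h.int.sub h'.int
  int_deriv := by
    have : deriv (fun x => χ x - χ' x) = fun x => deriv χ x - deriv χ' x :=
      funext fun x => deriv_fun_sub (h.diff x) (h'.diff x)
    rw [this]; exact h.int_deriv.sub h'.int_deriv
  int_dual := h.int_dual.sub h'.int_dual
  int_mul B f hf := by
    simp_rw [mul_sub]; exact (h.int_mul B f hf).sub (h'.int_mul B f hf)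
  dual B f hf := by
    simp_rw [mul_sub]
    rw [integral_sub (h.int_mul B f hf) (h'.int_mul B f hf), h.dual B f hf, h'.dual B f hf,
      integral_sub (hf.integrable_mul h.int_dual) (hf.integrable_mul h'.int_dual)]

/-- `Λ^α` of a Cauchy weight. -/
noncomputable def cauchyDual (α x₀ R x : ℝ) : ℝ := R ^ (-α) * profileDual α ((x - x₀) / R)

lemma abs_cauchyDual_le {α : ℝ} (hα₁ : 1 < α) (hα₂ : α < 2) (x₀ : ℝ) {R : ℝ} (hR : 0 < R)
    (x : ℝ) :
    |cauchyDual α x₀ R x| ≤ profileDualConst α * R ^ (-α) * cauchyWeight x₀ R x := by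
  unfold cauchyDual cauchyWeight
  have := Real.rpow_pos_of_pos hR (-α)
  rw [abs_mul, abs_of_pos this, mul_comm (profileDualConst α), mul_assoc]
  gcongr
  exact abs_profileDual_le hα₁ hα₂ _

lemma isDualPair_cauchyWeight {α : ℝ} (hα₁ : 1 < α) (hα₂ : α < 2) (x₀ : ℝ) {R : ℝ} (hR : 0 < R) :
    IsDualPair α (cauchyWeight x₀ R) (cauchyDual α x₀ R) := by
  have hRα := Real.rpow_pos_of_pos hR α
  have hsub : ∀ x, x₀ + R * ((x - x₀) / R) = x := fun x => by field_simp; ring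
  have key : ∀ B f, IsC11 B f → ∀ x, fracLaplacian α f x * cauchyWeight x₀ R x =
      R ^ (-α) * (fracLaplacian α (fun y => f (x₀ + R * y)) ((x - x₀) / R) *
        (1 + ((x - x₀) / R) ^ 2)⁻¹) := fun B f hf x => by
    rw [fracLaplacian_comp_affine f hf.diff x₀ hR, hsub, Real.rpow_neg hR.le, cauchyWeight]
    field_simp
  refine ⟨fun x => (hasDerivAt_cauchyWeight x₀ R x).differentiableAt,
    integrable_cauchyWeight x₀ hR, integrable_deriv_cauchyWeight x₀ hR, ?_, ?_, ?_⟩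
  · refine Integrable.mono' ((integrable_cauchyWeight x₀ hR).const_mul
      (profileDualConst α * R ^ (-α))) (Measurable.aestronglyMeasurable ?_)
      (Eventually.of_forall fun x => abs_cauchyDual_le hα₁ hα₂ x₀ hR x)
    exact ((measurable_profileDual α).comp (by fun_prop)).const_mul _
  · intro B f hf
    simp_rw [key B f hf]
    exact ((((integral_fracLaplacian_mul_profile hα₁ hα₂ (hf.comp_affine x₀ R)).1).comp_div
      hR.ne').comp_sub_right x₀).const_mul _
  · intro B f hf
    have h := (integral_fracLaplacian_mul_profile hα₁ hα₂ (hf.comp_affine x₀ R)).2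
    simp_rw [key B f hf]
    have e : ∀ x, f x * cauchyDual α x₀ R x = R ^ (-α) *
        (f (x₀ + R * ((x - x₀) / R)) * profileDual α ((x - x₀) / R)) := fun x => by
      rw [hsub, cauchyDual]; ring
    simp_rw [e]
    rw [integral_const_mul, integral_const_mul,
      integral_sub_right_eq_self (fun x => fracLaplacian α (fun y => f (x₀ + R * y)) (x / R) *
        (1 + (x / R) ^ 2)⁻¹) x₀,
      integral_sub_right_eq_self (fun x => f (x₀ + R * (x / R)) * profileDual α (x / R)) x₀,
      Measure.integral_comp_div (fun y => fracLaplacian α (fun y => f (x₀ + R * y)) y *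
        (1 + y ^ 2)⁻¹) R,
      Measure.integral_comp_div (fun y => f (x₀ + R * y) * profileDual α y) R, h]

/-! ### Regularity of solutions at positive times -/

lemma IsC11.of_lipschitz_deriv {B : ℝ} {f : ℝ → ℝ} (hd : Differentiable ℝ f)
    (hb : ∀ x, |f x| ≤ B) (hl : ∀ x y, |deriv f y - deriv f x| ≤ B * |y - x|) : IsC11 B f := by
  refine ⟨hd, hb, fun x z => ?_⟩
  have hB : 0 ≤ B := (abs_nonneg _).trans (hb 0)
  have hg : ∀ y, HasDerivAt (fun y => f y - deriv f x * y) (deriv f y - deriv f x) y := fun y => by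
    exact ((hd y).hasDerivAt.fun_sub ((hasDerivAt_id y).const_mul (deriv f x))).congr_deriv
      (by simp)
  have h := (convex_uIcc x (x + z)).norm_image_sub_le_of_norm_hasDerivWithin_le
    (fun y _ => (hg y).hasDerivWithinAt) (C := B * |z|) (fun y hy => by
      refine (hl x y).trans ?_
      have := abs_sub_left_of_mem_uIcc hy
      rw [add_sub_cancel_left] at this
      exact mul_le_mul_of_nonneg_left this hB) left_mem_uIcc right_mem_uIcc
  have e : f (x + z) - f x - deriv f x * z =
      f (x + z) - deriv f x * (x + z) - (f x - deriv f x * x) := by ring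
  rw [e]
  refine h.trans (le_of_eq ?_)
  rw [add_sub_cancel_left, Real.norm_eq_abs, mul_assoc, abs_mul_abs_self, pow_two]

/-- Uniform regularity of a function of time and space on the time strip `(a, T)`. -/
structure StripBounds (a T B : ℝ) (u : ℝ → ℝ → ℝ) : Prop where
  c11 : ∀ t ∈ Ioo a T, IsC11 B (u t)
  diff_time : ∀ t ∈ Ioo a T, ∀ x, DifferentiableAt ℝ (fun s => u s x) t
  bdd_time : ∀ t ∈ Ioo a T, ∀ x, |deriv (fun s => u s x) t| ≤ B
  cont_time : ∀ t ∈ Ioo a T, Continuous fun x => deriv (fun s => u s x) t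
  lip_deriv : ∀ s ∈ Ioo a T, ∀ t ∈ Ioo a T, ∀ x, |deriv (u t) x - deriv (u s) x| ≤ B * |t - s|

lemma IsCbSmooth.exists_stripBounds {u : ℝ → ℝ → ℝ} {a T : ℝ}
    (h : IsCbSmooth u (Ioo a T ×ˢ univ)) : ∃ B, StripBounds a T B u := by
  obtain ⟨hs, hb⟩ := h
  obtain ⟨B0, hB0⟩ := hb 0
  obtain ⟨B1, hB1⟩ := hb 1
  obtain ⟨B2, hB2⟩ := hb 2
  set U : ℝ × ℝ → ℝ := fun z => u z.1 z.2 with hU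
  have hopen : IsOpen (Ioo a T ×ˢ (univ : Set ℝ)) := isOpen_Ioo.prod isOpen_univ
  have hconv : Convex ℝ (Ioo a T ×ˢ (univ : Set ℝ)) := (convex_Ioo a T).prod convex_univ
  have hcd : ∀ z ∈ Ioo a T ×ˢ (univ : Set ℝ), ContDiffAt ℝ ∞ U z := fun z hz =>
    hs.contDiffAt (hopen.mem_nhds hz)
  have hD : ∀ z ∈ Ioo a T ×ˢ (univ : Set ℝ), HasFDerivAt U (fderiv ℝ U z) z := fun z hz =>
    ((hcd z hz).differentiableAt (by simp)).hasFDerivAt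
  have hcd' : ∀ z ∈ Ioo a T ×ˢ (univ : Set ℝ), ContDiffAt ℝ 1 (fderiv ℝ U) z := fun z hz =>
    (hcd z hz).fderiv_right (m := 1) (by norm_cast)
  have hD2 : ∀ z ∈ Ioo a T ×ˢ (univ : Set ℝ), ∀ z' ∈ Ioo a T ×ˢ (univ : Set ℝ),
      ‖fderiv ℝ U z' - fderiv ℝ U z‖ ≤ B2 * ‖z' - z‖ := fun z hz z' hz' =>
    hconv.norm_image_sub_le_of_norm_fderiv_le
      (fun y hy => (hcd' y hy).differentiableAt (by simp))
      (fun y hy => by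
        rw [← norm_iteratedFDeriv_one, norm_iteratedFDeriv_fderiv]; exact hB2 y hy) hz hz'
  have hx : ∀ t ∈ Ioo a T, ∀ x, HasDerivAt (u t) (fderiv ℝ U (t, x) (0, 1)) x := fun t ht x =>
    (hD (t, x) ⟨ht, mem_univ x⟩).comp_hasDerivAt x
      ((hasDerivAt_const x t).prodMk (hasDerivAt_id x))
  have ht' : ∀ t ∈ Ioo a T, ∀ x,
      HasDerivAt (fun s => u s x) (fderiv ℝ U (t, x) (1, 0)) t := fun t ht x =>
    HasFDerivAt.comp_hasDerivAt (l := U) (f := fun s => (s, x)) t (hD (t, x) ⟨ht, mem_univ x⟩)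
      ((hasDerivAt_id t).prodMk (hasDerivAt_const t x))
  have hn1 : ‖((0 : ℝ), (1 : ℝ))‖ = 1 := by simp
  have hn2 : ‖((1 : ℝ), (0 : ℝ))‖ = 1 := by simp
  refine ⟨max B0 (max B1 B2), ?_, fun t ht x => (ht' t ht x).differentiableAt, ?_, ?_, ?_⟩
  · intro t ht
    refine IsC11.of_lipschitz_deriv (fun x => (hx t ht x).differentiableAt) (fun x => ?_)
      fun x y => ?_
    · have := hB0 (t, x) ⟨ht, mem_univ x⟩
      rw [norm_iteratedFDeriv_zero] at this
      exact this.trans (le_max_left _ _)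
    · rw [(hx t ht x).deriv, (hx t ht y).deriv, ← sub_apply]
      refine ((fderiv ℝ U (t, y) - fderiv ℝ U (t, x)).le_opNorm _).trans ?_
      rw [hn1, mul_one]
      refine (hD2 (t, x) ⟨ht, mem_univ x⟩ (t, y) ⟨ht, mem_univ y⟩).trans ?_
      have : ‖(t, y) - (t, x)‖ = |y - x| := by simp [Prod.norm_def]
      rw [this]
      gcongr
      exact (le_max_right _ _).trans (le_max_right _ _)
  · intro t ht x
    rw [(ht' t ht x).deriv]
    refine ((fderiv ℝ U (t, x)).le_opNorm _).trans ?_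
    rw [hn2, mul_one, ← norm_iteratedFDeriv_one]
    exact (hB1 (t, x) ⟨ht, mem_univ x⟩).trans ((le_max_left _ _).trans (le_max_right _ _))
  · intro t ht
    have : (fun x => deriv (fun s => u s x) t) = fun x => fderiv ℝ U (t, x) (1, 0) :=
      funext fun x => (ht' t ht x).deriv
    rw [this]
    refine continuous_iff_continuousAt.2 fun x => ?_
    have h1 : ContinuousAt (fun x => fderiv ℝ U (t, x)) x :=
      ((hcd' (t, x) ⟨ht, mem_univ x⟩).continuousAt).comp (f := fun x => (t, x)) (by fun_prop)
    exact h1.clm_apply continuousAt_const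
  · intro s hs t ht x
    rw [(hx t ht x).deriv, (hx s hs x).deriv, ← sub_apply]
    refine ((fderiv ℝ U (t, x) - fderiv ℝ U (s, x)).le_opNorm _).trans ?_
    rw [hn1, mul_one]
    refine (hD2 (s, x) ⟨hs, mem_univ x⟩ (t, x) ⟨ht, mem_univ x⟩).trans ?_
    have : ‖(t, x) - (s, x)‖ = |t - s| := by simp [Prod.norm_def]
    rw [this]
    gcongr
    exact (le_max_right _ _).trans (le_max_right _ _)

lemma StripBounds.sub {a T B B' : ℝ} {u v : ℝ → ℝ → ℝ} (hu : StripBounds a T B u)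
    (hv : StripBounds a T B' v) : StripBounds a T (B + B') fun t x => u t x - v t x := by
  have hdt : ∀ t ∈ Ioo a T, ∀ x, deriv (fun s => u s x - v s x) t =
      deriv (fun s => u s x) t - deriv (fun s => v s x) t := fun t ht x =>
    deriv_fun_sub (hu.diff_time t ht x) (hv.diff_time t ht x)
  have hdx : ∀ t ∈ Ioo a T, ∀ x, deriv (fun x => u t x - v t x) x = deriv (u t) x - deriv (v t) x :=
    fun t ht x => deriv_fun_sub ((hu.c11 t ht).diff x) ((hv.c11 t ht).diff x)
  refine ⟨fun t ht => (hu.c11 t ht).sub (hv.c11 t ht),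
    fun t ht x => (hu.diff_time t ht x).sub (hv.diff_time t ht x), fun t ht x => ?_,
    fun t ht => ?_, fun s hs t ht x => ?_⟩
  · rw [hdt t ht]
    exact (abs_sub _ _).trans (add_le_add (hu.bdd_time t ht x) (hv.bdd_time t ht x))
  · simp_rw [hdt t ht]
    exact (hu.cont_time t ht).sub (hv.cont_time t ht)
  · rw [hdx t ht, hdx s hs, add_mul, show deriv (u t) x - deriv (v t) x -
      (deriv (u s) x - deriv (v s) x) = (deriv (u t) x - deriv (u s) x) -
        (deriv (v t) x - deriv (v s) x) by ring]
    exact (abs_sub _ _).trans (add_le_add (hu.lip_deriv s hs t ht x) (hv.lip_deriv s hs t ht x))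

/-- Differentiation under the integral sign for weighted integrals of `η (u t)`. -/
lemma StripBounds.hasDerivAt_integral {a T B : ℝ} {u : ℝ → ℝ → ℝ} (h : StripBounds a T B u)
    {η η' χ : ℝ → ℝ} (hη : ∀ y, HasDerivAt η (η' y) y) (hη' : Continuous η') (hχ : Integrable χ)
    {t : ℝ} (ht : t ∈ Ioo a T) :
    Integrable (fun x => η' (u t x) * deriv (fun s => u s x) t * χ x) ∧
    HasDerivAt (fun s => ∫ x, η (u s x) * χ x)
      (∫ x, η' (u t x) * deriv (fun s => u s x) t * χ x) t := by
  have hηc : Continuous η := continuous_iff_continuousAt.2 fun y => (hη y).continuousAt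
  obtain ⟨M, hM⟩ := (isCompact_Icc (a := -B) (b := B)).exists_bound_of_continuousOn
    hη'.continuousOn
  obtain ⟨N, hN⟩ := (isCompact_Icc (a := -B) (b := B)).exists_bound_of_continuousOn
    hηc.continuousOn
  refine hasDerivAt_integral_of_dominated_loc_of_deriv_le (s := Ioo a T) (μ := volume)
    (F := fun s x => η (u s x) * χ x)
    (F' := fun s x => η' (u s x) * deriv (fun s => u s x) s * χ x)
    (bound := fun x => M * B * ‖χ x‖) (Ioo_mem_nhds ht.1 ht.2) ?_ ?_ ?_ ?_
    (hχ.norm.const_mul _) ?_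
  · filter_upwards [Ioo_mem_nhds ht.1 ht.2] with s hs
    exact (hηc.comp (h.c11 s hs).continuous).aestronglyMeasurable.mul hχ.1
  · exact hχ.bdd_mul (c := N) (hηc.comp (h.c11 t ht).continuous).aestronglyMeasurable
      (Eventually.of_forall fun x => hN _ (abs_le.1 ((h.c11 t ht).bdd x)))
  · exact ((hη'.comp (h.c11 t ht).continuous).mul (h.cont_time t ht)).aestronglyMeasurable.mul hχ.1
  · refine Eventually.of_forall fun x s hs => ?_
    have h1 := hM _ (abs_le.1 ((h.c11 s hs).bdd x))
    rw [norm_mul, norm_mul]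
    gcongr
    · exact (norm_nonneg _).trans h1
    · exact h.bdd_time s hs x
  · exact Eventually.of_forall fun x s hs =>
      ((hη (u s x)).comp s (h.diff_time s hs x).hasDerivAt).mul_const (χ x)

lemma integral_deriv_mul_weight {F F' χ : ℝ → ℝ} {M : ℝ} (hF : ∀ x, HasDerivAt F (F' x) x)
    (hb : ∀ x, |F x| ≤ M) (hb' : ∀ x, |F' x| ≤ M) (hχ : Differentiable ℝ χ)
    (hi : Integrable χ) (hi' : Integrable (deriv χ)) :
    Integrable (fun x => F' x * χ x) ∧ Integrable (fun x => F x * deriv χ x) ∧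
      ∫ x, F' x * χ x = -∫ x, F x * deriv χ x := by
  have hFc : Continuous F := continuous_iff_continuousAt.2 fun y => (hF y).continuousAt
  have hF'm : Measurable F' := by
    rw [← funext fun x => (hF x).deriv]; exact measurable_deriv F
  have h1 : Integrable (fun x => F' x * χ x) := hi.bdd_mul (c := M)
    hF'm.aestronglyMeasurable (Eventually.of_forall hb')
  have h2 : Integrable (fun x => F x * deriv χ x) := hi'.bdd_mul (c := M)
    hFc.aestronglyMeasurable (Eventually.of_forall hb)
  have h3 : Integrable (fun x => F x * χ x) := hi.bdd_mul (c := M)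
    hFc.aestronglyMeasurable (Eventually.of_forall hb)
  refine ⟨h1, h2, ?_⟩
  rw [integral_mul_deriv_eq_deriv_mul_of_integrable (fun x _ => hF x)
    (fun x _ => (hχ x).hasDerivAt) h2 h1 h3, neg_neg]

/-! ### Entropy balances -/

/-- The weighted balance law for an entropy `η` with flux `q`, `q' = y η'`, at one time. The middle
term on the right is the entropy dissipation of `Λ^α`. -/
lemma entropy_balance {α : ℝ} {a T B B' : ℝ} {u : ℝ → ℝ → ℝ} (h : StripBounds a T B u)
    {η η' q χ lam : ℝ → ℝ} (hη' : Continuous η')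
    (hq : ∀ y, HasDerivAt q (y * η' y) y) (hχ : IsDualPair α χ lam) {t : ℝ} (ht : t ∈ Ioo a T)
    (hηu : IsC11 B' fun x => η (u t x))
    (heq : ∀ x, deriv (fun s => u s x) t + fracLaplacian α (u t) x + u t x * deriv (u t) x = 0) :
    Integrable (fun x => (η' (u t x) * fracLaplacian α (u t) x -
      fracLaplacian α (fun x => η (u t x)) x) * χ x) ∧
    Integrable (fun x => q (u t x) * deriv χ x) ∧
    ∫ x, η' (u t x) * deriv (fun s => u s x) t * χ x = -(∫ x, η (u t x) * lam x) -
      (∫ x, (η' (u t x) * fracLaplacian α (u t) x -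
        fracLaplacian α (fun x => η (u t x)) x) * χ x) + ∫ x, q (u t x) * deriv χ x := by
  have hqc : Continuous q := continuous_iff_continuousAt.2 fun y => (hq y).continuousAt
  have hu := h.c11 t ht
  have hB := hu.nonneg
  obtain ⟨M, hM⟩ := (isCompact_Icc (a := -B) (b := B)).exists_bound_of_continuousOn
    hη'.continuousOn
  obtain ⟨N, hN⟩ := (isCompact_Icc (a := -B) (b := B)).exists_bound_of_continuousOn
    hqc.continuousOn
  have hM' : ∀ x, |η' (u t x)| ≤ M := fun x => hM _ (abs_le.1 (hu.bdd x))
  have hM0 : 0 ≤ M := (abs_nonneg _).trans (hM' 0)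
  have hflux := integral_deriv_mul_weight (F := fun x => q (u t x))
    (F' := fun x => u t x * η' (u t x) * deriv (u t) x) (M := max N (B * M * (3 * B)))
    (fun x => (hq (u t x)).comp x (hu.diff x).hasDerivAt)
    (fun x => (hN _ (abs_le.1 (hu.bdd x))).trans (le_max_left _ _))
    (fun x => by
      refine le_trans ?_ (le_max_right _ _)
      rw [abs_mul, abs_mul]
      gcongr
      · exact hu.bdd x
      · exact hM' x
      · exact hu.abs_deriv_le x) hχ.diff hχ.int hχ.int_deriv
  have hi1 : Integrable fun x => η' (u t x) * (fracLaplacian α (u t) x * χ x) :=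
    (hχ.int_mul B _ hu).bdd_mul (c := M) (hη'.comp hu.continuous).aestronglyMeasurable
      (Eventually.of_forall hM')
  have hi2 := hχ.int_mul B' _ hηu
  have he : (fun x => (η' (u t x) * fracLaplacian α (u t) x -
      fracLaplacian α (fun x => η (u t x)) x) * χ x) =
      fun x => η' (u t x) * (fracLaplacian α (u t) x * χ x) -
        fracLaplacian α (fun x => η (u t x)) x * χ x := by
    ext x; ring
  have hi3 : Integrable (fun x => (η' (u t x) * fracLaplacian α (u t) x -
      fracLaplacian α (fun x => η (u t x)) x) * χ x) := he ▸ hi1.sub hi2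
  refine ⟨hi3, hflux.2.1, ?_⟩
  have hp : ∀ x, η' (u t x) * deriv (fun s => u s x) t * χ x =
      -(fracLaplacian α (fun x => η (u t x)) x * χ x) -
        (η' (u t x) * fracLaplacian α (u t) x -
          fracLaplacian α (fun x => η (u t x)) x) * χ x -
        u t x * η' (u t x) * deriv (u t) x * χ x := fun x => by
    have : deriv (fun s => u s x) t = -fracLaplacian α (u t) x - u t x * deriv (u t) x := by
      linarith [heq x]
    rw [this]; ring
  simp_rw [hp]
  have hn : Integrable fun x => -(fracLaplacian α (fun x => η (u t x)) x * χ x) := hi2.neg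
  have hn' : Integrable fun x => -(fracLaplacian α (fun x => η (u t x)) x * χ x) -
      (η' (u t x) * fracLaplacian α (u t) x -
        fracLaplacian α (fun x => η (u t x)) x) * χ x := hn.sub hi3
  rw [integral_sub hn' hflux.1, integral_sub hn hi3, integral_neg,
    hχ.dual B' _ hηu, hflux.2.2, sub_neg_eq_add]

/-! ### A smooth approximation of the absolute value -/

/-- A smooth convex approximation of the absolute value, at distance at most `δ` from it. -/
noncomputable def smoothAbs (δ y : ℝ) : ℝ := √(y ^ 2 + δ ^ 2) - δ

section smoothAbs

variable {δ : ℝ}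

lemma sq_sqrt_sq_add (δ y : ℝ) : √(y ^ 2 + δ ^ 2) ^ 2 = y ^ 2 + δ ^ 2 :=
  Real.sq_sqrt (by positivity)

lemma le_sqrt_sq_add (δ y : ℝ) : δ ≤ √(y ^ 2 + δ ^ 2) :=
  Real.le_sqrt_of_sq_le (by nlinarith [sq_nonneg y])

lemma abs_le_sqrt_sq_add (δ y : ℝ) : |y| ≤ √(y ^ 2 + δ ^ 2) :=
  Real.abs_le_sqrt (by nlinarith [sq_nonneg δ])

lemma hasDerivAt_smoothAbs (hδ : 0 < δ) (y : ℝ) :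
    HasDerivAt (smoothAbs δ) (y / √(y ^ 2 + δ ^ 2)) y := by
  have h := ((((hasDerivAt_id y).pow 2).add_const (δ ^ 2)).sqrt
    (add_pos_of_nonneg_of_pos (sq_nonneg _) (pow_pos hδ 2)).ne').sub_const δ
  refine h.congr_deriv ?_
  simp only [id, Nat.cast_ofNat, mul_one, Nat.add_one_sub_one, pow_one, Pi.pow_apply]
  field_simp

lemma continuous_deriv_smoothAbs (hδ : 0 < δ) :
    Continuous fun y : ℝ => y / √(y ^ 2 + δ ^ 2) :=
  Continuous.div (by fun_prop) (by fun_prop) fun y => (hδ.trans_le (le_sqrt_sq_add δ y)).ne'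

lemma smoothAbs_nonneg (δ y : ℝ) : 0 ≤ smoothAbs δ y :=
  sub_nonneg.2 (le_sqrt_sq_add δ y)

lemma sub_le_smoothAbs (δ y : ℝ) : |y| - δ ≤ smoothAbs δ y :=
  sub_le_sub_right (abs_le_sqrt_sq_add δ y) δ

lemma smoothAbs_le (hδ : 0 < δ) (y : ℝ) : smoothAbs δ y ≤ |y| := by
  unfold smoothAbs
  rw [sub_le_iff_le_add]
  refine Real.sqrt_le_iff.2 ⟨by positivity, ?_⟩
  nlinarith [sq_abs y, abs_nonneg y, mul_nonneg (abs_nonneg y) hδ.le]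

lemma abs_deriv_smoothAbs_le (hδ : 0 < δ) (y : ℝ) : |y / √(y ^ 2 + δ ^ 2)| ≤ 1 := by
  have h := hδ.trans_le (le_sqrt_sq_add δ y)
  rw [abs_div, abs_of_pos h, div_le_one h]
  exact abs_le_sqrt_sq_add δ y

lemma smoothAbs_taylor (hδ : 0 < δ) (x y : ℝ) :
    0 ≤ smoothAbs δ y - smoothAbs δ x - x / √(x ^ 2 + δ ^ 2) * (y - x) ∧
    smoothAbs δ y - smoothAbs δ x - x / √(x ^ 2 + δ ^ 2) * (y - x) ≤
      (2 * δ)⁻¹ * (y - x) ^ 2 := by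
  unfold smoothAbs
  have hx := sq_sqrt_sq_add δ x
  have hy := sq_sqrt_sq_add δ y
  have hx0 := le_sqrt_sq_add δ x
  have hy0 := le_sqrt_sq_add δ y
  set p := √(x ^ 2 + δ ^ 2)
  set r := √(y ^ 2 + δ ^ 2)
  have hp : 0 < p := hδ.trans_le hx0
  have hr : 0 < r := hδ.trans_le hy0
  have e : r - δ - (p - δ) - x / p * (y - x) = (p * r - x * y - δ ^ 2) / p := by
    field_simp
    nlinarith
  rw [e]
  constructor
  · refine div_nonneg ?_ hp.le
    have : x * y + δ ^ 2 ≤ p * r := by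
      refine le_of_sq_le_sq ?_ (by positivity)
      rw [mul_pow, hx, hy]
      nlinarith [sq_nonneg (δ * (x - y))]
    linarith
  · calc (p * r - x * y - δ ^ 2) / p ≤ ((y - x) ^ 2 / 2) / p := by
          gcongr
          nlinarith [sq_nonneg (p - r)]
      _ ≤ ((y - x) ^ 2 / 2) / δ := by gcongr
      _ = _ := by field_simp

lemma mul_deriv_smoothAbs_sub (hδ : 0 < δ) (y : ℝ) :
    |y * (y / √(y ^ 2 + δ ^ 2)) - smoothAbs δ y| ≤ δ := by
  unfold smoothAbs
  have hy := sq_sqrt_sq_add δ y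
  have hy0 := le_sqrt_sq_add δ y
  set r := √(y ^ 2 + δ ^ 2)
  have hr : 0 < r := hδ.trans_le hy0
  have e : y * (y / r) - (r - δ) = δ - δ ^ 2 / r := by
    field_simp
    nlinarith
  rw [e, abs_le]
  have h1 : δ ^ 2 / r ≤ δ := by
    rw [div_le_iff₀ hr]; nlinarith
  have h2 : 0 ≤ δ ^ 2 / r := by positivity
  constructor <;> linarith

lemma IsC11.smoothAbs {B : ℝ} {f : ℝ → ℝ} (hf : IsC11 B f) (hδ : 0 < δ) :
    ∃ B', IsC11 B' fun x => _root_.smoothAbs δ (f x) := by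
  have hB := hf.nonneg
  have hM : 0 ≤ max (max B 1) (2 * δ)⁻¹ := by positivity
  refine ⟨_, hf.comp hM (hasDerivAt_smoothAbs hδ) (fun x => ?_) (fun x => ?_) fun a b => ?_⟩
  · rw [abs_of_nonneg (smoothAbs_nonneg δ _)]
    exact ((smoothAbs_le hδ _).trans (hf.bdd x)).trans
      ((le_max_left _ _).trans (le_max_left _ _))
  · exact (abs_deriv_smoothAbs_le hδ _).trans ((le_max_right _ _).trans (le_max_left _ _))
  · rw [abs_of_nonneg (smoothAbs_taylor hδ a b).1]
    refine (smoothAbs_taylor hδ a b).2.trans ?_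
    gcongr
    exact le_max_right _ _

end smoothAbs

/-! ### Evolution of weighted integrals of a solution -/

namespace IsFractalBurgersSolution

variable {α : ℝ} {u₀ : ℝ → ℝ} {u : ℝ → ℝ → ℝ}

lemma exists_stripBounds (h : IsFractalBurgersSolution α u₀ u) {a T : ℝ} (ha : 0 < a)
    (haT : a < T) : ∃ B, StripBounds a T B u :=
  (h.smooth T (ha.trans haT) a ⟨ha, haT⟩).exists_stripBounds

/-- A solution is bounded by a common constant on `(0, T)`. -/
lemma exists_bound (h : IsFractalBurgersSolution α u₀ u) {T : ℝ} (hT : 0 < T) :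
    ∃ M, 0 ≤ M ∧ ∀ t ∈ Ioo 0 T, ∀ x, |u t x| ≤ M := by
  obtain ⟨M, hM⟩ := (h.bounded T hT).2
  exact ⟨max M 0, le_max_right _ _, fun t ht x =>
    (hM (t, x) ⟨ht, mem_univ x⟩).trans (le_max_left _ _)⟩

lemma congr_initial (h : IsFractalBurgersSolution α u₀ u) {g : ℝ → ℝ} (hg : u₀ =ᵐ[volume] g) :
    IsFractalBurgersSolution α g u where
  bounded := h.bounded
  smooth := h.smooth
  equation := h.equation
  initial φ hφ := by
    have : ∫ x, g x * φ x = ∫ x, u₀ x * φ x :=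
      integral_congr_ae (hg.mono fun x hx => by simp only [hx])
    rw [this]
    exact h.initial φ hφ

end IsFractalBurgersSolution

lemma abs_integral_mul_le_of_abs_le {f χ ρ : ℝ → ℝ} {M K : ℝ} (hM : ∀ x, |f x| ≤ M)
    (hK : ∀ x, |ρ x| ≤ K * χ x) (hχ : Integrable χ) :
    |∫ x, f x * ρ x| ≤ M * K * ∫ x, χ x := by
  have hM0 : 0 ≤ M := (abs_nonneg _).trans (hM 0)
  rw [← integral_const_mul, ← Real.norm_eq_abs]
  refine norm_integral_le_of_norm_le (hχ.const_mul _) (Eventually.of_forall fun x => ?_)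
  rw [norm_mul, mul_assoc]
  exact mul_le_mul (hM x) (hK x) (norm_nonneg _) hM0

/-- Testing a solution against a weight moves away from the initial value at linear speed. -/
lemma IsFractalBurgersSolution.abs_integral_sub_initial_le {α : ℝ} {u₀ : ℝ → ℝ} {u : ℝ → ℝ → ℝ}
    (h : IsFractalBurgersSolution α u₀ u) {T M : ℝ} (hM : ∀ t ∈ Ioo 0 T, ∀ x, |u t x| ≤ M)
    {χ lam : ℝ → ℝ} (hχ : IsDualPair α χ lam) {K K' : ℝ} (hK : ∀ x, |lam x| ≤ K * χ x)
    (hK' : ∀ x, |deriv χ x| ≤ K' * χ x) {t : ℝ} (ht : t ∈ Ioo 0 T) :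
    |(∫ x, u t x * χ x) - ∫ x, u₀ x * χ x| ≤ t * ((M * K + M ^ 2 / 2 * K') * ∫ x, χ x) := by
  have hderiv : ∀ s ∈ Ioo 0 T, ∃ J', HasDerivAt (fun s => ∫ x, u s x * χ x) J' s ∧
      |J'| ≤ (M * K + M ^ 2 / 2 * K') * ∫ x, χ x := by
    intro s hs
    obtain ⟨B, hB⟩ := h.exists_stripBounds (half_pos hs.1) ((half_lt_self hs.1).trans hs.2)
    have hs' : s ∈ Ioo (s / 2) T := ⟨half_lt_self hs.1, hs.2⟩
    have h1 := (hB.hasDerivAt_integral (η := fun y => y) (η' := fun _ => 1)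
      (fun y => hasDerivAt_id y) continuous_const hχ.int hs').2
    have h2 := (entropy_balance hB (η := fun y => y) (η' := fun _ => 1) (q := fun y => y ^ 2 / 2)
      continuous_const (fun y => by simpa using (hasDerivAt_pow 2 y).div_const 2) hχ hs'
      (hB.c11 s hs') (h.equation s hs.1)).2.2
    simp only [one_mul, sub_self, zero_mul, integral_zero, sub_zero] at h1 h2
    refine ⟨_, h1, ?_⟩
    rw [h2, add_mul]
    refine (abs_add_le _ _).trans (add_le_add ?_ ?_)
    · rw [abs_neg]
      exact abs_integral_mul_le_of_abs_le (hM s hs) hK hχ.int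
    · refine abs_integral_mul_le_of_abs_le (fun x => ?_) hK' hχ.int
      rw [abs_div, abs_pow, abs_two]
      have := hM s hs x
      gcongr
  set J : ℝ → ℝ := fun s => ∫ x, u s x * χ x
  set D := (M * K + M ^ 2 / 2 * K') * ∫ x, χ x
  have hD : 0 ≤ D := by
    obtain ⟨_, _, h1⟩ := hderiv t ht
    exact (abs_nonneg _).trans h1
  have hlip : ∀ s ∈ Ioo 0 t, |J t - J s| ≤ t * D := fun s hs => by
    have hsub : Icc s t ⊆ Ioo 0 T := fun r hr => ⟨hs.1.trans_le hr.1, hr.2.trans_lt ht.2⟩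
    have := (convex_Icc s t).norm_image_sub_le_of_norm_deriv_le (f := J) (C := D)
      (fun r hr => (hderiv r (hsub hr)).choose_spec.1.differentiableAt)
      (fun r hr => by
        rw [(hderiv r (hsub hr)).choose_spec.1.deriv]
        exact (hderiv r (hsub hr)).choose_spec.2)
      (left_mem_Icc.2 hs.2.le) (right_mem_Icc.2 hs.2.le)
    refine this.trans ?_
    rw [Real.norm_of_nonneg (by linarith [hs.2]), mul_comm]
    gcongr
    linarith [hs.1]
  have hlim : Tendsto (fun s => |J t - J s|) (𝓝[>] 0) (𝓝 |J t - ∫ x, u₀ x * χ x|) :=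
    ((h.initial χ hχ.int).const_sub (J t)).abs
  exact le_of_tendsto hlim (mem_of_superset (Ioo_mem_nhdsGT ht.1) hlip)

/-- The density of the Gagliardo seminorm of order `α / 2`. -/
noncomputable def gagliardo (α : ℝ) (f : ℝ → ℝ) (x : ℝ) : ℝ :=
  ∫ z, (f (x + z) - f x) ^ 2 / |z| ^ (1 + α)

lemma gagliardo_nonneg (α : ℝ) (f : ℝ → ℝ) (x : ℝ) : 0 ≤ gagliardo α f x :=
  integral_nonneg fun z => by positivity

lemma IsC11.sq {B : ℝ} {f : ℝ → ℝ} (hf : IsC11 B f) : ∃ B', IsC11 B' fun x => f x ^ 2 := by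
  have hB := hf.nonneg
  refine ⟨_, hf.comp (η := fun y => y ^ 2) (η' := fun y => 2 * y) (M := 1 + 2 * B + B ^ 2)
    (by positivity) (fun y => by simpa using hasDerivAt_pow 2 y) (fun x => ?_) (fun x => ?_)
    fun a b => ?_⟩
  · have := hf.bdd x
    rw [abs_pow]
    nlinarith [abs_nonneg (f x)]
  · rw [abs_mul, abs_two]
    nlinarith [hf.bdd x]
  · rw [show b ^ 2 - a ^ 2 - 2 * a * (b - a) = (b - a) ^ 2 by ring, abs_of_nonneg (sq_nonneg _)]
    nlinarith [sq_nonneg (b - a), mul_nonneg hB (sq_nonneg (b - a)), sq_nonneg (B * (b - a))]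

lemma IsC11.integrable_gagliardo {α : ℝ} (hα₁ : 1 < α) (hα₂ : α < 2) {B : ℝ} {f : ℝ → ℝ}
    (hf : IsC11 B f) (x : ℝ) : Integrable fun z => (f (x + z) - f x) ^ 2 / |z| ^ (1 + α) := by
  obtain ⟨B', hB'⟩ := hf.sq
  have := (mul_fracLaplacian_sub_fracLaplacian_comp hα₁ hα₂ hf (η := fun y => y ^ 2)
    (η' := fun y => 2 * y) (fun y => by simpa using hasDerivAt_pow 2 y) hB' x).1
  convert this using 2 with z
  ring

lemma IsC11.two_mul_fracLaplacian_sub {α : ℝ} (hα₁ : 1 < α) (hα₂ : α < 2) {B : ℝ} {f : ℝ → ℝ}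
    (hf : IsC11 B f) (x : ℝ) :
    2 * f x * fracLaplacian α f x - fracLaplacian α (fun x => f x ^ 2) x =
      fracLaplacianConst α * gagliardo α f x := by
  obtain ⟨B', hB'⟩ := hf.sq
  rw [(mul_fracLaplacian_sub_fracLaplacian_comp hα₁ hα₂ hf (η := fun y => y ^ 2)
    (η' := fun y => 2 * y) (fun y => by simpa using hasDerivAt_pow 2 y) hB' x).2, gagliardo]
  congr 2
  ext z
  ring

/-- The weighted energy inequality: the Gagliardo energy is controlled by the decrease of the
weighted `L²` norm, uniformly down to time `0`. -/
lemma IsFractalBurgersSolution.energy {α : ℝ} (hα₁ : 1 < α) (hα₂ : α < 2) {u₀ : ℝ → ℝ}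
    {u : ℝ → ℝ → ℝ} (h : IsFractalBurgersSolution α u₀ u) {T M : ℝ}
    (hM : ∀ t ∈ Ioo 0 T, ∀ x, |u t x| ≤ M)
    {χ lam : ℝ → ℝ} (hχ : IsDualPair α χ lam) {K K' : ℝ} (hK : ∀ x, |lam x| ≤ K * χ x)
    (hK' : ∀ x, |deriv χ x| ≤ K' * χ x) {t : ℝ} (ht : t ∈ Ioo 0 T) :
    Integrable (fun x => gagliardo α (u t) x * χ x) ∧
    ∃ Φ', HasDerivAt (fun s => ∫ x, u s x ^ 2 * χ x) Φ' t ∧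
      Φ' ≤ (M ^ 2 * K + 2 / 3 * M ^ 3 * K') * (∫ x, χ x) -
        fracLaplacianConst α * ∫ x, gagliardo α (u t) x * χ x := by
  obtain ⟨B, hB⟩ := h.exists_stripBounds (half_pos ht.1) ((half_lt_self ht.1).trans ht.2)
  have ht' : t ∈ Ioo (t / 2) T := ⟨half_lt_self ht.1, ht.2⟩
  have hC := fracLaplacianConst_pos hα₁ hα₂
  have hη : ∀ y : ℝ, HasDerivAt (fun y => y ^ 2) (2 * y) y := fun y => by
    simpa using hasDerivAt_pow 2 y
  have hc : Continuous fun y : ℝ => 2 * y := by fun_prop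
  obtain ⟨B', hB'⟩ := (hB.c11 t ht').sq
  have h1 := (hB.hasDerivAt_integral hη hc hχ.int ht').2
  obtain ⟨h2, -, h3⟩ := entropy_balance hB (η := fun y => y ^ 2) (q := fun y => 2 / 3 * y ^ 3) hc
    (fun y => ((hasDerivAt_pow 3 y).const_mul (2 / 3)).congr_deriv (by simp; ring)) hχ ht' hB'
    (h.equation t ht.1)
  simp only [(hB.c11 t ht').two_mul_fracLaplacian_sub hα₁ hα₂] at h2 h3
  have e3 : ∫ x, fracLaplacianConst α * gagliardo α (u t) x * χ x =
      fracLaplacianConst α * ∫ x, gagliardo α (u t) x * χ x := by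
    simp_rw [mul_assoc]
    exact integral_const_mul _ _
  rw [e3] at h3
  refine ⟨?_, _, h1, ?_⟩
  · have := h2.const_mul (fracLaplacianConst α)⁻¹
    simpa only [mul_assoc, inv_mul_cancel_left₀ hC.ne'] using this
  · rw [h3]
    have e1 := abs_integral_mul_le_of_abs_le (f := fun x => u t x ^ 2) (M := M ^ 2)
      (fun x => by rw [abs_pow]; have := hM t ht x; gcongr) hK hχ.int
    have e2 := abs_integral_mul_le_of_abs_le (f := fun x => 2 / 3 * u t x ^ 3)
      (M := 2 / 3 * M ^ 3)
      (fun x => by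
        rw [abs_mul, abs_pow, abs_of_pos (by norm_num : (0 : ℝ) < 2 / 3)]
        have := hM t ht x
        gcongr) hK' hχ.int
    rw [abs_le] at e1 e2
    rw [add_mul]
    linarith [e1.1, e2.2]

/-- A nonnegative dissipation rate compatible with a bounded energy is `o(1/s)` along a sequence
of times `s → 0`. -/
lemma exists_mul_le_of_dissipation {T N D : ℝ} (hT : 0 < T) {Φ F : ℝ → ℝ}
    (hN : ∀ t ∈ Ioo 0 T, |Φ t| ≤ N)
    (hΦ : ∀ t ∈ Ioo 0 T, ∃ Φ', HasDerivAt Φ Φ' t ∧ Φ' ≤ D - F t) {κ τ : ℝ} (hκ : 0 < κ)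
    (hτ : 0 < τ) : ∃ s ∈ Ioo 0 (min τ T), s * F s ≤ κ := by
  -- Otherwise `F s > κ / s`, so that `Φ s - D s + κ log s` is antitone, which contradicts
  -- `log s → -∞` and the boundedness of `Φ`.
  by_contra! hcon
  set r := min τ T / 2 with hr
  have hr0 : 0 < r := half_pos (lt_min hτ hT)
  have hrT : r < min τ T := half_lt_self (lt_min hτ hT)
  choose! Φ' hΦ' hΦle using hΦ
  have hd : ∀ s ∈ Ioc 0 r, HasDerivAt (fun s => Φ s - D * s + κ * Real.log s)
      (Φ' s - D + κ * s⁻¹) s := fun s hs => by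
    have h1 := hΦ' s ⟨hs.1, hs.2.trans_lt (hrT.trans_le (min_le_right _ _))⟩
    exact ((h1.sub ((hasDerivAt_id s).const_mul D)).add
      ((Real.hasDerivAt_log hs.1.ne').const_mul κ)).congr_deriv (by simp)
  have hanti : AntitoneOn (fun s => Φ s - D * s + κ * Real.log s) (Ioc 0 r) := by
    refine antitoneOn_of_deriv_nonpos (convex_Ioc 0 r)
      (fun s hs => (hd s hs).continuousAt.continuousWithinAt)
      (fun s hs => ((hd s (interior_subset hs)).differentiableAt.differentiableWithinAt))
      fun s hs => ?_
    have hs' := interior_subset hs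
    rw [(hd s hs').deriv]
    have h1 := hΦle s ⟨hs'.1, hs'.2.trans_lt (hrT.trans_le (min_le_right _ _))⟩
    have h2 := hcon s ⟨hs'.1, hs'.2.trans_lt hrT⟩
    have h3 : κ * s⁻¹ < F s := by
      rw [← div_eq_mul_inv, div_lt_iff₀ hs'.1]; linarith
    linarith
  have hlim : Tendsto (fun s : ℝ => N + |D| * r + κ * Real.log s) (𝓝[>] 0) atBot :=
    tendsto_atBot_add_const_left _ _ (Real.tendsto_log_nhdsGT_zero.const_mul_atBot hκ)
  obtain ⟨s, hs, hs'⟩ := ((hlim.eventually_lt_atBot (Φ r - D * r + κ * Real.log r)).and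
    (Ioo_mem_nhdsGT hr0)).exists
  have h1 := hanti ⟨hs'.1, hs'.2.le⟩ ⟨hr0, le_rfl⟩ hs'.2.le
  have h2 := abs_le.1 (hN s ⟨hs'.1, hs'.2.trans (hrT.trans_le (min_le_right _ _))⟩)
  have h3 : -(|D| * r) ≤ D * s := by
    have : |D * s| ≤ |D| * r := by
      rw [abs_mul, abs_of_pos hs'.1]; gcongr; exact hs'.2.le
    exact (abs_le.1 this).1
  simp only at h1
  linarith

/-! ### Strong attainment of the initial datum -/

/-- Bounded measurable functions that are continuous almost everywhere. Functions of bounded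
variation are of this kind. -/
structure IsRegularDatum (g : ℝ → ℝ) : Prop where
  meas : Measurable g
  bdd : ∃ B, ∀ x, |g x| ≤ B
  cont : ∀ᵐ x, ContinuousAt g x

/-- Mollification at scale `ε` by the Cauchy kernel. -/
noncomputable def cauchyMean (ε : ℝ) (f : ℝ → ℝ) (x : ℝ) : ℝ :=
  (ε * Real.pi)⁻¹ * ∫ y, f y * cauchyWeight x ε y

lemma measurable_cauchyMean (ε : ℝ) {f : ℝ → ℝ} (hf : Measurable f) :
    Measurable (cauchyMean ε f) := by
  unfold cauchyMean
  refine Measurable.const_mul (StronglyMeasurable.measurable ?_) _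
  refine StronglyMeasurable.integral_prod_right (f := fun x y : ℝ => f y * cauchyWeight x ε y) ?_
  exact Measurable.stronglyMeasurable (by unfold Function.uncurry cauchyWeight; fun_prop)

lemma cauchyMean_eq {ε : ℝ} (hε : 0 < ε) (f : ℝ → ℝ) (x : ℝ) :
    cauchyMean ε f x = Real.pi⁻¹ * ∫ y, f (x + ε * y) * (1 + y ^ 2)⁻¹ := by
  unfold cauchyMean cauchyWeight
  have e : ∀ y, f y * (1 + ((y - x) / ε) ^ 2)⁻¹ =
      f (x + ε * ((y - x) / ε)) * (1 + ((y - x) / ε) ^ 2)⁻¹ := fun y => by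
    congr 2; field_simp; ring
  simp_rw [e]
  rw [integral_sub_right_eq_self (fun y => f (x + ε * (y / ε)) * (1 + (y / ε) ^ 2)⁻¹) x,
    Measure.integral_comp_div (fun y => f (x + ε * y) * (1 + y ^ 2)⁻¹) ε, abs_of_pos hε,
    smul_eq_mul]
  field_simp

lemma abs_cauchyMean_le {ε B : ℝ} (hε : 0 < ε) {f : ℝ → ℝ} (hB : ∀ x, |f x| ≤ B) (x : ℝ) :
    |cauchyMean ε f x| ≤ B := by
  have hp : 0 < ε * Real.pi := mul_pos hε Real.pi_pos
  have h := abs_integral_mul_le_of_abs_le (K := 1) hB (ρ := cauchyWeight x ε)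
    (fun y => by rw [abs_of_pos (cauchyWeight_pos x ε y), one_mul]) (integrable_cauchyWeight x hε)
  rw [integral_cauchyWeight x hε, mul_one] at h
  rw [cauchyMean, abs_mul, abs_of_pos (inv_pos.2 hp), inv_mul_le_iff₀ hp]
  linarith

lemma IsRegularDatum.tendsto_integral_abs_cauchyMean_sub {g χ : ℝ → ℝ} (hg : IsRegularDatum g)
    (hχ : Integrable χ) :
    Tendsto (fun ε => ∫ x, |cauchyMean ε g x - g x| * χ x) (𝓝[>] 0) (𝓝 0) := by
  obtain ⟨B, hB⟩ := hg.bdd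
  have hgm := hg.meas
  have key : ∀ x, ContinuousAt g x → Tendsto (fun ε => cauchyMean ε g x) (𝓝[>] 0) (𝓝 (g x)) := by
    intro x hx
    have h1 : Tendsto (fun ε => ∫ y, g (x + ε * y) * (1 + y ^ 2)⁻¹) (𝓝[>] 0)
        (𝓝 (∫ y, g x * (1 + y ^ 2)⁻¹)) := by
      refine tendsto_integral_filter_of_dominated_convergence (fun y => B * (1 + y ^ 2)⁻¹)
        (Eventually.of_forall fun ε => Measurable.aestronglyMeasurable (by fun_prop))
        (Eventually.of_forall fun ε => Eventually.of_forall fun y => ?_)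
        (integrable_inv_one_add_sq.const_mul B) (Eventually.of_forall fun y => ?_)
      · rw [norm_mul, Real.norm_of_nonneg (by positivity : 0 ≤ (1 + y ^ 2)⁻¹)]
        gcongr
        exact hB _
      · refine Tendsto.mul_const _ ?_
        have h2 : Tendsto (fun ε : ℝ => x + ε * y) (𝓝[>] 0) (𝓝 x) := by
          have : Tendsto (fun ε : ℝ => x + ε * y) (𝓝 0) (𝓝 (x + 0 * y)) :=
            Continuous.tendsto (by fun_prop) _
          rw [zero_mul, add_zero] at this
          exact this.mono_left nhdsWithin_le_nhds
        exact hx.tendsto.comp h2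
    have h3 := h1.const_mul Real.pi⁻¹
    rw [integral_const_mul, integral_univ_inv_one_add_sq,
      show Real.pi⁻¹ * (g x * Real.pi) = g x by field_simp] at h3
    exact h3.congr' (eventually_mem_nhdsWithin.mono fun ε hε => (cauchyMean_eq hε g x).symm)
  have : Tendsto (fun ε => ∫ x, |cauchyMean ε g x - g x| * χ x) (𝓝[>] 0)
      (𝓝 (∫ _ : ℝ, (0 : ℝ))) := by
    refine tendsto_integral_filter_of_dominated_convergence (fun x => 2 * B * ‖χ x‖)
      (Eventually.of_forall fun ε => ?_) (eventually_mem_nhdsWithin.mono fun ε hε => ?_)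
      (hχ.norm.const_mul _) ?_
    · exact (((measurable_cauchyMean ε hgm).sub hgm).abs).aestronglyMeasurable.mul hχ.1
    · refine Eventually.of_forall fun x => ?_
      rw [norm_mul, Real.norm_eq_abs, abs_abs]
      gcongr
      have := abs_sub (cauchyMean ε g x) (g x)
      linarith [abs_cauchyMean_le hε hB x, hB x]
    · filter_upwards [hg.cont] with x hx
      have := (((key x hx).sub_const (g x)).abs).mul_const (χ x)
      simpa using this
  simpa using this

/-- The mass of the Cauchy profile outside `[-K, K]`. -/
noncomputable def cauchyTail (K : ℝ) : ℝ :=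
  ∫ y, {y : ℝ | K < |y|}.indicator (fun y => (1 + y ^ 2)⁻¹) y

lemma measurableSet_lt_abs (K : ℝ) : MeasurableSet {y : ℝ | K < |y|} :=
  measurableSet_lt measurable_const measurable_id.abs

lemma tendsto_cauchyTail : Tendsto cauchyTail atTop (𝓝 0) := by
  have : Tendsto cauchyTail atTop (𝓝 (∫ _ : ℝ, (0 : ℝ))) := by
    refine tendsto_integral_filter_of_dominated_convergence (fun y => (1 + y ^ 2)⁻¹)
      (Eventually.of_forall fun K => (Measurable.indicator (by fun_prop)
        (measurableSet_lt_abs K)).aestronglyMeasurable)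
      (Eventually.of_forall fun K => Eventually.of_forall fun y => ?_)
      integrable_inv_one_add_sq (Eventually.of_forall fun y => ?_)
    · refine (norm_indicator_le_norm_self _ _).trans ?_
      rw [Real.norm_of_nonneg (by positivity)]
    · refine tendsto_const_nhds.congr' ?_
      filter_upwards [eventually_ge_atTop |y|] with K hK
      rw [indicator_of_notMem]
      simpa using hK
  simpa using this

/-- The mollification error in terms of the Gagliardo density: increments over distances at most
`K ε` are charged to the Gagliardo density, the remaining ones to the tail of the kernel. -/
lemma IsC11.abs_sub_cauchyMean_le {α : ℝ} (hα₁ : 1 < α) (hα₂ : α < 2) {B M : ℝ} {f : ℝ → ℝ}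
    (hf : IsC11 B f) (hM : ∀ x, |f x| ≤ M) {ε K β : ℝ} (hε : 0 < ε) (hK : 0 < K) (hβ : 0 < β)
    (x : ℝ) :
    |f x - cauchyMean ε f x| ≤ β + K ^ (1 + α) * ε ^ α / (Real.pi * β) * gagliardo α f x +
      2 * M / Real.pi * cauchyTail K := by
  have hp := Real.pi_pos
  have hεp : 0 < ε * Real.pi := mul_pos hε hp
  have hfc := hf.continuous
  have hM0 : 0 ≤ M := (abs_nonneg _).trans (hM 0)
  have hint : ∀ y₀ : ℝ, Integrable fun y => (f x - f (y₀ + y)) * cauchyWeight 0 ε y := fun y₀ =>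
    (integrable_cauchyWeight 0 hε).bdd_mul (c := 2 * M) (by fun_prop)
      (Eventually.of_forall fun y => by
        have := abs_sub (f x) (f (y₀ + y))
        rw [Real.norm_eq_abs]
        linarith [hM x, hM (y₀ + y)])
  have e1 : f x - cauchyMean ε f x =
      (ε * Real.pi)⁻¹ * ∫ z, (f x - f (x + z)) * cauchyWeight 0 ε z := by
    have h1 : ∫ y, f y * cauchyWeight x ε y = ∫ z, f (x + z) * cauchyWeight 0 ε z := by
      rw [← integral_add_left_eq_self _ x]
      simp [cauchyWeight]
    have h2 : Integrable fun z => f (x + z) * cauchyWeight 0 ε z :=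
      (integrable_cauchyWeight 0 hε).bdd_mul (c := M) (by fun_prop)
        (Eventually.of_forall fun y => hM _)
    simp_rw [sub_mul]
    rw [integral_sub ((integrable_cauchyWeight 0 hε).const_mul _) h2, integral_const_mul,
      integral_cauchyWeight 0 hε, cauchyMean, h1]
    field_simp
  set ind : ℝ → ℝ := {y : ℝ | K < |y|}.indicator (fun y => (1 + y ^ 2)⁻¹) with hind
  have hindi : Integrable ind := integrable_inv_one_add_sq.indicator (measurableSet_lt_abs K)
  have i1 := (integrable_cauchyWeight 0 hε).const_mul β
  have i2 := (hf.integrable_gagliardo hα₁ hα₂ x).const_mul ((K * ε) ^ (1 + α) / β)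
  have i3 := (hindi.comp_div hε.ne').const_mul (2 * M)
  have hpt : ∀ z, ‖(f x - f (x + z)) * cauchyWeight 0 ε z‖ ≤ β * cauchyWeight 0 ε z +
      (K * ε) ^ (1 + α) / β * ((f (x + z) - f x) ^ 2 / |z| ^ (1 + α)) + 2 * M * ind (z / ε) := by
    intro z
    have hw := cauchyWeight_pos 0 ε z
    rw [norm_mul, Real.norm_of_nonneg hw.le, Real.norm_eq_abs, abs_sub_comm]
    set d := f (x + z) - f x with hd
    have hi0 : 0 ≤ ind (z / ε) := indicator_nonneg (fun y _ => by positivity) _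
    have hg0 : 0 ≤ (K * ε) ^ (1 + α) / β * (d ^ 2 / |z| ^ (1 + α)) := by positivity
    rcases le_or_gt |z| (K * ε) with hz | hz
    · have h1 : |d| ≤ β + d ^ 2 / β := by
        rw [← sub_le_iff_le_add', le_div_iff₀ hβ]
        nlinarith [sq_abs d, sq_nonneg (|d| - β), abs_nonneg d]
      have h2 : d ^ 2 / β * cauchyWeight 0 ε z ≤
          (K * ε) ^ (1 + α) / β * (d ^ 2 / |z| ^ (1 + α)) := by
        rcases eq_or_ne z 0 with rfl | hz0
        · simp [hd]
        have hz' : 0 < |z| ^ (1 + α) := Real.rpow_pos_of_pos (abs_pos.2 hz0) _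
        calc d ^ 2 / β * cauchyWeight 0 ε z ≤ d ^ 2 / β * 1 := by
              gcongr; exact cauchyWeight_le_one 0 ε z
          _ ≤ d ^ 2 / β * ((K * ε) ^ (1 + α) / |z| ^ (1 + α)) := by
              gcongr
              rw [one_le_div hz']
              gcongr
          _ = _ := by ring
      nlinarith [mul_le_mul_of_nonneg_right h1 hw.le, mul_nonneg hM0 hi0]
    · have h1 : ind (z / ε) = cauchyWeight 0 ε z := by
        rw [hind, indicator_of_mem, cauchyWeight, sub_zero]
        rw [mem_ofPred_eq, abs_div, abs_of_pos hε, lt_div_iff₀ hε]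
        exact hz
      have h2 : |d| ≤ 2 * M := by
        have := abs_sub (f (x + z)) (f x)
        linarith [hM x, hM (x + z)]
      rw [h1]
      nlinarith [mul_le_mul_of_nonneg_right h2 hw.le, mul_pos hβ hw]
  have hI := norm_integral_le_of_norm_le ((i1.fun_add i2).fun_add i3) (Eventually.of_forall hpt)
  rw [integral_add (i1.fun_add i2) i3, integral_add i1 i2, integral_const_mul, integral_const_mul,
    integral_const_mul, integral_cauchyWeight 0 hε, Measure.integral_comp_div ind ε,
    abs_of_pos hε, smul_eq_mul, Real.norm_eq_abs] at hI
  rw [e1, abs_mul, abs_of_pos (inv_pos.2 hεp), inv_mul_le_iff₀ hεp]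
  refine hI.trans (le_of_eq ?_)
  change β * (ε * Real.pi) + (K * ε) ^ (1 + α) / β * gagliardo α f x +
    2 * M * (ε * cauchyTail K) = _
  rw [Real.mul_rpow hK.le hε.le, Real.rpow_add hε, Real.rpow_one]
  field_simp

/-- Quantitative distance of a solution to its datum: the three scales `ε`, `K`, `β` are free. -/
lemma IsFractalBurgersSolution.integral_abs_sub_initial_le {α : ℝ} (hα₁ : 1 < α) (hα₂ : α < 2)
    {g : ℝ → ℝ} {u : ℝ → ℝ → ℝ} (h : IsFractalBurgersSolution α g u) (hg : IsRegularDatum g)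
    {T M : ℝ} (hM : ∀ t ∈ Ioo 0 T, ∀ x, |u t x| ≤ M) {R : ℝ} (hR : 0 < R) {s : ℝ}
    (hs : s ∈ Ioo 0 T) {ε K β : ℝ} (hε : 0 < ε) (hK : 0 < K) (hβ : 0 < β) :
    ∫ x, |u s x - g x| * cauchyWeight 0 R x ≤
      β * (R * Real.pi) +
      K ^ (1 + α) * ε ^ α / (Real.pi * β) * (∫ x, gagliardo α (u s) x * cauchyWeight 0 R x) +
      2 * M / Real.pi * cauchyTail K * (R * Real.pi) +
      s * (M * (profileDualConst α * ε ^ (-α)) + M ^ 2 / 2 * ε⁻¹) * (R * Real.pi) +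
      ∫ x, |cauchyMean ε g x - g x| * cauchyWeight 0 R x := by
  obtain ⟨B, hB⟩ := h.exists_stripBounds (half_pos hs.1) ((half_lt_self hs.1).trans hs.2)
  have hs' : s ∈ Ioo (s / 2) T := ⟨half_lt_self hs.1, hs.2⟩
  have hu := hB.c11 s hs'
  have hum := hu.continuous.measurable
  have hgm := hg.meas
  have hp := Real.pi_pos
  obtain ⟨N, hN⟩ := hg.bdd
  have hχ := integrable_cauchyWeight 0 hR
  have hw : ∀ x, |cauchyDual α 0 R x| ≤ profileDualConst α * R ^ (-α) * cauchyWeight 0 R x :=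
    abs_cauchyDual_le hα₁ hα₂ 0 hR
  have hF := (h.energy hα₁ hα₂ hM (isDualPair_cauchyWeight hα₁ hα₂ 0 hR) hw
    (abs_deriv_cauchyWeight_le 0 hR) hs).1
  have h2 : ∀ x, |cauchyMean ε (u s) x - cauchyMean ε g x| ≤
      s * (M * (profileDualConst α * ε ^ (-α)) + M ^ 2 / 2 * ε⁻¹) := by
    intro x
    have := h.abs_integral_sub_initial_le hM (isDualPair_cauchyWeight hα₁ hα₂ x hε)
      (abs_cauchyDual_le hα₁ hα₂ x hε) (abs_deriv_cauchyWeight_le x hε) hs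
    rw [integral_cauchyWeight x hε] at this
    have hp' : 0 < ε * Real.pi := mul_pos hε hp
    rw [cauchyMean, cauchyMean, ← mul_sub, abs_mul, abs_of_pos (inv_pos.2 hp'),
      inv_mul_le_iff₀ hp']
    linarith
  have hgε : Integrable fun x => |cauchyMean ε g x - g x| * cauchyWeight 0 R x := by
    refine hχ.bdd_mul (c := 2 * N)
      (((measurable_cauchyMean ε hgm).sub hgm).abs).aestronglyMeasurable
      (Eventually.of_forall fun x => ?_)
    rw [Real.norm_eq_abs, abs_abs]
    have := abs_sub (cauchyMean ε g x) (g x)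
    linarith [abs_cauchyMean_le hε hN x, hN x]
  set c2 := K ^ (1 + α) * ε ^ α / (Real.pi * β) with hc2
  set c3 := 2 * M / Real.pi * cauchyTail K with hc3
  set c4 := s * (M * (profileDualConst α * ε ^ (-α)) + M ^ 2 / 2 * ε⁻¹) with hc4
  have j1 := hχ.const_mul β
  have j2 := hF.const_mul c2
  have j3 := hχ.const_mul c3
  have j4 := hχ.const_mul c4
  have hpt : ∀ x, ‖|u s x - g x| * cauchyWeight 0 R x‖ ≤ β * cauchyWeight 0 R x +
      c2 * (gagliardo α (u s) x * cauchyWeight 0 R x) + c3 * cauchyWeight 0 R x +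
      c4 * cauchyWeight 0 R x + |cauchyMean ε g x - g x| * cauchyWeight 0 R x := by
    intro x
    have h1 := hu.abs_sub_cauchyMean_le hα₁ hα₂ (hM s hs) hε hK hβ x
    have e : u s x - g x = (u s x - cauchyMean ε (u s) x) +
      (cauchyMean ε (u s) x - cauchyMean ε g x) + (cauchyMean ε g x - g x) := by ring
    have h3 : |u s x - g x| ≤ β + c2 * gagliardo α (u s) x + c3 + c4 +
        |cauchyMean ε g x - g x| := by
      rw [e]
      refine (abs_add_three _ _ _).trans ?_
      have := h2 x
      gcongr
    rw [Real.norm_of_nonneg (mul_nonneg (abs_nonneg _) (cauchyWeight_pos 0 R x).le)]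
    refine (mul_le_mul_of_nonneg_right h3 (cauchyWeight_pos 0 R x).le).trans (le_of_eq (by ring))
  have := norm_integral_le_of_norm_le ((((j1.fun_add j2).fun_add j3).fun_add j4).fun_add hgε)
    (Eventually.of_forall hpt)
  rw [integral_add (((j1.fun_add j2).fun_add j3).fun_add j4) hgε,
    integral_add ((j1.fun_add j2).fun_add j3) j4, integral_add (j1.fun_add j2) j3,
    integral_add j1 j2, integral_const_mul, integral_const_mul, integral_const_mul,
    integral_const_mul, integral_cauchyWeight 0 hR] at this
  exact (le_abs_self _).trans this

/-- At times `s` where the Gagliardo energy is `o(1/s)`, the solution is close to its datum. The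
mollification scale is a large multiple of the parabolic scale `s ^ (1 / α)`; as `α > 1`, the
convection term is of lower order there. -/
lemma IsFractalBurgersSolution.exists_energy_threshold {α : ℝ} (hα₁ : 1 < α) (hα₂ : α < 2)
    {g : ℝ → ℝ} {u : ℝ → ℝ → ℝ} (h : IsFractalBurgersSolution α g u) (hg : IsRegularDatum g)
    {T M : ℝ} (hT : 0 < T) (hM : ∀ t ∈ Ioo 0 T, ∀ x, |u t x| ≤ M) {R : ℝ} (hR : 0 < R) {κ : ℝ}
    (hκ : 0 < κ) :
    ∃ κ' > 0, ∀ᶠ s in 𝓝[>] 0,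
      s * (∫ x, gagliardo α (u s) x * cauchyWeight 0 R x) ≤ κ' →
        ∫ x, |u s x - g x| * cauchyWeight 0 R x ≤ κ := by
  have hp := Real.pi_pos
  have hα0 : 0 < α := by linarith
  set I := R * Real.pi with hI
  have hI0 : 0 < I := mul_pos hR hp
  obtain ⟨K, hK0, hK⟩ : ∃ K > 0, 2 * M / Real.pi * cauchyTail K * I < κ / 6 := by
    have h1 : Tendsto (fun K => 2 * M / Real.pi * cauchyTail K * I) atTop
        (𝓝 (2 * M / Real.pi * 0 * I)) := (tendsto_cauchyTail.const_mul _).mul_const _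
    rw [mul_zero, zero_mul] at h1
    obtain ⟨K, h2, h3⟩ := ((h1.eventually_lt_const (by positivity : 0 < κ / 6)).and
      (eventually_gt_atTop 0)).exists
    exact ⟨K, h3, h2⟩
  obtain ⟨L, hL0, hL⟩ : ∃ L > 0, M * (profileDualConst α * L ^ (-α)) * I < κ / 6 := by
    have h1 : Tendsto (fun L : ℝ => M * (profileDualConst α * L ^ (-α)) * I) atTop
        (𝓝 (M * (profileDualConst α * 0) * I)) :=
      (((tendsto_rpow_neg_atTop hα0).const_mul _).const_mul _).mul_const _
    rw [mul_zero, mul_zero, zero_mul] at h1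
    obtain ⟨L, h2, h3⟩ := ((h1.eventually_lt_const (by positivity : 0 < κ / 6)).and
      (eventually_gt_atTop 0)).exists
    exact ⟨L, h3, h2⟩
  set β := κ / 6 / I with hβ
  have hβ0 : 0 < β := by positivity
  have hKp : 0 < K ^ (1 + α) := Real.rpow_pos_of_pos hK0 _
  have hLp : 0 < L ^ α := Real.rpow_pos_of_pos hL0 _
  refine ⟨κ / 6 * (Real.pi * β) / (K ^ (1 + α) * L ^ α), by positivity, ?_⟩
  have hε : Tendsto (fun s : ℝ => L * s ^ (1 / α)) (𝓝[>] 0) (𝓝[>] 0) := by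
    refine tendsto_nhdsWithin_iff.2 ⟨?_, eventually_mem_nhdsWithin.mono fun s hs =>
      mul_pos hL0 (Real.rpow_pos_of_pos hs _)⟩
    have : Tendsto (fun s : ℝ => L * s ^ (1 / α)) (𝓝 0) (𝓝 (L * 0 ^ (1 / α))) :=
      ((Real.continuousAt_rpow_const 0 (1 / α) (Or.inr (by positivity))).tendsto).const_mul L
    rw [Real.zero_rpow (by positivity), mul_zero] at this
    exact this.mono_left nhdsWithin_le_nhds
  have hconv : Tendsto (fun s : ℝ => M ^ 2 / 2 * L⁻¹ * s ^ (1 - 1 / α) * I) (𝓝[>] 0) (𝓝 0) := by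
    have hpos : 0 < 1 - 1 / α := by
      rw [sub_pos, div_lt_one hα0]; exact hα₁
    have : Tendsto (fun s : ℝ => M ^ 2 / 2 * L⁻¹ * s ^ (1 - 1 / α) * I) (𝓝 0)
        (𝓝 (M ^ 2 / 2 * L⁻¹ * 0 ^ (1 - 1 / α) * I)) :=
      ((Real.continuousAt_rpow_const 0 (1 - 1 / α)
        (Or.inr hpos.le)).tendsto.const_mul _).mul_const _
    rw [Real.zero_rpow hpos.ne', mul_zero, zero_mul] at this
    exact this.mono_left nhdsWithin_le_nhds
  have hmean := (hg.tendsto_integral_abs_cauchyMean_sub (integrable_cauchyWeight 0 hR)).comp hε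
  filter_upwards [Ioo_mem_nhdsGT hT, hconv.eventually_lt_const (by positivity : 0 < κ / 6),
    hmean.eventually_lt_const (by positivity : 0 < κ / 6)] with s hs hs1 hs2 hs3
  have hsα : 0 < s ^ (1 / α) := Real.rpow_pos_of_pos hs.1 _
  have hε0 : 0 < L * s ^ (1 / α) := mul_pos hL0 hsα
  have hmain := h.integral_abs_sub_initial_le hα₁ hα₂ hg hM hR hs hε0 hK0 hβ0
  have e1 : (L * s ^ (1 / α)) ^ α = L ^ α * s := by
    rw [Real.mul_rpow hL0.le hsα.le, ← Real.rpow_mul hs.1.le, one_div_mul_cancel hα0.ne',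
      Real.rpow_one]
  have e2 : s * (L * s ^ (1 / α)) ^ (-α) = L ^ (-α) := by
    have := hs.1
    rw [Real.rpow_neg hε0.le, e1, Real.rpow_neg hL0.le]
    field_simp
  have e3 : s * (L * s ^ (1 / α))⁻¹ = L⁻¹ * s ^ (1 - 1 / α) := by
    rw [Real.rpow_sub hs.1, Real.rpow_one]
    field_simp
  have t1 : β * I = κ / 6 := by rw [hβ]; field_simp
  have t2 : K ^ (1 + α) * (L * s ^ (1 / α)) ^ α / (Real.pi * β) *
      (∫ x, gagliardo α (u s) x * cauchyWeight 0 R x) ≤ κ / 6 := by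
    rw [e1]
    rw [le_div_iff₀ (by positivity)] at hs3
    rw [div_mul_eq_mul_div, div_le_iff₀ (by positivity)]
    linarith
  have t4 : s * (M * (profileDualConst α * (L * s ^ (1 / α)) ^ (-α)) +
      M ^ 2 / 2 * (L * s ^ (1 / α))⁻¹) * I =
      M * (profileDualConst α * L ^ (-α)) * I + M ^ 2 / 2 * L⁻¹ * s ^ (1 - 1 / α) * I := by
    rw [mul_assoc (M ^ 2 / 2), ← e2, ← e3]; ring
  simp only [Function.comp_apply] at hs2
  rw [← hI, t1, t4] at hmain
  linarith

/-- Two solutions are simultaneously close to their data at arbitrarily small times. -/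
lemma exists_time_near_initial {α : ℝ} (hα₁ : 1 < α) (hα₂ : α < 2) {g g' : ℝ → ℝ}
    {u v : ℝ → ℝ → ℝ} (hu : IsFractalBurgersSolution α g u) (hg : IsRegularDatum g)
    (hv : IsFractalBurgersSolution α g' v) (hg' : IsRegularDatum g') {R : ℝ} (hR : 0 < R)
    {κ τ : ℝ} (hκ : 0 < κ) (hτ : 0 < τ) :
    ∃ s ∈ Ioo 0 τ, ∫ x, |u s x - g x| * cauchyWeight 0 R x ≤ κ ∧
      ∫ x, |v s x - g' x| * cauchyWeight 0 R x ≤ κ := by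
  have hC := fracLaplacianConst_pos hα₁ hα₂
  obtain ⟨M, hM0, hM⟩ := hu.exists_bound one_pos
  obtain ⟨M', hM0', hM'⟩ := hv.exists_bound one_pos
  obtain ⟨κ₁, hκ₁, h1⟩ := hu.exists_energy_threshold hα₁ hα₂ hg one_pos hM hR hκ
  obtain ⟨κ₂, hκ₂, h2⟩ := hv.exists_energy_threshold hα₁ hα₂ hg' one_pos hM' hR hκ
  obtain ⟨τ', hτ', hτsub⟩ := mem_nhdsGT_iff_exists_Ioo_subset.1 (h1.and h2)
  have hpair := isDualPair_cauchyWeight hα₁ hα₂ 0 hR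
  have hw := abs_cauchyDual_le hα₁ hα₂ 0 hR
  have hw' := abs_deriv_cauchyWeight_le 0 hR
  have eu := fun t (ht : t ∈ Ioo (0 : ℝ) 1) => (hu.energy hα₁ hα₂ hM hpair hw hw' ht).2
  have ev := fun t (ht : t ∈ Ioo (0 : ℝ) 1) => (hv.energy hα₁ hα₂ hM' hpair hw hw' ht).2
  have hbound : ∀ {f : ℝ → ℝ} {M : ℝ}, (∀ x, |f x| ≤ M) →
      |∫ x, f x ^ 2 * cauchyWeight 0 R x| ≤ M ^ 2 * 1 * ∫ x, cauchyWeight 0 R x := fun hf =>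
    abs_integral_mul_le_of_abs_le (fun x => by rw [abs_pow]; have := hf x; gcongr)
      (fun x => by rw [abs_of_pos (cauchyWeight_pos 0 R x), one_mul])
      (integrable_cauchyWeight 0 hR)
  set Fu : ℝ → ℝ := fun t => ∫ x, gagliardo α (u t) x * cauchyWeight 0 R x
  set Fv : ℝ → ℝ := fun t => ∫ x, gagliardo α (v t) x * cauchyWeight 0 R x
  have hnn : ∀ (f : ℝ → ℝ), 0 ≤ ∫ x, gagliardo α f x * cauchyWeight 0 R x := fun f =>
    integral_nonneg fun x => mul_nonneg (gagliardo_nonneg α f x) (cauchyWeight_pos 0 R x).le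
  obtain ⟨s, hs, hs'⟩ := exists_mul_le_of_dissipation one_pos
    (Φ := fun t => (∫ x, u t x ^ 2 * cauchyWeight 0 R x) + ∫ x, v t x ^ 2 * cauchyWeight 0 R x)
    (F := fun t => fracLaplacianConst α * Fu t + fracLaplacianConst α * Fv t)
    (fun t ht => (abs_add_le _ _).trans (add_le_add (hbound (hM t ht)) (hbound (hM' t ht))))
    (D := (M ^ 2 * (profileDualConst α * R ^ (-α)) + 2 / 3 * M ^ 3 * R⁻¹) *
        (∫ x, cauchyWeight 0 R x) +
      (M' ^ 2 * (profileDualConst α * R ^ (-α)) + 2 / 3 * M' ^ 3 * R⁻¹) *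
        ∫ x, cauchyWeight 0 R x)
    (fun t ht => by
      obtain ⟨a, ha, ha'⟩ := eu t ht
      obtain ⟨b, hb, hb'⟩ := ev t ht
      exact ⟨a + b, ha.add hb, (add_le_add ha' hb').trans (le_of_eq (by simp only [Fu, Fv]; ring))⟩)
    (κ := fracLaplacianConst α * min κ₁ κ₂) (τ := min τ τ')
    (mul_pos hC (lt_min hκ₁ hκ₂)) (lt_min hτ hτ')
  have hsum : s * (Fu s + Fv s) ≤ min κ₁ κ₂ :=
    le_of_mul_le_mul_left (le_trans (le_of_eq (by ring)) hs') hC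
  have hsτ : s < min τ τ' := hs.2.trans_le (min_le_left _ _)
  have hmem := hτsub ⟨hs.1, hsτ.trans_le (min_le_right _ _)⟩
  have hs0 := hs.1
  have pu : 0 ≤ s * Fu s := mul_nonneg hs0.le (hnn _)
  have pv : 0 ≤ s * Fv s := mul_nonneg hs0.le (hnn _)
  rw [mul_add] at hsum
  refine ⟨s, ⟨hs0, hsτ.trans_le (min_le_left _ _)⟩, hmem.1 ?_, hmem.2 ?_⟩
  · exact le_trans (by linarith) (hsum.trans (min_le_left _ _))
  · exact le_trans (by linarith) (hsum.trans (min_le_right _ _))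

/-! ### Weighted Kato inequality and the `L¹` contraction -/

/-- The weighted Kato inequality for the difference `w` of two solutions, for the regularised
absolute value. The regularisation costs `δ` times a bound on the derivatives of the solutions,
which is finite on every strip away from the initial time. -/
lemma exists_hasDerivAt_integral_smoothAbs_le {α : ℝ} (hα₁ : 1 < α) (hα₂ : α < 2)
    {u v : ℝ → ℝ → ℝ} {a T B B' M : ℝ} (hu : StripBounds a T B u) (hv : StripBounds a T B' v)
    {t : ℝ} (ht : t ∈ Ioo a T)
    (hequ : ∀ x, deriv (fun s => u s x) t + fracLaplacian α (u t) x + u t x * deriv (u t) x = 0)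
    (heqv : ∀ x, deriv (fun s => v s x) t + fracLaplacian α (v t) x + v t x * deriv (v t) x = 0)
    (hMu : ∀ x, |u t x| ≤ M) (hMv : ∀ x, |v t x| ≤ M)
    {χ lam W : ℝ → ℝ} (hχ : IsDualPair α χ lam) (hχ0 : ∀ x, 0 ≤ χ x) (hW : Integrable W)
    {K K' : ℝ} (hK : ∀ x, |lam x| ≤ K * W x) (hK' : ∀ x, |deriv χ x| ≤ K' * W x)
    {δ : ℝ} (hδ : 0 < δ) :
    ∃ Φ', HasDerivAt (fun s => ∫ x, smoothAbs δ (u s x - v s x) * χ x) Φ' t ∧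
      Φ' ≤ (K + M * K') * (∫ x, smoothAbs δ (u t x - v t x) * W x) +
        δ * (3 * (B + B')) * ∫ x, χ x := by
  have hC := fracLaplacianConst_pos hα₁ hα₂
  have hut := hu.c11 t ht
  have hvt := hv.c11 t ht
  have hB := hut.nonneg
  have hB' := hvt.nonneg
  set S := B + B' with hS
  have hS0 : 0 ≤ S := add_nonneg hB hB'
  have hw := hu.sub hv
  have hwt := hw.c11 t ht
  obtain ⟨N, hN⟩ := hwt.smoothAbs hδ
  obtain ⟨hi, hd⟩ := hw.hasDerivAt_integral (hasDerivAt_smoothAbs hδ)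
    (continuous_deriv_smoothAbs hδ) hχ.int ht
  refine ⟨_, hd, ?_⟩
  set η' : ℝ → ℝ := fun y => y / √(y ^ 2 + δ ^ 2) with hη'
  set w : ℝ → ℝ := fun x => u t x - v t x with hwdef
  set b : ℝ → ℝ := fun x => (u t x + v t x) / 2 with hb
  set b' : ℝ → ℝ := fun x => (deriv (u t) x + deriv (v t) x) / 2 with hb'
  have hwd : ∀ x, deriv w x = deriv (u t) x - deriv (v t) x := fun x =>
    deriv_fun_sub (hut.diff x) (hvt.diff x)
  have hbd : ∀ x, HasDerivAt b (b' x) x := fun x =>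
    ((hut.diff x).hasDerivAt.add (hvt.diff x).hasDerivAt).div_const 2
  have hb'b : ∀ x, |b' x| ≤ 3 * S := fun x => by
    rw [hb', abs_div, abs_two, div_le_iff₀ two_pos]
    have := abs_add_le (deriv (u t) x) (deriv (v t) x)
    linarith [hut.abs_deriv_le x, hvt.abs_deriv_le x]
  have hbM : ∀ x, |b x| ≤ M := fun x => by
    rw [hb, abs_div, abs_two, div_le_iff₀ two_pos]
    have := abs_add_le (u t x) (v t x)
    linarith [hMu x, hMv x]
  have hM0 : 0 ≤ M := (abs_nonneg _).trans (hbM 0)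
  have hηS : ∀ x, |smoothAbs δ (w x)| ≤ S := fun x => by
    rw [abs_of_nonneg (smoothAbs_nonneg δ _)]
    exact (smoothAbs_le hδ _).trans (hwt.bdd x)
  have hη'1 : ∀ x, |η' (w x)| ≤ 1 := fun x => abs_deriv_smoothAbs_le hδ _
  -- The convective flux of the regularised entropy, `(b η(w))_x`.
  have hflux := integral_deriv_mul_weight (F := fun x => b x * smoothAbs δ (w x))
    (F' := fun x => b' x * smoothAbs δ (w x) + b x * (η' (w x) * deriv w x))
    (M := M * S + 3 * S * S + M * (1 * (3 * S)))
    (fun x => (hbd x).mul ((hasDerivAt_smoothAbs hδ (w x)).comp x (hwt.diff x).hasDerivAt))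
    (fun x => by
      have h1 : |b x * smoothAbs δ (w x)| ≤ M * S := by
        rw [abs_mul]
        exact mul_le_mul (hbM x) (hηS x) (abs_nonneg _) hM0
      have : 0 ≤ 3 * S * S + M * (1 * (3 * S)) := by positivity
      linarith)
    (fun x => by
      have h1 : |b' x * smoothAbs δ (w x)| ≤ 3 * S * S := by
        rw [abs_mul]
        exact mul_le_mul (hb'b x) (hηS x) (abs_nonneg _) (by positivity)
      have h2 : |b x * (η' (w x) * deriv w x)| ≤ M * (1 * (3 * S)) := by
        rw [abs_mul, abs_mul]
        exact mul_le_mul (hbM x) (mul_le_mul (hη'1 x) (hwt.abs_deriv_le x) (abs_nonneg _)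
          zero_le_one) (by positivity) hM0
      have h3 := abs_add_le (b' x * smoothAbs δ (w x)) (b x * (η' (w x) * deriv w x))
      have : 0 ≤ M * S := by positivity
      linarith) hχ.diff hχ.int hχ.int_deriv
  have hdual := hχ.dual N _ hN
  have hdi := hχ.int_mul N _ hN
  have hpt : ∀ x, η' (w x) * deriv (fun s => u s x - v s x) t * χ x ≤
      -(fracLaplacian α (fun x => smoothAbs δ (w x)) x * χ x) -
      (b' x * smoothAbs δ (w x) + b x * (η' (w x) * deriv w x)) * χ x +
      δ * (3 * S) * χ x := by
    intro x
    have e1 : deriv (fun s => u s x - v s x) t =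
        -fracLaplacian α w x - b x * deriv w x - b' x * w x := by
      rw [deriv_fun_sub (hu.diff_time t ht x) (hv.diff_time t ht x), hwdef,
        fracLaplacian_sub hα₁ hα₂ hut hvt, ← hwdef, hwd]
      simp only [hb, hb', hwdef]
      linear_combination hequ x - heqv x
    -- Convexity makes the chain-rule defect of the fractional Laplacian nonnegative.
    have e2 : fracLaplacian α (fun x => smoothAbs δ (w x)) x ≤ η' (w x) * fracLaplacian α w x := by
      have := (mul_fracLaplacian_sub_fracLaplacian_comp hα₁ hα₂ hwt (hasDerivAt_smoothAbs hδ)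
        hN x).2
      have h0 : 0 ≤ ∫ z, (smoothAbs δ (w (x + z)) - smoothAbs δ (w x) -
          w x / √(w x ^ 2 + δ ^ 2) * (w (x + z) - w x)) / |z| ^ (1 + α) :=
        integral_nonneg fun z => div_nonneg (smoothAbs_taylor hδ _ _).1 (by positivity)
      have := mul_nonneg hC.le h0
      simp only [hη']
      linarith
    have e3 : |b' x * (w x * η' (w x) - smoothAbs δ (w x))| ≤ 3 * S * δ := by
      rw [abs_mul]
      exact mul_le_mul (hb'b x) (mul_deriv_smoothAbs_sub hδ _) (abs_nonneg _) (by positivity)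
    rw [e1]
    have e4 : η' (w x) * (-fracLaplacian α w x - b x * deriv w x - b' x * w x) ≤
        -fracLaplacian α (fun x => smoothAbs δ (w x)) x -
        (b' x * smoothAbs δ (w x) + b x * (η' (w x) * deriv w x)) + δ * (3 * S) := by
      have := (abs_le.1 e3).1
      linarith
    exact (mul_le_mul_of_nonneg_right e4 (hχ0 x)).trans (le_of_eq (by ring))
  have hdi' : Integrable fun x => -(fracLaplacian α (fun x => smoothAbs δ (w x)) x * χ x) :=
    hdi.neg
  have hdi'' : Integrable fun x => -(fracLaplacian α (fun x => smoothAbs δ (w x)) x * χ x) -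
      (b' x * smoothAbs δ (w x) + b x * (η' (w x) * deriv w x)) * χ x := hdi'.sub hflux.1
  have hc := hχ.int.const_mul (δ * (3 * S))
  refine (integral_mono hi (hdi''.add hc) hpt).trans ?_
  have e : ∫ x, ((fun x => -(fracLaplacian α (fun x => smoothAbs δ (w x)) x * χ x) -
      (b' x * smoothAbs δ (w x) + b x * (η' (w x) * deriv w x)) * χ x) +
      fun x => δ * (3 * S) * χ x) x = -(∫ x, smoothAbs δ (w x) * lam x) +
      (∫ x, b x * smoothAbs δ (w x) * deriv χ x) + δ * (3 * S) * ∫ x, χ x := by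
    rw [integral_add' hdi'' hc, integral_sub hdi' hflux.1, integral_neg, hdual, hflux.2.2,
      integral_const_mul, sub_neg_eq_add]
  rw [e]
  have hηW : Integrable fun x => smoothAbs δ (w x) * W x := hN.integrable_mul hW
  have hW0 : ∀ {ρ : ℝ → ℝ} {k : ℝ}, (∀ x, |ρ x| ≤ k * W x) → ∀ x,
      ‖smoothAbs δ (w x) * ρ x‖ ≤ k * (smoothAbs δ (w x) * W x) := fun hk x => by
    rw [norm_mul, Real.norm_of_nonneg (smoothAbs_nonneg δ _), mul_left_comm]
    exact mul_le_mul_of_nonneg_left (hk x) (smoothAbs_nonneg δ _)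
  have f1 : -(∫ x, smoothAbs δ (w x) * lam x) ≤ K * ∫ x, smoothAbs δ (w x) * W x := by
    rw [← integral_const_mul]
    refine (neg_le_abs _).trans ?_
    rw [← Real.norm_eq_abs]
    exact norm_integral_le_of_norm_le (hηW.const_mul K) (Eventually.of_forall (hW0 hK))
  have f2 : (∫ x, b x * smoothAbs δ (w x) * deriv χ x) ≤
      M * K' * ∫ x, smoothAbs δ (w x) * W x := by
    rw [← integral_const_mul]
    refine (le_abs_self _).trans ?_
    rw [← Real.norm_eq_abs]
    refine norm_integral_le_of_norm_le (hηW.const_mul (M * K')) (Eventually.of_forall fun x => ?_)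
    rw [mul_assoc, norm_mul, mul_assoc]
    exact mul_le_mul (hbM x) (hW0 hK' x) (norm_nonneg _) hM0
  linarith

/-- A version of Fatou's lemma for Bochner integrals, including integrability of the limit. -/
lemma integrable_and_integral_le_of_tendsto {F : ℕ → ℝ → ℝ} {f : ℝ → ℝ} {c : ℕ → ℝ} {C : ℝ}
    (hF : ∀ n, Integrable (F n)) (hF0 : ∀ n x, 0 ≤ F n x)
    (hlim : ∀ x, Tendsto (fun n => F n x) atTop (𝓝 (f x))) (hc : ∀ n, ∫ x, F n x ≤ c n)
    (hC : Tendsto c atTop (𝓝 C)) : Integrable f ∧ ∫ x, f x ≤ C := by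
  have hf0 : ∀ x, 0 ≤ f x := fun x => ge_of_tendsto' (hlim x) fun n => hF0 n x
  have hC0 : 0 ≤ C := ge_of_tendsto' hC fun n => (integral_nonneg (hF0 n)).trans (hc n)
  have hfm : AEStronglyMeasurable f volume :=
    aestronglyMeasurable_of_tendsto_ae atTop (fun n => (hF n).1) (Eventually.of_forall hlim)
  have key : ∫⁻ x, ENNReal.ofReal (f x) ≤ ENNReal.ofReal C := by
    calc ∫⁻ x, ENNReal.ofReal (f x)
        = ∫⁻ x, liminf (fun n => ENNReal.ofReal (F n x)) atTop := by
          refine lintegral_congr fun x => ?_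
          exact ((ENNReal.continuous_ofReal.tendsto _).comp (hlim x)).liminf_eq.symm
      _ ≤ liminf (fun n => ∫⁻ x, ENNReal.ofReal (F n x)) atTop :=
          lintegral_liminf_le' fun n => (hF n).1.aemeasurable.ennreal_ofReal
      _ ≤ liminf (fun n => ENNReal.ofReal (c n)) atTop := by
          refine liminf_le_liminf (Eventually.of_forall fun n => ?_)
          rw [← ofReal_integral_eq_lintegral_ofReal (hF n) (Eventually.of_forall (hF0 n))]
          exact ENNReal.ofReal_le_ofReal (hc n)
      _ = ENNReal.ofReal C := ((ENNReal.continuous_ofReal.tendsto _).comp hC).liminf_eq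
  have hfi : Integrable f := by
    refine ⟨hfm, ?_⟩
    rw [hasFiniteIntegral_iff_ofReal (Eventually.of_forall hf0)]
    exact key.trans_lt ENNReal.ofReal_lt_top
  refine ⟨hfi, ?_⟩
  rw [← ofReal_integral_eq_lintegral_ofReal hfi (Eventually.of_forall hf0)] at key
  exact (ENNReal.ofReal_le_ofReal_iff hC0).1 key

lemma le_of_forall_pos_sub_mul_le {X Y p q : ℝ}
    (h : ∀ δ > 0, X - δ * p ≤ Y + δ * q) : X ≤ Y := by
  have h1 : Tendsto (fun δ : ℝ => X - δ * p) (𝓝[>] 0) (𝓝 X) := by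
    have : Tendsto (fun δ : ℝ => X - δ * p) (𝓝 0) (𝓝 (X - 0 * p)) :=
      Continuous.tendsto (by fun_prop) _
    rw [zero_mul, sub_zero] at this
    exact this.mono_left nhdsWithin_le_nhds
  have h2 : Tendsto (fun δ : ℝ => Y + δ * q) (𝓝[>] 0) (𝓝 Y) := by
    have : Tendsto (fun δ : ℝ => Y + δ * q) (𝓝 0) (𝓝 (Y + 0 * q)) :=
      Continuous.tendsto (by fun_prop) _
    rw [zero_mul, add_zero] at this
    exact this.mono_left nhdsWithin_le_nhds
  exact le_of_tendsto_of_tendsto h1 h2 (eventually_mem_nhdsWithin.mono h)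

/-- The regularised absolute value differs from the absolute value by at most `δ`, weighted form. -/
lemma smoothAbs_integral_bounds {δ B : ℝ} (hδ : 0 < δ) {f χ : ℝ → ℝ} (hf : IsC11 B f)
    (hχ : Integrable χ) (hχ0 : ∀ x, 0 ≤ χ x) :
    (∫ x, |f x| * χ x) - δ * (∫ x, χ x) ≤ ∫ x, smoothAbs δ (f x) * χ x ∧
      ∫ x, smoothAbs δ (f x) * χ x ≤ ∫ x, |f x| * χ x := by
  obtain ⟨N, hN⟩ := hf.smoothAbs hδ
  have h1 : Integrable fun x => |f x| * χ x := hχ.bdd_mul (c := B)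
    hf.continuous.abs.aestronglyMeasurable
    (Eventually.of_forall fun x => by rw [Real.norm_eq_abs, abs_abs]; exact hf.bdd x)
  have h2 : Integrable fun x => smoothAbs δ (f x) * χ x := hN.integrable_mul hχ
  refine ⟨?_, integral_mono h2 h1 fun x =>
    mul_le_mul_of_nonneg_right (smoothAbs_le hδ _) (hχ0 x)⟩
  rw [← integral_const_mul, ← integral_sub h1 (hχ.const_mul δ)]
  refine integral_mono (h1.sub (hχ.const_mul δ)) h2 fun x => ?_
  simp only
  rw [← sub_mul]
  exact mul_le_mul_of_nonneg_right (sub_le_smoothAbs δ _) (hχ0 x)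

/-- The exponential growth rate of `L¹` norms with a Cauchy weight of scale `R`; it vanishes as
`R → ∞`. -/
noncomputable def growthRate (α M R : ℝ) : ℝ := profileDualConst α * R ^ (-α) + M * R⁻¹

lemma growthRate_nonneg {α : ℝ} (hα₁ : 1 < α) (hα₂ : α < 2) {M R : ℝ} (hM : 0 ≤ M)
    (hR : 0 < R) : 0 ≤ growthRate α M R :=
  add_nonneg (mul_nonneg (profileDualConst_nonneg hα₁ hα₂) (Real.rpow_nonneg hR.le _))
    (mul_nonneg hM (inv_nonneg.2 hR.le))

lemma tendsto_growthRate {α : ℝ} (hα₁ : 1 < α) (M : ℝ) :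
    Tendsto (growthRate α M) atTop (𝓝 0) := by
  have := ((tendsto_rpow_neg_atTop (by linarith : 0 < α)).const_mul (profileDualConst α)).add
    (tendsto_inv_atTop_zero.const_mul M)
  simp only [mul_zero, add_zero] at this
  exact this

/-- Grönwall's form of the weighted Kato inequality, between two positive times. -/
lemma weighted_integral_abs_sub_le {α : ℝ} (hα₁ : 1 < α) (hα₂ : α < 2) {g g' : ℝ → ℝ}
    {u v : ℝ → ℝ → ℝ} (hu : IsFractalBurgersSolution α g u)
    (hv : IsFractalBurgersSolution α g' v) {T M : ℝ} (hM0 : 0 ≤ M)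
    (hMu : ∀ t ∈ Ioo 0 T, ∀ x, |u t x| ≤ M) (hMv : ∀ t ∈ Ioo 0 T, ∀ x, |v t x| ≤ M) {R : ℝ}
    (hR : 0 < R) {s t : ℝ} (hs : 0 < s) (hst : s ≤ t) (ht : t < T) :
    Real.exp (-(growthRate α M R * t)) * ∫ x, |u t x - v t x| * cauchyWeight 0 R x ≤
      Real.exp (-(growthRate α M R * s)) * ∫ x, |u s x - v s x| * cauchyWeight 0 R x := by
  have hsT : s / 2 < T := (half_lt_self hs).trans_le (hst.trans ht.le)
  obtain ⟨B, hB⟩ := hu.exists_stripBounds (half_pos hs) hsT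
  obtain ⟨B', hB'⟩ := hv.exists_stripBounds (half_pos hs) hsT
  have hmem : ∀ r ∈ Icc s t, r ∈ Ioo (s / 2) T := fun r hr =>
    ⟨(half_lt_self hs).trans_le hr.1, hr.2.trans_lt ht⟩
  have hmem' : ∀ r ∈ Icc s t, r ∈ Ioo 0 T := fun r hr => ⟨hs.trans_le hr.1, hr.2.trans_lt ht⟩
  have hχ := isDualPair_cauchyWeight hα₁ hα₂ 0 hR
  have hχ0 : ∀ x, 0 ≤ cauchyWeight 0 R x := fun x => (cauchyWeight_pos 0 R x).le
  set k := growthRate α M R with hk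
  have hk0 : 0 ≤ k := growthRate_nonneg hα₁ hα₂ hM0 hR
  set I := ∫ x, cauchyWeight 0 R x with hI
  have hI0 : 0 ≤ I := integral_nonneg hχ0
  set D := 3 * (B + B') * I with hD
  have hs' := left_mem_Icc.2 hst
  have ht' := right_mem_Icc.2 hst
  have hD0 : 0 ≤ D := by
    have := (hB.c11 s (hmem s hs')).nonneg
    have := (hB'.c11 s (hmem s hs')).nonneg
    positivity
  refine le_of_forall_pos_sub_mul_le (p := Real.exp (-(k * t)) * I) (q := D * (t - s))
    fun δ hδ => ?_
  have hder := fun r (hr : r ∈ Icc s t) => exists_hasDerivAt_integral_smoothAbs_le hα₁ hα₂ hB hB'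
    (hmem r hr) (hu.equation r (hmem' r hr).1) (hv.equation r (hmem' r hr).1)
    (hMu r (hmem' r hr)) (hMv r (hmem' r hr)) hχ hχ0 hχ.int (abs_cauchyDual_le hα₁ hα₂ 0 hR)
    (abs_deriv_cauchyWeight_le 0 hR) hδ
  choose! Φ' hΦ' hΦle using hder
  -- The factor `exp (-k r)` absorbs the linear growth, and `δ D r` the error of the regularisation.
  set Φ : ℝ → ℝ := fun s => ∫ x, smoothAbs δ (u s x - v s x) * cauchyWeight 0 R x with hΦ
  have hd : ∀ r ∈ Icc s t, HasDerivAt (fun r => Real.exp (-(k * r)) * Φ r - δ * D * r)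
      (Real.exp (-(k * r)) * (Φ' r - k * Φ r) - δ * D) r := fun r hr => by
    have h1 : HasDerivAt (fun r => Real.exp (-(k * r))) (Real.exp (-(k * r)) * -(k * 1)) r :=
      (((hasDerivAt_id r).const_mul k).neg).exp
    exact ((h1.mul (hΦ' r hr)).sub ((hasDerivAt_id r).const_mul (δ * D))).congr_deriv (by ring)
  have hanti : AntitoneOn (fun r => Real.exp (-(k * r)) * Φ r - δ * D * r) (Icc s t) := by
    refine antitoneOn_of_deriv_nonpos (convex_Icc s t)
      (fun r hr => (hd r hr).continuousAt.continuousWithinAt)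
      (fun r hr => (hd r (interior_subset hr)).differentiableAt.differentiableWithinAt)
      fun r hr => ?_
    have hr' := interior_subset hr
    rw [(hd r hr').deriv]
    have h1 : Φ' r - k * Φ r ≤ δ * D := by
      have := hΦle r hr'
      rw [hD]
      rw [← mul_assoc, sub_le_iff_le_add']
      exact this
    have h2 : Real.exp (-(k * r)) ≤ 1 :=
      Real.exp_le_one_iff.2 (neg_nonpos.2 (mul_nonneg hk0 (hs.le.trans hr'.1)))
    have h3 : 0 < Real.exp (-(k * r)) := Real.exp_pos _
    nlinarith [mul_le_mul_of_nonneg_left h1 h3.le, mul_nonneg hδ.le hD0]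
  have h1 := hanti hs' ht' hst
  simp only at h1
  have b1 := (smoothAbs_integral_bounds hδ ((hB.sub hB').c11 t (hmem t ht')) hχ.int hχ0).1
  have b2 := (smoothAbs_integral_bounds hδ ((hB.sub hB').c11 s (hmem s hs')) hχ.int hχ0).2
  have c1 := mul_le_mul_of_nonneg_left b1 (Real.exp_pos (-(k * t))).le
  have c2 := mul_le_mul_of_nonneg_left b2 (Real.exp_pos (-(k * s))).le
  simp only [hΦ] at h1
  rw [mul_sub] at c1
  linarith

/-- The `L¹` contraction property. No sign of the derivatives is needed: in the Kato inequality the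
convective flux is a total derivative, so that only the derivative of the weight sees it. -/
theorem integrable_sub_and_integral_abs_sub_le {α : ℝ} (hα₁ : 1 < α) (hα₂ : α < 2)
    {g g' : ℝ → ℝ} {u v : ℝ → ℝ → ℝ} (hu : IsFractalBurgersSolution α g u)
    (hg : IsRegularDatum g) (hv : IsFractalBurgersSolution α g' v) (hg' : IsRegularDatum g')
    (hint : Integrable fun x => g x - g' x) {t : ℝ} (ht : 0 < t) :
    Integrable (fun x => |u t x - v t x|) ∧ ∫ x, |u t x - v t x| ≤ ∫ x, |g x - g' x| := by
  have hT : 0 < t + 1 := by linarith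
  obtain ⟨M₁, h1, hM₁⟩ := hu.exists_bound hT
  obtain ⟨M₂, h2, hM₂⟩ := hv.exists_bound hT
  set M := max M₁ M₂
  have hM0 : 0 ≤ M := h1.trans (le_max_left _ _)
  have hMu : ∀ t' ∈ Ioo 0 (t + 1), ∀ x, |u t' x| ≤ M := fun t' h x =>
    (hM₁ t' h x).trans (le_max_left _ _)
  have hMv : ∀ t' ∈ Ioo 0 (t + 1), ∀ x, |v t' x| ≤ M := fun t' h x =>
    (hM₂ t' h x).trans (le_max_right _ _)
  set J := ∫ x, |g x - g' x| with hJ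
  have hJ0 : 0 ≤ J := integral_nonneg fun x => abs_nonneg _
  have hcont : ∀ r ∈ Ioo 0 (t + 1), Continuous (u r) ∧ Continuous (v r) := fun r hr => by
    obtain ⟨B, hB⟩ := hu.exists_stripBounds (half_pos hr.1) ((half_lt_self hr.1).trans hr.2)
    obtain ⟨B', hB'⟩ := hv.exists_stripBounds (half_pos hr.1) ((half_lt_self hr.1).trans hr.2)
    have hr' : r ∈ Ioo (r / 2) (t + 1) := ⟨half_lt_self hr.1, hr.2⟩
    exact ⟨(hB.c11 r hr').continuous, (hB'.c11 r hr').continuous⟩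
  have hbdi : ∀ {p q : ℝ → ℝ} {P Q R : ℝ}, 0 < R → Measurable p → Measurable q →
      (∀ x, |p x| ≤ P) → (∀ x, |q x| ≤ Q) →
      Integrable fun x => |p x - q x| * cauchyWeight 0 R x := fun hR hp hq hP hQ =>
    (integrable_cauchyWeight 0 hR).bdd_mul (c := _ + _) (hp.sub hq).abs.aestronglyMeasurable
      (Eventually.of_forall fun x => by
        rw [Real.norm_eq_abs, abs_abs]
        exact (abs_sub _ _).trans (add_le_add (hP x) (hQ x)))
  have ht' : t ∈ Ioo 0 (t + 1) := ⟨ht, by linarith⟩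
  have key : ∀ R : ℝ, 0 < R → ∫ x, |u t x - v t x| * cauchyWeight 0 R x ≤
      Real.exp (growthRate α M R * t) * J := by
    intro R hR
    set k := growthRate α M R with hk
    have hk0 : 0 ≤ k := growthRate_nonneg hα₁ hα₂ hM0 hR
    have hstep : ∀ κ > 0, Real.exp (-(k * t)) * (∫ x, |u t x - v t x| * cauchyWeight 0 R x) -
        κ * 0 ≤ J + κ * 2 := by
      intro κ hκ
      obtain ⟨s, hs, hsu, hsv⟩ := exists_time_near_initial hα₁ hα₂ hu hg hv hg' hR hκ ht
      have hsT : s ∈ Ioo 0 (t + 1) := ⟨hs.1, by linarith [hs.2]⟩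
      have hmain := weighted_integral_abs_sub_le hα₁ hα₂ hu hv hM0 hMu hMv hR hs.1 hs.2.le ht'.2
      obtain ⟨G, hG⟩ := hg.bdd
      obtain ⟨G', hG'⟩ := hg'.bdd
      have i1 := hbdi hR (hcont s hsT).1.measurable hg.meas (hMu s hsT) hG
      have i2 := hbdi hR (hcont s hsT).2.measurable hg'.meas (hMv s hsT) hG'
      have i3 := hint.abs
      have h3 : ∫ x, |u s x - v s x| * cauchyWeight 0 R x ≤ κ + κ + J := by
        refine le_trans (integral_mono (hbdi hR (hcont s hsT).1.measurable
          (hcont s hsT).2.measurable (hMu s hsT) (hMv s hsT)) ((i1.add i2).add i3)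
          fun x => ?_) ?_
        · have hw0 := (cauchyWeight_pos 0 R x).le
          have hw1 := cauchyWeight_le_one 0 R x
          have e : u s x - v s x = (u s x - g x) + -(v s x - g' x) + (g x - g' x) := by ring
          have h4 : |u s x - v s x| ≤ |u s x - g x| + |v s x - g' x| + |g x - g' x| := by
            rw [e]
            refine (abs_add_three _ _ _).trans ?_
            rw [abs_neg]
          have h5 := mul_le_mul_of_nonneg_right h4 hw0
          have h6 := mul_le_of_le_one_right (abs_nonneg (g x - g' x)) hw1
          simp only [Pi.add_apply]
          linarith
        · rw [integral_add' (i1.add i2) i3, integral_add' i1 i2]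
          linarith
      have h7 : Real.exp (-(k * s)) ≤ 1 :=
        Real.exp_le_one_iff.2 (neg_nonpos.2 (mul_nonneg hk0 hs.1.le))
      have h8 : 0 ≤ ∫ x, |u s x - v s x| * cauchyWeight 0 R x :=
        integral_nonneg fun x => mul_nonneg (abs_nonneg _) (cauchyWeight_pos 0 R x).le
      nlinarith
    have := le_of_forall_pos_sub_mul_le hstep
    rw [Real.exp_neg, inv_mul_le_iff₀ (Real.exp_pos _)] at this
    exact this
  have hn : Tendsto (fun n : ℕ => (n : ℝ) + 1) atTop atTop :=
    tendsto_atTop_add_const_right _ _ tendsto_natCast_atTop_atTop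
  refine integrable_and_integral_le_of_tendsto
    (F := fun n x => |u t x - v t x| * cauchyWeight 0 ((n : ℝ) + 1) x)
    (c := fun n => Real.exp (growthRate α M ((n : ℝ) + 1) * t) * J)
    (fun n => hbdi (by positivity) (hcont t ht').1.measurable (hcont t ht').2.measurable
      (hMu t ht') (hMv t ht'))
    (fun n x => mul_nonneg (abs_nonneg _) (cauchyWeight_pos 0 _ x).le) (fun x => ?_)
    (fun n => key _ (by positivity)) ?_
  · have := ((tendsto_cauchyWeight_atTop x).comp hn).const_mul |u t x - v t x|
    rwa [mul_one] at this
  · have h3 := ((tendsto_growthRate hα₁ M).comp hn).mul_const t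
    rw [zero_mul] at h3
    have h4 := ((Real.continuous_exp.tendsto 0).comp h3).mul_const J
    rw [Real.exp_zero, one_mul] at h4
    exact h4

/-- Propagation of tightness: the mass of the difference of two solutions on the region between the
scales `R` and `L` grows at most linearly in time, at a rate that vanishes as `R → ∞`. -/
lemma integral_abs_sub_mul_sub_le {α : ℝ} (hα₁ : 1 < α) (hα₂ : α < 2) {g g' : ℝ → ℝ}
    {u v : ℝ → ℝ → ℝ} (hu : IsFractalBurgersSolution α g u)
    (hv : IsFractalBurgersSolution α g' v) {T M : ℝ}
    (hMu : ∀ t ∈ Ioo 0 T, ∀ x, |u t x| ≤ M) (hMv : ∀ t ∈ Ioo 0 T, ∀ x, |v t x| ≤ M) {R L : ℝ}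
    (hR : 0 < R) (hRL : R ≤ L) {s t m : ℝ} (hs : 0 < s) (hst : s ≤ t) (ht : t < T)
    (hm : ∀ r, 0 < r → Integrable (fun x => |u r x - v r x|) ∧ ∫ x, |u r x - v r x| ≤ m) :
    ∫ x, |u t x - v t x| * (cauchyWeight 0 L x - cauchyWeight 0 R x) ≤
      (∫ x, |u s x - v s x| * (cauchyWeight 0 L x - cauchyWeight 0 R x)) +
        2 * growthRate α M R * m * (t - s) := by
  have hL : 0 < L := hR.trans_le hRL
  have hsT : s / 2 < T := (half_lt_self hs).trans_le (hst.trans ht.le)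
  obtain ⟨B, hB⟩ := hu.exists_stripBounds (half_pos hs) hsT
  obtain ⟨B', hB'⟩ := hv.exists_stripBounds (half_pos hs) hsT
  have hmem : ∀ r ∈ Icc s t, r ∈ Ioo (s / 2) T := fun r hr =>
    ⟨(half_lt_self hs).trans_le hr.1, hr.2.trans_lt ht⟩
  have hmem' : ∀ r ∈ Icc s t, r ∈ Ioo 0 T := fun r hr => ⟨hs.trans_le hr.1, hr.2.trans_lt ht⟩
  have hs' := left_mem_Icc.2 hst
  have ht' := right_mem_Icc.2 hst
  have hM0 : 0 ≤ M := (abs_nonneg _).trans (hMu s (hmem' s hs') 0)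
  have hA := profileDualConst_nonneg hα₁ hα₂
  have hχL := isDualPair_cauchyWeight hα₁ hα₂ 0 hL
  have hχR := isDualPair_cauchyWeight hα₁ hα₂ 0 hR
  have hχ := hχL.sub hχR
  have hmono : ∀ x, cauchyWeight 0 R x ≤ cauchyWeight 0 L x := cauchyWeight_mono hR hRL
  set χ : ℝ → ℝ := fun x => cauchyWeight 0 L x - cauchyWeight 0 R x with hχdef
  have hχ0 : ∀ x, 0 ≤ χ x := fun x => sub_nonneg.2 (hmono x)
  have hLR : L ^ (-α) ≤ R ^ (-α) := Real.rpow_le_rpow_of_nonpos hR hRL (by linarith)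
  have hRα : 0 < R ^ (-α) := Real.rpow_pos_of_pos hR _
  have hK : ∀ x, |cauchyDual α 0 L x - cauchyDual α 0 R x| ≤
      2 * (profileDualConst α * R ^ (-α)) * cauchyWeight 0 L x := fun x => by
    have h1 := abs_cauchyDual_le hα₁ hα₂ 0 hL x
    have h2 := abs_cauchyDual_le hα₁ hα₂ 0 hR x
    have h3 : profileDualConst α * L ^ (-α) * cauchyWeight 0 L x ≤
        profileDualConst α * R ^ (-α) * cauchyWeight 0 L x :=
      mul_le_mul_of_nonneg_right (mul_le_mul_of_nonneg_left hLR hA) (cauchyWeight_pos 0 L x).le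
    have h4 : profileDualConst α * R ^ (-α) * cauchyWeight 0 R x ≤
        profileDualConst α * R ^ (-α) * cauchyWeight 0 L x :=
      mul_le_mul_of_nonneg_left (hmono x) (mul_nonneg hA hRα.le)
    have := abs_sub (cauchyDual α 0 L x) (cauchyDual α 0 R x)
    linarith
  have hK' : ∀ x, |deriv χ x| ≤ 2 * R⁻¹ * cauchyWeight 0 L x := fun x => by
    have h1 := abs_deriv_cauchyWeight_le 0 hL x
    have h2 := abs_deriv_cauchyWeight_le 0 hR x
    have h3 : L⁻¹ * cauchyWeight 0 L x ≤ R⁻¹ * cauchyWeight 0 L x :=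
      mul_le_mul_of_nonneg_right (inv_anti₀ hR hRL) (cauchyWeight_pos 0 L x).le
    have h4 : R⁻¹ * cauchyWeight 0 R x ≤ R⁻¹ * cauchyWeight 0 L x :=
      mul_le_mul_of_nonneg_left (hmono x) (inv_nonneg.2 hR.le)
    have h5 : deriv χ x = deriv (cauchyWeight 0 L) x - deriv (cauchyWeight 0 R) x :=
      deriv_fun_sub (hχL.diff x) (hχR.diff x)
    have := abs_sub (deriv (cauchyWeight 0 L) x) (deriv (cauchyWeight 0 R) x)
    rw [h5]
    linarith
  set I := ∫ x, χ x with hI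
  set D := 3 * (B + B') * I with hD
  set c := 2 * growthRate α M R * m with hc
  refine le_of_forall_pos_sub_mul_le (p := I) (q := D * (t - s)) fun δ hδ => ?_
  have hder := fun r (hr : r ∈ Icc s t) => exists_hasDerivAt_integral_smoothAbs_le hα₁ hα₂ hB hB'
    (hmem r hr) (hu.equation r (hmem' r hr).1) (hv.equation r (hmem' r hr).1)
    (hMu r (hmem' r hr)) (hMv r (hmem' r hr)) hχ hχ0 hχL.int hK hK' hδ
  choose! Φ' hΦ' hΦle using hder
  set Φ : ℝ → ℝ := fun s => ∫ x, smoothAbs δ (u s x - v s x) * χ x with hΦ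
  have hd : ∀ r ∈ Icc s t, HasDerivAt (fun r => Φ r - (c + δ * D) * r)
      (Φ' r - (c + δ * D)) r := fun r hr =>
    ((hΦ' r hr).sub ((hasDerivAt_id r).const_mul (c + δ * D))).congr_deriv (by simp)
  have hanti : AntitoneOn (fun r => Φ r - (c + δ * D) * r) (Icc s t) := by
    refine antitoneOn_of_deriv_nonpos (convex_Icc s t)
      (fun r hr => (hd r hr).continuousAt.continuousWithinAt)
      (fun r hr => (hd r (interior_subset hr)).differentiableAt.differentiableWithinAt)
      fun r hr => ?_
    have hr' := interior_subset hr
    rw [(hd r hr').deriv]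
    have h1 := hΦle r hr'
    have hc11 := (hB.sub hB').c11 r (hmem r hr')
    have h2 : ∫ x, smoothAbs δ (u r x - v r x) * cauchyWeight 0 L x ≤ m := by
      obtain ⟨hm1, hm2⟩ := hm r (hs.trans_le hr'.1)
      obtain ⟨N, hN⟩ := hc11.smoothAbs hδ
      refine (integral_mono (hN.integrable_mul hχL.int) hm1 fun x => ?_).trans hm2
      refine (mul_le_of_le_one_right (smoothAbs_nonneg δ _) (cauchyWeight_le_one 0 L x)).trans ?_
      exact smoothAbs_le hδ _
    have h3 : 0 ≤ 2 * (profileDualConst α * R ^ (-α)) + M * (2 * R⁻¹) := by positivity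
    have h4 := mul_le_mul_of_nonneg_left h2 h3
    have h5 : (2 * (profileDualConst α * R ^ (-α)) + M * (2 * R⁻¹)) * m = c := by
      rw [hc, growthRate]; ring
    have h6 : δ * (3 * (B + B')) * I = δ * D := by rw [hD]; ring
    linarith
  have h1 := hanti hs' ht' hst
  simp only at h1
  have b1 := (smoothAbs_integral_bounds hδ ((hB.sub hB').c11 t (hmem t ht')) hχ.int hχ0).1
  have b2 := (smoothAbs_integral_bounds hδ ((hB.sub hB').c11 s (hmem s hs')) hχ.int hχ0).2
  simp only [hΦ] at h1
  linarith

/-! ### Step convolutions and translates of solutions -/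

lemma IsRegularDatum.comp_add_right {g : ℝ → ℝ} (hg : IsRegularDatum g) (a : ℝ) :
    IsRegularDatum fun x => g (x + a) where
  meas := hg.meas.comp (measurable_id.add_const a)
  bdd := hg.bdd.imp fun _ hB x => hB (x + a)
  cont := by
    have h := (measurePreserving_add_right (volume : Measure ℝ) a).quasiMeasurePreserving.ae hg.cont
    filter_upwards [h] with x hx
    exact ContinuousAt.comp (f := fun x => x + a) hx (by fun_prop)

lemma integrable_and_integral_measure_Iic_sub (μ : Measure ℝ) [IsFiniteMeasure μ] {h : ℝ}
    (hh : 0 ≤ h) :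
    Integrable (fun x => μ.real (Iic (x + h)) - μ.real (Iic x)) ∧
      ∫ x, (μ.real (Iic (x + h)) - μ.real (Iic x)) = h * μ.real univ := by
  have hmono : Monotone fun x => μ.real (Iic x) := fun x y hxy =>
    measureReal_mono (Iic_subset_Iic.2 hxy)
  have hm : Measurable fun x => μ.real (Iic (x + h)) - μ.real (Iic x) :=
    (hmono.measurable.comp (measurable_id.add_const h)).sub hmono.measurable
  have hnn : ∀ x, 0 ≤ μ.real (Iic (x + h)) - μ.real (Iic x) := fun x =>
    sub_nonneg.2 (hmono (by linarith))
  have e1 : ∀ x, ENNReal.ofReal (μ.real (Iic (x + h)) - μ.real (Iic x)) = μ (Ioc x (x + h)) := by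
    intro x
    have : μ.real (Iic (x + h)) - μ.real (Iic x) = μ.real (Ioc x (x + h)) := by
      rw [← Iic_sdiff_Iic, measureReal_sdiff (Iic_subset_Iic.2 (by linarith)) measurableSet_Iic]
    rw [this, ofReal_measureReal]
  have hset : MeasurableSet {q : ℝ × ℝ | q.1 < q.2 ∧ q.2 ≤ q.1 + h} :=
    (measurableSet_lt measurable_fst measurable_snd).inter
      (measurableSet_le measurable_snd (measurable_fst.add_const h))
  -- Tonelli: each point `y` lies in `(x, x + h]` for a set of `x` of length `h`.
  have e2 : ∫⁻ x, μ (Ioc x (x + h)) = ENNReal.ofReal h * μ univ := by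
    have h1 := Measure.prod_apply (μ := (volume : Measure ℝ)) (ν := μ) hset
    have h2 := Measure.prod_apply_symm (μ := (volume : Measure ℝ)) (ν := μ) hset
    have h3 : ∀ x : ℝ, Prod.mk x ⁻¹' {q : ℝ × ℝ | q.1 < q.2 ∧ q.2 ≤ q.1 + h} = Ioc x (x + h) :=
      fun x => rfl
    have h4 : ∀ y : ℝ, (fun x => (x, y)) ⁻¹' {q : ℝ × ℝ | q.1 < q.2 ∧ q.2 ≤ q.1 + h} =
        Ico (y - h) y := fun y => by
      ext x
      simp only [mem_preimage, mem_ofPred_eq, mem_Ico]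
      constructor <;> rintro ⟨h5, h6⟩ <;> constructor <;> linarith
    simp only [h3] at h1
    simp only [h4, Real.volume_Ico, sub_sub_cancel, lintegral_const] at h2
    rw [← h1, h2]
  have e3 : ∫⁻ x, ENNReal.ofReal (μ.real (Iic (x + h)) - μ.real (Iic x)) =
      ENNReal.ofReal (h * μ.real univ) := by
    simp_rw [e1]
    rw [e2, ENNReal.ofReal_mul hh, ofReal_measureReal]
  refine ⟨⟨hm.aestronglyMeasurable, ?_⟩, ?_⟩
  · rw [hasFiniteIntegral_iff_ofReal (Eventually.of_forall hnn), e3]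
    exact ENNReal.ofReal_lt_top
  · rw [integral_eq_lintegral_of_nonneg_ae (Eventually.of_forall hnn) hm.aestronglyMeasurable, e3,
      ENNReal.toReal_ofReal (by positivity)]

/-- A step convolution has a representative that is bounded, continuous almost everywhere, and
Lipschitz for the `L¹` norm under translations. -/
lemma IsStepConvolution.exists_representative {u₀ : ℝ → ℝ} (h : IsStepConvolution u₀) :
    ∃ (g : ℝ → ℝ) (V : ℝ), u₀ =ᵐ[volume] g ∧ IsRegularDatum g ∧
      ∀ a > 0, Integrable (fun x => g (x + a) - g x) ∧ ∫ x, |g (x + a) - g x| ≤ a * V := by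
  obtain ⟨c, m, hm⟩ := h
  set P := m.toJordanDecomposition.posPart
  set N := m.toJordanDecomposition.negPart
  have hmP : Monotone fun x => P.real (Iic x) := fun x y hxy =>
    measureReal_mono (Iic_subset_Iic.2 hxy)
  have hmN : Monotone fun x => N.real (Iic x) := fun x y hxy =>
    measureReal_mono (Iic_subset_Iic.2 hxy)
  have hval : ∀ x, m (Iic x) = P.real (Iic x) - N.real (Iic x) := fun x => by
    conv_lhs => rw [← SignedMeasure.toSignedMeasure_toJordanDecomposition m]
    rw [JordanDecomposition.toSignedMeasure, Measure.toSignedMeasure_sub_apply measurableSet_Iic]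
  refine ⟨fun x => c + (P.real (Iic x) - N.real (Iic x)), P.real univ + N.real univ, ?_,
    ⟨(hmP.measurable.sub hmN.measurable).const_add c,
      ⟨|c| + (P.real univ + N.real univ), fun x => ?_⟩, ?_⟩, fun a ha => ?_⟩
  · filter_upwards [hm] with x hx
    rw [hx, hval]
  · refine (abs_add_le _ _).trans (add_le_add le_rfl ((abs_sub _ _).trans ?_))
    rw [abs_of_nonneg measureReal_nonneg, abs_of_nonneg measureReal_nonneg]
    exact add_le_add (measureReal_mono (subset_univ _)) (measureReal_mono (subset_univ _))
  · filter_upwards [hmP.countable_not_continuousAt.ae_notMem volume,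
      hmN.countable_not_continuousAt.ae_notMem volume] with x h1 h2
    simp only [not_not] at h1 h2
    exact continuousAt_const.add (h1.sub h2)
  · obtain ⟨i1, e1⟩ := integrable_and_integral_measure_Iic_sub P ha.le
    obtain ⟨i2, e2⟩ := integrable_and_integral_measure_Iic_sub N ha.le
    have e : (fun x => c + (P.real (Iic (x + a)) - N.real (Iic (x + a))) -
        (c + (P.real (Iic x) - N.real (Iic x)))) = fun x =>
        (P.real (Iic (x + a)) - P.real (Iic x)) - (N.real (Iic (x + a)) - N.real (Iic x)) := by
      ext x; ring
    have hi := i1.sub i2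
    refine ⟨e ▸ hi, ?_⟩
    have e' := fun x => congrFun e x
    simp_rw [e']
    rw [mul_add, ← e1, ← e2, ← integral_add i1 i2]
    refine integral_mono hi.abs (i1.add i2) fun x => (abs_sub _ _).trans (le_of_eq ?_)
    rw [abs_of_nonneg (sub_nonneg.2 (hmP (by linarith))),
      abs_of_nonneg (sub_nonneg.2 (hmN (by linarith)))]

lemma fracLaplacian_comp_add_right (α : ℝ) (f : ℝ → ℝ) (a x : ℝ) :
    fracLaplacian α (fun x => f (x + a)) x = fracLaplacian α f (x + a) := by
  unfold fracLaplacian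
  rw [deriv_comp_add_const]
  simp_rw [add_right_comm x _ a]

lemma IsFractalBurgersSolution.comp_add_right {α : ℝ} {u₀ : ℝ → ℝ} {u : ℝ → ℝ → ℝ}
    (h : IsFractalBurgersSolution α u₀ u) (a : ℝ) :
    IsFractalBurgersSolution α (fun x => u₀ (x + a)) (fun t x => u t (x + a)) where
  bounded T hT := by
    obtain ⟨h1, C, hC⟩ := h.bounded T hT
    refine ⟨h1.comp (f := fun z : ℝ × ℝ => (z.1, z.2 + a)) (by fun_prop)
      fun z hz => ⟨hz.1, mem_univ _⟩, C, fun z hz => hC (z.1, z.2 + a) ⟨hz.1, mem_univ _⟩⟩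
  smooth T hT b hb := by
    obtain ⟨h1, h2⟩ := h.smooth T hT b hb
    refine ⟨h1.comp (f := fun z : ℝ × ℝ => (z.1, z.2 + a)) (by fun_prop)
      fun z hz => ⟨hz.1, mem_univ _⟩, fun n => (h2 n).imp fun C hC z hz => ?_⟩
    have e := iteratedFDeriv_comp_add_right (𝕜 := ℝ) (f := fun z : ℝ × ℝ => u z.1 z.2) n (0, a) z
    simp only [Prod.fst_add, Prod.snd_add, add_zero] at e
    rw [e]
    exact hC _ ⟨by simpa using hz.1, mem_univ _⟩
  equation t ht x := by
    rw [fracLaplacian_comp_add_right, deriv_comp_add_const]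
    exact h.equation t ht (x + a)
  initial φ hφ := by
    have e : ∀ f : ℝ → ℝ, ∫ x, f (x + a) * φ x = ∫ x, f x * φ (x - a) := fun f => by
      rw [← integral_add_right_eq_self (fun x => f x * φ (x - a)) a]
      simp
    simp_rw [e]
    exact h.initial _ (hφ.comp_sub_right a)

/-! ### The space derivative of a solution -/

/-- `g` has total variation at most `V`, in the integrated form `‖g(· + a) - g‖₁ ≤ a V` for all
`a > 0`, and satisfies the regularity needed for the initial datum to be attained strongly. -/
structure HasBVDatum (g : ℝ → ℝ) (V : ℝ) : Prop where
  regular : IsRegularDatum g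
  translate : ∀ a > 0, Integrable (fun x => g (x + a) - g x) ∧ ∫ x, |g (x + a) - g x| ≤ a * V

section BV

variable {α : ℝ} {g : ℝ → ℝ} {u : ℝ → ℝ → ℝ} {V : ℝ}

lemma IsFractalBurgersSolution.integral_abs_translate_sub_le (hα₁ : 1 < α) (hα₂ : α < 2)
    (h : IsFractalBurgersSolution α g u) (hg : HasBVDatum g V) {a : ℝ} (ha : 0 < a) {t : ℝ}
    (ht : 0 < t) :
    Integrable (fun x => |u t (x + a) - u t x|) ∧ ∫ x, |u t (x + a) - u t x| ≤ a * V := by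
  obtain ⟨h1, h2⟩ := hg.translate a ha
  obtain ⟨h3, h4⟩ := integrable_sub_and_integral_abs_sub_le hα₁ hα₂ (h.comp_add_right a)
    (hg.regular.comp_add_right a) h hg.regular h1 ht
  exact ⟨h3, h4.trans h2⟩

lemma tendsto_differenceQuotient {f : ℝ → ℝ} (hf : Differentiable ℝ f) (x : ℝ) :
    Tendsto (fun n : ℕ => ((n : ℝ) + 1) * |f (x + ((n : ℝ) + 1)⁻¹) - f x|) atTop
      (𝓝 |deriv f x|) := by
  have h1 := (hf x).hasDerivAt.tendsto_slope_zero_right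
  have h2 : Tendsto (fun n : ℕ => ((n : ℝ) + 1)⁻¹) atTop (𝓝[>] 0) :=
    tendsto_inv_atTop_nhdsGT_zero.comp
      (tendsto_atTop_add_const_right _ _ tendsto_natCast_atTop_atTop)
  refine (h1.comp h2).abs.congr fun n => ?_
  simp only [Function.comp_apply, smul_eq_mul, inv_inv]
  rw [abs_mul, abs_of_pos (by positivity)]

lemma IsFractalBurgersSolution.integrable_abs_deriv (hα₁ : 1 < α) (hα₂ : α < 2)
    (h : IsFractalBurgersSolution α g u) (hg : HasBVDatum g V) {t : ℝ} (ht : 0 < t) :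
    Integrable fun x => |deriv (u t) x| := by
  obtain ⟨B, hB⟩ := h.exists_stripBounds (half_pos ht) (by linarith : t / 2 < t + 1)
  have hd := (hB.c11 t ⟨half_lt_self ht, by linarith⟩).diff
  have hq := fun n : ℕ => h.integral_abs_translate_sub_le hα₁ hα₂ hg
    (by positivity : 0 < ((n : ℝ) + 1)⁻¹) ht
  refine (integrable_and_integral_le_of_tendsto
    (F := fun n x => ((n : ℝ) + 1) * |u t (x + ((n : ℝ) + 1)⁻¹) - u t x|)
    (c := fun _ => V) (fun n => (hq n).1.const_mul _) (fun n x => by positivity)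
    (tendsto_differenceQuotient hd) (fun n => ?_) tendsto_const_nhds).1
  rw [integral_const_mul]
  have h1 : (0 : ℝ) < (n : ℝ) + 1 := by positivity
  have := mul_le_mul_of_nonneg_left (hq n).2 h1.le
  rwa [mul_inv_cancel_left₀ h1.ne'] at this

/-- Difference quotients of a `C^{1,1}` function converge in weighted `L¹`. -/
lemma IsC11.tendsto_integral_differenceQuotient {B : ℝ} {f χ : ℝ → ℝ} (hf : IsC11 B f)
    (hχ : Integrable χ) :
    Tendsto (fun n : ℕ => ((n : ℝ) + 1) * ∫ x, |f (x + ((n : ℝ) + 1)⁻¹) - f x| * χ x) atTop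
      (𝓝 (∫ x, |deriv f x| * χ x)) := by
  have hfc := hf.continuous
  simp_rw [← integral_const_mul, ← mul_assoc]
  refine tendsto_integral_of_dominated_convergence (fun x => 4 * B * ‖χ x‖) (fun n => ?_)
    (hχ.norm.const_mul _) (fun n => Eventually.of_forall fun x => ?_)
    (Eventually.of_forall fun x => (tendsto_differenceQuotient hf.diff x).mul_const _)
  · exact Continuous.aestronglyMeasurable (by fun_prop) |>.mul hχ.1
  · have h1 : (0 : ℝ) < (n : ℝ) + 1 := by positivity
    rw [norm_mul, norm_mul, Real.norm_of_nonneg h1.le, Real.norm_eq_abs, abs_abs]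
    refine mul_le_mul_of_nonneg_right ?_ (norm_nonneg _)
    have h2 := hf.abs_sub_sq_le x ((n : ℝ) + 1)⁻¹
    have h3 : |f (x + ((n : ℝ) + 1)⁻¹) - f x| ≤ 4 * B * ((n : ℝ) + 1)⁻¹ := by
      refine abs_le_of_sq_le_sq (h2.trans (le_of_eq (by ring))) ?_
      have := hf.nonneg
      positivity
    have := mul_le_mul_of_nonneg_left h3 h1.le
    rwa [mul_left_comm, mul_inv_cancel₀ h1.ne', mul_one] at this

/-- Uniform tightness of the space derivative on compact time intervals. -/
lemma IsFractalBurgersSolution.integral_abs_deriv_tail_le (hα₁ : 1 < α) (hα₂ : α < 2)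
    (h : IsFractalBurgersSolution α g u) (hg : HasBVDatum g V) {T M : ℝ}
    (hM : ∀ t ∈ Ioo 0 T, ∀ x, |u t x| ≤ M) {R : ℝ} (hR : 0 < R) {s t : ℝ} (hs : 0 < s)
    (hst : s ≤ t) (ht : t < T) :
    ∫ x, |deriv (u t) x| * (1 - cauchyWeight 0 R x) ≤
      (∫ x, |deriv (u s) x| * (1 - cauchyWeight 0 R x)) +
        2 * growthRate α M R * V * (t - s) := by
  have hc11 : ∀ r, 0 < r → ∃ B, IsC11 B (u r) := fun r hr => by
    obtain ⟨B, hB⟩ := h.exists_stripBounds (half_pos hr) (by linarith : r / 2 < r + 1)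
    exact ⟨B, hB.c11 r ⟨half_lt_self hr, by linarith⟩⟩
  obtain ⟨B, hB⟩ := hc11 s hs
  obtain ⟨B', hB'⟩ := hc11 t (hs.trans_le hst)
  have hL : ∀ L, R ≤ L → ∫ x, |deriv (u t) x| * (cauchyWeight 0 L x - cauchyWeight 0 R x) ≤
      (∫ x, |deriv (u s) x| * (cauchyWeight 0 L x - cauchyWeight 0 R x)) +
        2 * growthRate α M R * V * (t - s) := by
    intro L hRL
    have hχ : Integrable fun x => cauchyWeight 0 L x - cauchyWeight 0 R x :=
      (integrable_cauchyWeight 0 (hR.trans_le hRL)).sub (integrable_cauchyWeight 0 hR)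
    refine le_of_tendsto_of_tendsto' (hB'.tendsto_integral_differenceQuotient hχ)
      ((hB.tendsto_integral_differenceQuotient hχ).add_const _) fun n => ?_
    have h1 : (0 : ℝ) < (n : ℝ) + 1 := by positivity
    -- Tightness of the difference of `u` and its translate by `1 / (n + 1)`, whose mass is at most
    -- `V / (n + 1)` at all times.
    have h2 := integral_abs_sub_mul_sub_le hα₁ hα₂ (h.comp_add_right ((n : ℝ) + 1)⁻¹) h
      (fun r hr x => hM r hr _) hM hR hRL hs hst ht
      (fun r hr => h.integral_abs_translate_sub_le hα₁ hα₂ hg (inv_pos.2 h1) hr)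
    have h3 := mul_le_mul_of_nonneg_left h2 h1.le
    refine h3.trans (le_of_eq ?_)
    rw [mul_add]
    congr 1
    field_simp
  have hlim : ∀ r, 0 < r →
      Tendsto (fun L => ∫ x, |deriv (u r) x| * (cauchyWeight 0 L x - cauchyWeight 0 R x)) atTop
        (𝓝 (∫ x, |deriv (u r) x| * (1 - cauchyWeight 0 R x))) := fun r hr => by
    refine tendsto_integral_filter_of_dominated_convergence (fun x => |deriv (u r) x|)
      (Eventually.of_forall fun L => ?_)
      (Eventually.of_forall fun L => Eventually.of_forall fun x => ?_)
      (h.integrable_abs_deriv hα₁ hα₂ hg hr)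
      (Eventually.of_forall fun x => ((tendsto_cauchyWeight_atTop x).sub_const _).const_mul _)
    · exact (measurable_deriv (u r)).abs.aestronglyMeasurable.mul
        ((continuous_cauchyWeight 0 L).sub (continuous_cauchyWeight 0 R)).aestronglyMeasurable
    · rw [norm_mul, Real.norm_eq_abs, abs_abs]
      refine mul_le_of_le_one_right (abs_nonneg _) (abs_le.2 ⟨?_, ?_⟩)
      · linarith [cauchyWeight_pos 0 L x, cauchyWeight_le_one 0 R x]
      · linarith [cauchyWeight_pos 0 R x, cauchyWeight_le_one 0 L x]
  exact le_of_tendsto_of_tendsto (hlim t (hs.trans_le hst)) ((hlim s hs).add_const _)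
    ((eventually_ge_atTop R).mono hL)

/-- Continuity in time of the space derivative, in `L¹`. -/
lemma IsFractalBurgersSolution.tendsto_integral_abs_deriv_sub (hα₁ : 1 < α) (hα₂ : α < 2)
    (h : IsFractalBurgersSolution α g u) (hg : HasBVDatum g V) {t₀ : ℝ} (ht₀ : 0 < t₀) :
    Tendsto (fun t => ∫ x, |deriv (u t) x - deriv (u t₀) x|) (𝓝 t₀) (𝓝 0) := by
  have hV : 0 ≤ V := by
    have := (integral_nonneg fun x => abs_nonneg (g (x + 1) - g x)).trans
      (hg.translate 1 one_pos).2
    simpa using this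
  set s := t₀ / 2 with hs
  have hs0 : 0 < s := half_pos ht₀
  have hsT : s < t₀ + 1 := by linarith
  obtain ⟨M, hM0, hM⟩ := h.exists_bound (by linarith : 0 < t₀ + 1)
  obtain ⟨B, hB⟩ := h.exists_stripBounds hs0 hsT
  have hi := h.integrable_abs_deriv hα₁ hα₂ hg hs0
  set tail : ℝ → ℝ := fun R => (∫ x, |deriv (u s) x| * (1 - cauchyWeight 0 R x)) +
    2 * growthRate α M R * V * (t₀ + 1) with htail
  have htail0 : Tendsto tail atTop (𝓝 0) := by
    have h1 : Tendsto (fun R => ∫ x, |deriv (u s) x| * (1 - cauchyWeight 0 R x)) atTop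
        (𝓝 (∫ _ : ℝ, (0 : ℝ))) := by
      refine tendsto_integral_filter_of_dominated_convergence (fun x => |deriv (u s) x|)
        (Eventually.of_forall fun R => ?_)
        (Eventually.of_forall fun R => Eventually.of_forall fun x => ?_) hi
        (Eventually.of_forall fun x => ?_)
      · exact (measurable_deriv (u s)).abs.aestronglyMeasurable.mul
          (continuous_const.sub (continuous_cauchyWeight 0 R)).aestronglyMeasurable
      · rw [norm_mul, Real.norm_eq_abs, abs_abs]
        refine mul_le_of_le_one_right (abs_nonneg _) (abs_le.2 ⟨?_, ?_⟩)
        · linarith [cauchyWeight_le_one 0 R x]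
        · linarith [cauchyWeight_pos 0 R x]
      · have := ((tendsto_cauchyWeight_atTop x).const_sub 1).const_mul |deriv (u s) x|
        simpa using this
    have h2 := (((tendsto_growthRate hα₁ M).const_mul 2).mul_const V).mul_const (t₀ + 1)
    have h3 := h1.add h2
    simpa using h3
  -- Split at scale `R`: uniform convergence inside, tightness outside.
  have hsplit : ∀ R > 0, ∀ t ∈ Ioo s (t₀ + 1),
      ∫ x, |deriv (u t) x - deriv (u t₀) x| ≤ B * |t - t₀| * (R * Real.pi) + 2 * tail R := by
    intro R hR t ht
    have ht₀' : t₀ ∈ Ioo s (t₀ + 1) := ⟨half_lt_self ht₀, by linarith⟩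
    have hk := growthRate_nonneg hα₁ hα₂ hM0 hR
    have htl : ∀ r ∈ Ioo s (t₀ + 1), ∫ x, |deriv (u r) x| * (1 - cauchyWeight 0 R x) ≤ tail R :=
      fun r hr => by
        refine (h.integral_abs_deriv_tail_le hα₁ hα₂ hg hM hR hs0 hr.1.le hr.2).trans ?_
        have h1 : r - s ≤ t₀ + 1 := by linarith [hr.2]
        have h2 : 0 ≤ 2 * growthRate α M R * V := by positivity
        exact add_le_add le_rfl (mul_le_mul_of_nonneg_left h1 h2)
    have hti : ∀ r ∈ Ioo s (t₀ + 1),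
        Integrable fun x => |deriv (u r) x| * (1 - cauchyWeight 0 R x) := fun r hr =>
      (h.integrable_abs_deriv hα₁ hα₂ hg (hs0.trans hr.1)).mul_bdd (c := 1)
        (continuous_const.sub (continuous_cauchyWeight 0 R)).aestronglyMeasurable
        (Eventually.of_forall fun x => abs_le.2
          ⟨by linarith [cauchyWeight_le_one 0 R x], by linarith [cauchyWeight_pos 0 R x]⟩)
    have j1 := (integrable_cauchyWeight 0 hR).const_mul (B * |t - t₀|)
    have j2 := hti t ht
    have j3 := hti t₀ ht₀'
    have hpt : ∀ x, ‖|deriv (u t) x - deriv (u t₀) x|‖ ≤ B * |t - t₀| * cauchyWeight 0 R x +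
        |deriv (u t) x| * (1 - cauchyWeight 0 R x) +
        |deriv (u t₀) x| * (1 - cauchyWeight 0 R x) := fun x => by
      rw [Real.norm_eq_abs, abs_abs]
      have h1 := hB.lip_deriv t₀ ht₀' t ht x
      have h2 := abs_sub (deriv (u t) x) (deriv (u t₀) x)
      have w0 := cauchyWeight_pos 0 R x
      have w1 := cauchyWeight_le_one 0 R x
      have h3 := mul_le_mul_of_nonneg_right h1 w0.le
      have h4 := mul_le_mul_of_nonneg_right h2 (sub_nonneg.2 w1)
      linarith
    have := norm_integral_le_of_norm_le ((j1.fun_add j2).fun_add j3) (Eventually.of_forall hpt)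
    rw [integral_add (j1.fun_add j2) j3, integral_add j1 j2, integral_const_mul,
      integral_cauchyWeight 0 hR] at this
    refine (le_abs_self _).trans (this.trans ?_)
    linarith [htl t ht, htl t₀ ht₀']
  refine Metric.tendsto_nhds.2 fun ε hε => ?_
  obtain ⟨R, hR1, hR2⟩ := ((htail0.eventually_lt_const (by positivity : 0 < ε / 4)).and
    (eventually_gt_atTop 0)).exists
  have hlip : Tendsto (fun t => B * |t - t₀| * (R * Real.pi)) (𝓝 t₀) (𝓝 0) := by
    have : Tendsto (fun t => B * |t - t₀| * (R * Real.pi)) (𝓝 t₀)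
        (𝓝 (B * |t₀ - t₀| * (R * Real.pi))) := Continuous.tendsto (by fun_prop) _
    simpa using this
  filter_upwards [hlip.eventually_lt_const (by positivity : 0 < ε / 2),
    Ioo_mem_nhds (half_lt_self ht₀) (by linarith : t₀ < t₀ + 1)] with t ht1 ht2
  rw [Real.dist_eq, sub_zero, abs_of_nonneg (integral_nonneg fun x => abs_nonneg _)]
  linarith [hsplit R hR2 t ht2]

end BV

/-! ### Continuity in `L^p` -/

/-- Interpolation of `L^p` between `L¹` and the uniform norm. -/
lemma eLpNorm_le_of_enorm_le {f : ℝ → ℝ} {K p : ℝ≥0∞} (hp : 1 ≤ p) (hp' : p ≠ ⊤) (hK' : K ≠ ⊤)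
    (hK : ∀ x, ‖f x‖ₑ ≤ K) :
    eLpNorm f p volume ≤ (K ^ (p.toReal - 1) * eLpNorm f 1 volume) ^ (1 / p.toReal) := by
  have hp0 : p ≠ 0 := (zero_lt_one.trans_le hp).ne'
  have hp1 : 1 ≤ p.toReal := by
    rw [← ENNReal.toReal_one]; exact ENNReal.toReal_mono hp' hp
  have hp2 : 0 ≤ p.toReal - 1 := sub_nonneg.2 hp1
  rw [eLpNorm_eq_lintegral_rpow_enorm_toReal hp0 hp', eLpNorm_one_eq_lintegral_enorm,
    ← lintegral_const_mul' _ _ (ENNReal.rpow_ne_top_of_nonneg hp2 hK')]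
  refine ENNReal.rpow_le_rpow (lintegral_mono fun x => ?_) (by positivity)
  calc ‖f x‖ₑ ^ p.toReal = ‖f x‖ₑ ^ (p.toReal - 1 + 1) := by rw [sub_add_cancel]
    _ = ‖f x‖ₑ ^ (p.toReal - 1) * ‖f x‖ₑ := by
      rw [ENNReal.rpow_add_of_nonneg _ _ hp2 zero_le_one, ENNReal.rpow_one]
    _ ≤ K ^ (p.toReal - 1) * ‖f x‖ₑ := by gcongr; exact hK x

lemma eLpNorm_one_eq_ofReal {f : ℝ → ℝ} (hf : Integrable f) :
    eLpNorm f 1 volume = ENNReal.ofReal (∫ x, |f x|) := by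
  rw [eLpNorm_one_eq_lintegral_enorm, ← ofReal_integral_norm_eq_lintegral_enorm hf]
  rfl

lemma enorm_le_ofReal {y C : ℝ} (h : |y| ≤ C) : ‖y‖ₑ ≤ ENNReal.ofReal C := by
  rw [Real.enorm_eq_ofReal_abs]
  exact ENNReal.ofReal_le_ofReal h

section Lp

variable {α : ℝ} {g : ℝ → ℝ} {u : ℝ → ℝ → ℝ} {V : ℝ}

lemma IsFractalBurgersSolution.integrable_deriv (hα₁ : 1 < α) (hα₂ : α < 2)
    (h : IsFractalBurgersSolution α g u) (hg : HasBVDatum g V) {t : ℝ} (ht : 0 < t) :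
    Integrable (deriv (u t)) :=
  (integrable_norm_iff (measurable_deriv _).aestronglyMeasurable).1
    (h.integrable_abs_deriv hα₁ hα₂ hg ht)

lemma IsFractalBurgersSolution.memLp_deriv (hα₁ : 1 < α) (hα₂ : α < 2)
    (h : IsFractalBurgersSolution α g u) (hg : HasBVDatum g V) {p : ℝ≥0∞} (hp : 1 ≤ p) {t : ℝ}
    (ht : 0 < t) : MemLp (deriv (u t)) p volume := by
  obtain ⟨B, hB⟩ := h.exists_stripBounds (half_pos ht) (by linarith : t / 2 < t + 1)
  have hc := hB.c11 t ⟨half_lt_self ht, by linarith⟩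
  have hm : AEStronglyMeasurable (deriv (u t)) volume := (measurable_deriv _).aestronglyMeasurable
  by_cases hp' : p = ⊤
  · rw [hp']
    exact memLp_top_of_bound hm (3 * B) (Eventually.of_forall hc.abs_deriv_le)
  refine ⟨hm, (eLpNorm_le_of_enorm_le hp hp' ENNReal.ofReal_ne_top
    fun x => enorm_le_ofReal (hc.abs_deriv_le x)).trans_lt ?_⟩
  have hp1 : 1 ≤ p.toReal := by
    rw [← ENNReal.toReal_one]; exact ENNReal.toReal_mono hp' hp
  refine ENNReal.rpow_lt_top_of_nonneg (by positivity) (ENNReal.mul_ne_top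
    (ENNReal.rpow_ne_top_of_nonneg (sub_nonneg.2 hp1) ENNReal.ofReal_ne_top) ?_)
  rw [eLpNorm_one_eq_ofReal (h.integrable_deriv hα₁ hα₂ hg ht)]
  exact ENNReal.ofReal_ne_top

lemma IsFractalBurgersSolution.tendsto_eLpNorm_deriv_sub (hα₁ : 1 < α) (hα₂ : α < 2)
    (h : IsFractalBurgersSolution α g u) (hg : HasBVDatum g V) {p : ℝ≥0∞} (hp : 1 ≤ p) {t₀ : ℝ}
    (ht₀ : 0 < t₀) :
    Tendsto (fun t => eLpNorm (deriv (u t) - deriv (u t₀)) p volume) (𝓝 t₀) (𝓝 0) := by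
  have hs : t₀ / 2 < t₀ := half_lt_self ht₀
  obtain ⟨B, hB⟩ := h.exists_stripBounds (half_pos ht₀) (by linarith : t₀ / 2 < t₀ + 1)
  have ht₀' : t₀ ∈ Ioo (t₀ / 2) (t₀ + 1) := ⟨hs, by linarith⟩
  have hnhds : Ioo (t₀ / 2) (t₀ + 1) ∈ 𝓝 t₀ := Ioo_mem_nhds ht₀'.1 ht₀'.2
  by_cases hp' : p = ⊤
  · have hlim : Tendsto (fun t => ENNReal.ofReal (B * |t - t₀|)) (𝓝 t₀) (𝓝 0) := by
      have h1 : Tendsto (fun t => B * |t - t₀|) (𝓝 t₀) (𝓝 (B * |t₀ - t₀|)) :=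
        Continuous.tendsto (by fun_prop) _
      have h2 := (ENNReal.continuous_ofReal.tendsto _).comp h1
      simp only [sub_self, abs_zero, mul_zero, ENNReal.ofReal_zero] at h2
      exact h2
    refine tendsto_of_tendsto_of_tendsto_of_le_of_le' tendsto_const_nhds hlim
      (Eventually.of_forall fun _ => zero_le) ?_
    filter_upwards [hnhds] with t ht
    rw [hp', eLpNorm_exponent_top]
    exact eLpNormEssSup_le_of_ae_bound
      (Eventually.of_forall fun x => hB.lip_deriv t₀ ht₀' t ht x)
  · have hp1 : 1 ≤ p.toReal := by
      rw [← ENNReal.toReal_one]; exact ENNReal.toReal_mono hp' hp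
    set K : ℝ≥0∞ := ENNReal.ofReal (6 * B)
    have hlim : Tendsto (fun t => (K ^ (p.toReal - 1) *
        ENNReal.ofReal (∫ x, |deriv (u t) x - deriv (u t₀) x|)) ^ (1 / p.toReal)) (𝓝 t₀)
        (𝓝 0) := by
      have h1 := (ENNReal.continuous_ofReal.tendsto _).comp
        (h.tendsto_integral_abs_deriv_sub hα₁ hα₂ hg ht₀)
      have h2 := ENNReal.Tendsto.const_mul (a := K ^ (p.toReal - 1)) h1
        (Or.inr (ENNReal.rpow_ne_top_of_nonneg (sub_nonneg.2 hp1) ENNReal.ofReal_ne_top))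
      have h3 := ((ENNReal.continuous_rpow_const (y := 1 / p.toReal)).tendsto _).comp h2
      rw [ENNReal.ofReal_zero, mul_zero, ENNReal.zero_rpow_of_pos (by positivity)] at h3
      exact h3
    refine tendsto_of_tendsto_of_tendsto_of_le_of_le' tendsto_const_nhds hlim
      (Eventually.of_forall fun _ => zero_le) ?_
    filter_upwards [hnhds] with t ht
    refine (eLpNorm_le_of_enorm_le (K := K) hp hp' ENNReal.ofReal_ne_top fun x =>
      enorm_le_ofReal ?_).trans (le_of_eq ?_)
    · rw [Pi.sub_apply]
      have := abs_sub (deriv (u t) x) (deriv (u t₀) x)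
      linarith [(hB.c11 t ht).abs_deriv_le x, (hB.c11 t₀ ht₀').abs_deriv_le x]
    · rw [eLpNorm_one_eq_ofReal ((h.integrable_deriv hα₁ hα₂ hg
        ((half_pos ht₀).trans ht.1)).sub (h.integrable_deriv hα₁ hα₂ hg ht₀))]
      rfl

end Lp

theorem theorem2p2 (α : ℝ) (hα₁ : 1 < α) (hα₂ : α < 2) :
    (∀ (u₀ : ℝ → ℝ) (u : ℝ → ℝ → ℝ),
      IsStepConvolution u₀ → IsFractalBurgersSolution α u₀ u →
      ∀ (p : ℝ≥0∞) [Fact (1 ≤ p)] (T : ℝ), 0 < T →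
        IsContinuousInLp p (Ioc 0 T) (fun t => deriv (u t))) ∧
    (∀ (u₀ v₀ : ℝ → ℝ) (u v : ℝ → ℝ → ℝ),
      IsStepConvolution u₀ → IsFractalBurgersSolution α u₀ u →
      IsStepConvolution v₀ → IsFractalBurgersSolution α v₀ v →
      (∀ᵐ z : ℝ × ℝ ∂(volume.restrict (Ioi 0 ×ˢ univ)), 0 ≤ deriv (v z.1) z.2) →
      Integrable (fun x => u₀ x - v₀ x) →
      ∀ t : ℝ, 0 < t →
        eLpNorm (fun x => u t x - v t x) 1 volume ≤
          eLpNorm (fun x => u₀ x - v₀ x) 1 volume) := by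
  constructor
  · intro u₀ u hu₀ hu p hp T _
    obtain ⟨g, V, hug, hg, hV⟩ := hu₀.exists_representative
    have hbv : HasBVDatum g V := ⟨hg, hV⟩
    have hsol := hu.congr_initial hug
    refine ⟨fun t => hsol.memLp_deriv hα₁ hα₂ hbv hp.out t.2.1, ?_⟩
    refine continuous_iff_continuousAt.2 fun t₀ => ?_
    refine (Lp.tendsto_Lp_iff_tendsto_eLpNorm'' _ _ _ _).2 ?_
    exact (hsol.tendsto_eLpNorm_deriv_sub hα₁ hα₂ hbv hp.out t₀.2.1).comp continuousAt_subtype_val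
  · intro u₀ v₀ u v hu₀ hu hv₀ hv _ hint t ht
    obtain ⟨g, V, hug, hg, -⟩ := hu₀.exists_representative
    obtain ⟨g', V', hvg, hg', -⟩ := hv₀.exists_representative
    have hae : (fun x => u₀ x - v₀ x) =ᵐ[volume] fun x => g x - g' x := hug.sub hvg
    have hint' := hint.congr hae
    obtain ⟨h1, h2⟩ := integrable_sub_and_integral_abs_sub_le hα₁ hα₂ (hu.congr_initial hug) hg
      (hv.congr_initial hvg) hg' hint' ht
    obtain ⟨B, hB⟩ := hu.exists_stripBounds (half_pos ht) (by linarith : t / 2 < t + 1)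
    obtain ⟨B', hB'⟩ := hv.exists_stripBounds (half_pos ht) (by linarith : t / 2 < t + 1)
    have hmem : t ∈ Ioo (t / 2) (t + 1) := ⟨half_lt_self ht, by linarith⟩
    have hw : Integrable fun x => u t x - v t x :=
      (integrable_norm_iff ((hB.c11 t hmem).continuous.sub
        (hB'.c11 t hmem).continuous).aestronglyMeasurable).1 h1
    rw [eLpNorm_congr_ae hae, eLpNorm_one_eq_ofReal hw, eLpNorm_one_eq_ofReal hint']
    exact ENNReal.ofReal_le_ofReal h2
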